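/- **Proposition 4.2** (the double of $k^\phi(G)$ is the Dijkgraaf–Pasquier–Roche algebra). Let $k$ be a field, $G$ a finite group with identity $e$, and $\phi:G^3\to k^\times$ a normalised 3-cocycle: $$\phi(y,s,t)\,\phi(x,ys,t)\,\phi(x,y,s)=\phi(x,y,st)\,\phi(xy,s,t),\qquad \phi(x,e,y)=1 .$$ Let $k^\phi(G)$ be the quasi-Hopf algebra of functions on $G$, with $(\Delta f)(a,b)=f(ab)$, $\varepsilon(f)=f(e)$, associator $\phi\in k(G)^{\otimes3}$ and antipode $(Sf)(x)=f(x^{-1})$; let $\delta_s\in k(G)$ be the delta-functions. A quasi-Hopf algebra $H$ with associator $\phi_H$ satisfies $({\rm id}\otimes\Delta)\Delta=\phi_H((\Delta\otimes{\rm id})\Delta(\cdot))\phi_H^{-1}$ and the other axioms of Drinfeld, with bijective antipode; its modules form a monoidal category ${}_H\mathcal M$ with associativity isomorphism the action of $\phi_H$. If $H$ is quasitriangular, with invertible $\mathcal R\in H\otimes H$ obeying $\Delta^{\rm op}=\mathcal R\Delta(\cdot)\mathcal R^{-1}$ and the two hexagon identities, ${}_H\mathcal M$ is braided by $v\otimes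 w\mapsto \mathcal R^{(2)}w\otimes\mathcal R^{(1)}v$. A *quantum double* of a quasi-Hopf algebra $H$ is a quasitriangular quasi-Hopf algebra $D$ together with a braided monoidal equivalence from ${}_D\mathcal M$ to the double (Drinfeld centre) $({}_H\mathcal M)^\circ$ of ${}_H\mathcal M$, and a natural $k$-linear identification of underlying $k$-modules compatible with tensor products and units. Here objects of $({}_H\mathcal M)^\circ$ are pairs $(V,\lambda)$ of an $H$-module $V$ and a monoidal natural isomorphism $\lambda_W:V\otimes W\to W\otimes V$ ($W\in{}_H\mathcal M$), and the braiding is given by $\lambda$. Then $k^\phi(G)$ has a quantum double, and every quantum double of $k^\phi(G)$ is the quasi-Hopf algebra $D^\phi(G)=kG^{\rm op}\ltimes_\chi k(G)$: it has a $k$-basis $\{x\otimes\delta_s\}_{x,s\in G}$ in which $$(x\otimes\delta_s)(y\otimes\delta_t)=\delta_{ysy^{-1},t}\;\chi(y,x)(t)\; yx\otimes\delta_t,\qquad 1=\sum_s e\otimes\delta_s,$$ $$\chi(x,y)(s)=\frac{\phi(x,y,y^{-1}x^{-1}sxy)\,\phi(s,x,y)}{\phi(x,x^{-1}sx,y)},$$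 $$\Delta(x\otimes\delta_s)=\sum_{ab=s}\frac{\phi(x,x^{-1}ax,x^{-1}bx)\,\phi(a,b,x)}{\phi(a,x,x^{-1}bx)}\,(x\otimes\delta_a)\otimes(x\otimes\delta_b),\qquad \varepsilon(x\otimes\delta_s)=\delta_{s,e},$$ the associator is $\sum_{x,y,z}\phi(x,y,z)\,(e\otimes\delta_x)\otimes(e\otimes\delta_y)\otimes(e\otimes\delta_z)$, and the quasitriangular structure is $$\mathcal R=\sum_{x\in G}(x\otimes 1)\otimes(e\otimes\delta_x),\qquad x\otimes1:=\sum_s x\otimes\delta_s .$$ Under the identification of ${}_D\mathcal M$ with the double category, for $(V,\lambda)$ in the latter $x\otimes\delta_s$ acts by $v\mapsto\langle x,\beta(\delta_s v)\rangle$, where $\beta:V\to k(G)\otimes V$, $\beta(v)=\lambda_{k(G)}(v\otimes1)$ with $k(G)$ the left regular module, and $\langle x,\cdot\rangle$ evaluates the first factor at $x$. -/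

import Mathlib

open scoped TensorProduct
open CategoryTheory MonoidalCategory

universe u

namespace QuasiHopf

section Algebra

variable (k : Type u) [CommRing k] (H : Type u) [Ring H] [Algebra k H]

/-- The rebracketing isomorphism of algebras `(A ⊗ B) ⊗ C → A ⊗ (B ⊗ C)`. Higher tensor powers
of `H` are always nested to the right, as in `H ⊗ (H ⊗ H)`. -/
noncomputable abbrev reassoc (A B C : Type u) [Ring A] [Algebra k A] [Ring B] [Algebra k B]
    [Ring C] [Algebra k C] : (A ⊗[k] B) ⊗[k] C →ₐ[k] A ⊗[k] (B ⊗[k] C) :=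
  (Algebra.TensorProduct.assoc k k k A B C).toAlgHom

variable {k H}

/-- `Δ ⊗ id ⊗ id` on the threefold tensor power. -/
noncomputable def comulFst (Δ : H →ₐ[k] H ⊗[k] H) :
    H ⊗[k] (H ⊗[k] H) →ₐ[k] H ⊗[k] (H ⊗[k] (H ⊗[k] H)) :=
  (reassoc k H H (H ⊗[k] H)).comp
    (Algebra.TensorProduct.map Δ (AlgHom.id k (H ⊗[k] H)))

/-- `id ⊗ Δ ⊗ id` on the threefold tensor power. -/
noncomputable def comulSnd (Δ : H →ₐ[k] H ⊗[k] H) :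
    H ⊗[k] (H ⊗[k] H) →ₐ[k] H ⊗[k] (H ⊗[k] (H ⊗[k] H)) :=
  Algebra.TensorProduct.map (AlgHom.id k H)
    ((reassoc k H H H).comp (Algebra.TensorProduct.map Δ (AlgHom.id k H)))

/-- `id ⊗ id ⊗ Δ` on the threefold tensor power. -/
noncomputable def comulTrd (Δ : H →ₐ[k] H ⊗[k] H) :
    H ⊗[k] (H ⊗[k] H) →ₐ[k] H ⊗[k] (H ⊗[k] (H ⊗[k] H)) :=
  Algebra.TensorProduct.map (AlgHom.id k H)
    (Algebra.TensorProduct.map (AlgHom.id k H) Δ)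

variable (k H)

/-- `a ⊗ b ⊗ c ↦ a ⊗ b ⊗ c ⊗ 1`. -/
noncomputable def padRight : H ⊗[k] (H ⊗[k] H) →ₐ[k] H ⊗[k] (H ⊗[k] (H ⊗[k] H)) :=
  Algebra.TensorProduct.map (AlgHom.id k H)
    (Algebra.TensorProduct.map (AlgHom.id k H) Algebra.TensorProduct.includeLeft)

/-- `a ⊗ b ⊗ c ↦ 1 ⊗ a ⊗ b ⊗ c`. -/
noncomputable def padLeft : H ⊗[k] (H ⊗[k] H) →ₐ[k] H ⊗[k] (H ⊗[k] (H ⊗[k] H)) :=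
  Algebra.TensorProduct.includeRight

/-- `x ↦ x₁₂`, that is `a ⊗ b ↦ a ⊗ b ⊗ 1`. -/
noncomputable def leg12 : H ⊗[k] H →ₐ[k] H ⊗[k] (H ⊗[k] H) :=
  Algebra.TensorProduct.map (AlgHom.id k H) Algebra.TensorProduct.includeLeft

/-- `x ↦ x₁₃`, that is `a ⊗ b ↦ a ⊗ 1 ⊗ b`. -/
noncomputable def leg13 : H ⊗[k] H →ₐ[k] H ⊗[k] (H ⊗[k] H) :=
  Algebra.TensorProduct.map (AlgHom.id k H) Algebra.TensorProduct.includeRight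

/-- `x ↦ x₂₃`, that is `a ⊗ b ↦ 1 ⊗ a ⊗ b`. -/
noncomputable def leg23 : H ⊗[k] H →ₐ[k] H ⊗[k] (H ⊗[k] H) :=
  Algebra.TensorProduct.includeRight

/-- `x ↦ x₃₁₂`: the first component is put in slot `3`, the second in slot `1`, the third in
slot `2`, that is `a ⊗ b ⊗ c ↦ b ⊗ c ⊗ a`. -/
noncomputable def leg312 : H ⊗[k] (H ⊗[k] H) →ₐ[k] H ⊗[k] (H ⊗[k] H) :=
  (reassoc k H H H).comp (Algebra.TensorProduct.comm k H (H ⊗[k] H)).toAlgHom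

/-- `x ↦ x₂₃₁`: the first component is put in slot `2`, the second in slot `3`, the third in
slot `1`, that is `a ⊗ b ⊗ c ↦ c ⊗ a ⊗ b`. -/
noncomputable def leg231 : H ⊗[k] (H ⊗[k] H) →ₐ[k] H ⊗[k] (H ⊗[k] H) :=
  (Algebra.TensorProduct.comm k (H ⊗[k] H) H).toAlgHom.comp
    (Algebra.TensorProduct.assoc k k k H H H).symm.toAlgHom

/-- `x ↦ x₁₃₂`, that is `a ⊗ b ⊗ c ↦ a ⊗ c ⊗ b`. -/
noncomputable def leg132 : H ⊗[k] (H ⊗[k] H) →ₐ[k] H ⊗[k] (H ⊗[k] H) :=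
  Algebra.TensorProduct.map (AlgHom.id k H) (Algebra.TensorProduct.comm k H H).toAlgHom

/-- `x ↦ x₂₁₃`, that is `a ⊗ b ⊗ c ↦ b ⊗ a ⊗ c`. -/
noncomputable def leg213 : H ⊗[k] (H ⊗[k] H) →ₐ[k] H ⊗[k] (H ⊗[k] H) :=
  (reassoc k H H H).comp
    ((Algebra.TensorProduct.map (Algebra.TensorProduct.comm k H H).toAlgHom
      (AlgHom.id k H)).comp (Algebra.TensorProduct.assoc k k k H H H).symm.toAlgHom)

/-- A quasi-bialgebra structure on the unital algebra `H` over `k`. -/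
structure QuasiBialgebra where
  /-- the coproduct `Δ` -/
  comul : H →ₐ[k] H ⊗[k] H
  /-- the counit `ε` -/
  counit : H →ₐ[k] k
  /-- the associator `φ`, an invertible element of `H ⊗ H ⊗ H` -/
  phi : (H ⊗[k] (H ⊗[k] H))ˣ
  /-- `(id ⊗ Δ) Δ h = φ · ((Δ ⊗ id) Δ h) · φ⁻¹` -/
  quasi_coassoc : ∀ h : H,
    Algebra.TensorProduct.map (AlgHom.id k H) comul (comul h) =
      phi.val * reassoc k H H H
        (Algebra.TensorProduct.map comul (AlgHom.id k H) (comul h)) * phi.inv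
  /-- `(ε ⊗ id) Δ h = h` -/
  counit_left : ∀ h : H, Algebra.TensorProduct.lid k H
    (Algebra.TensorProduct.map counit (AlgHom.id k H) (comul h)) = h
  /-- `(id ⊗ ε) Δ h = h` -/
  counit_right : ∀ h : H, Algebra.TensorProduct.rid k k H
    (Algebra.TensorProduct.map (AlgHom.id k H) counit (comul h)) = h
  /-- `(1 ⊗ φ) · (id ⊗ Δ ⊗ id) φ · (φ ⊗ 1) = (id ⊗ id ⊗ Δ) φ · (Δ ⊗ id ⊗ id) φ` -/
  cocycle : padLeft k H phi.val * comulSnd comul phi.val * padRight k H phi.val =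
    comulTrd comul phi.val * comulFst comul phi.val
  /-- `(id ⊗ ε ⊗ id) φ = 1 ⊗ 1` -/
  normalized : Algebra.TensorProduct.map (AlgHom.id k H)
    ((Algebra.TensorProduct.lid k H).toAlgHom.comp
      (Algebra.TensorProduct.map counit (AlgHom.id k H))) phi.val = 1

/-- A quasi-Hopf algebra structure on `H`: a quasi-bialgebra with an antipode `(S, α, β)`,
where `S` is a bijective algebra antihomomorphism. -/
structure QuasiHopfAlgebra extends QuasiBialgebra k H where
  /-- the antipode `S`, an antiautomorphism of the algebra `H` -/
  S : H ≃ₐ[k] Hᵐᵒᵖ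
  /-- the element `α` -/
  α : H
  /-- the element `β` -/
  β : H
  /-- `∑ S(h₁) α h₂ = ε(h) α` -/
  antipode_left : ∀ h : H,
    TensorProduct.lift ((LinearMap.mul k H).compl₁₂
      (LinearMap.mulRight k α ∘ₗ (MulOpposite.opLinearEquiv k).symm.toLinearMap ∘ₗ
        S.toLinearMap) LinearMap.id) (comul h) = counit h • α
  /-- `∑ h₁ β S(h₂) = ε(h) β` -/
  antipode_right : ∀ h : H,
    TensorProduct.lift ((LinearMap.mul k H).compl₁₂
      (LinearMap.mulRight k β)
      ((MulOpposite.opLinearEquiv k).symm.toLinearMap ∘ₗ S.toLinearMap)) (comul h) =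
        counit h • β
  /-- `∑ φ¹ β S(φ²) α φ³ = 1` -/
  antipode_phi :
    TensorProduct.lift ((LinearMap.mul k H).compl₁₂
      (LinearMap.mulRight k β)
      (TensorProduct.lift ((LinearMap.mul k H).compl₁₂
        (LinearMap.mulRight k α ∘ₗ (MulOpposite.opLinearEquiv k).symm.toLinearMap ∘ₗ
          S.toLinearMap) LinearMap.id))) phi.val = 1
  /-- `∑ S(φ⁻¹) α φ⁻² β S(φ⁻³) = 1`, where `φ⁻¹ ⊗ φ⁻² ⊗ φ⁻³` are the components of the
  inverse of `φ` -/
  antipode_phi_inv :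
    TensorProduct.lift ((LinearMap.mul k H).compl₁₂
      (LinearMap.mulRight k α ∘ₗ (MulOpposite.opLinearEquiv k).symm.toLinearMap ∘ₗ
        S.toLinearMap)
      (TensorProduct.lift ((LinearMap.mul k H).compl₁₂
        (LinearMap.mulRight k β)
        ((MulOpposite.opLinearEquiv k).symm.toLinearMap ∘ₗ S.toLinearMap)))) phi.inv = 1

/-- A quasitriangular quasi-Hopf algebra structure on `H`. -/
structure QuasitriangularQuasiHopfAlgebra extends QuasiHopfAlgebra k H where
  /-- the universal R-matrix, an invertible element of `H ⊗ H` -/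
  R : (H ⊗[k] H)ˣ
  /-- `Δᵒᵖ(h) R = R Δ(h)` -/
  quasi_cocomm : ∀ h : H,
    Algebra.TensorProduct.comm k H H (comul h) * R.val = R.val * comul h
  /-- `(Δ ⊗ id) R = φ₃₁₂ R₁₃ φ₁₃₂⁻¹ R₂₃ φ` -/
  hexagon_fst : reassoc k H H H (Algebra.TensorProduct.map comul (AlgHom.id k H) R.val) =
    leg312 k H phi.val * leg13 k H R.val * leg132 k H phi.inv * leg23 k H R.val * phi.val
  /-- `(id ⊗ Δ) R = φ₂₃₁⁻¹ R₁₃ φ₂₁₃ R₁₂ φ⁻¹` -/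
  hexagon_snd : Algebra.TensorProduct.map (AlgHom.id k H) comul R.val =
    leg231 k H phi.inv * leg13 k H R.val * leg213 k H phi.val * leg12 k H R.val * phi.inv

end Algebra

section Modules

variable {k : Type u} [CommRing k] {H : Type u} [Ring H] [Algebra k H]

/-- A left module over the algebra underlying the quasi-bialgebra `Q`, given by a `k`-module and
a representation on it. The structure `Q` is recorded in the type since it determines the tensor
product of modules. -/
structure QMod (Q : QuasiBialgebra k H) : Type (u + 1) where
  /-- the underlying `k`-module -/
  V : Type u
  [addCommGroup : AddCommGroup V]
  [module : Module k V]
  /-- the action -/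
  ρ : H →ₐ[k] Module.End k V

attribute [instance] QMod.addCommGroup QMod.module

namespace QMod

variable {Q : QuasiBialgebra k H}

/-- Morphisms of modules. -/
@[ext]
structure Hom (M N : QMod Q) where
  /-- the underlying linear map -/
  lin : M.V →ₗ[k] N.V
  comm : ∀ h : H, lin ∘ₗ M.ρ h = N.ρ h ∘ₗ lin

instance : Category (QMod Q) where
  Hom M N := Hom M N
  id M := ⟨LinearMap.id, fun _ => rfl⟩
  comp f g := ⟨g.lin ∘ₗ f.lin, fun h => by
    rw [LinearMap.comp_assoc, f.comm, ← LinearMap.comp_assoc, g.comm, LinearMap.comp_assoc]⟩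

/-- The linear map underlying a morphism of modules. -/
def Hom.toLin {M N : QMod Q} (f : M ⟶ N) : M.V →ₗ[k] N.V := Hom.lin f

@[ext]
theorem hom_ext {M N : QMod Q} {f g : M ⟶ N} (h : Hom.toLin f = Hom.toLin g) : f = g :=
  Hom.ext h

@[simp] theorem id_toLin (M : QMod Q) : Hom.toLin (𝟙 M) = LinearMap.id := rfl

@[simp] theorem comp_toLin {M N P : QMod Q} (f : M ⟶ N) (g : N ⟶ P) :
    Hom.toLin (f ≫ g) = Hom.toLin g ∘ₗ Hom.toLin f := rfl

theorem toLin_comm {M N : QMod Q} (f : M ⟶ N) (h : H) :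
    Hom.toLin f ∘ₗ M.ρ h = N.ρ h ∘ₗ Hom.toLin f := Hom.comm f h

/-- An invertible intertwiner is an isomorphism. -/
def isoMk {M N : QMod Q} (e : M.V ≃ₗ[k] N.V)
    (comm : ∀ h : H, e.toLinearMap ∘ₗ M.ρ h = N.ρ h ∘ₗ e.toLinearMap) : M ≅ N where
  hom := ⟨e.toLinearMap, comm⟩
  inv := ⟨e.symm.toLinearMap, fun h => by
    apply LinearMap.ext; intro x
    apply e.injective
    have := LinearMap.congr_fun (comm h) (e.symm x)
    simpa using this.symm⟩
  hom_inv_id := by ext x; exact e.symm_apply_apply x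
  inv_hom_id := by ext x; exact e.apply_symm_apply x

end QMod

/-- The action of `A ⊗ B` on `V ⊗ W` obtained from actions of `A` on `V` and of `B` on `W`. -/
noncomputable def act {A B V W : Type u} [Ring A] [Algebra k A] [Ring B] [Algebra k B]
    [AddCommGroup V] [Module k V] [AddCommGroup W] [Module k W]
    (a : A →ₐ[k] Module.End k V) (b : B →ₐ[k] Module.End k W) :
    A ⊗[k] B →ₐ[k] Module.End k (V ⊗[k] W) :=
  (Module.endTensorEndAlgHom (R := k) (S := k) (A := k) (M := V) (N := W)).comp
    (Algebra.TensorProduct.map a b)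

@[simp] theorem act_tmul {A B V W : Type u} [Ring A] [Algebra k A] [Ring B] [Algebra k B]
    [AddCommGroup V] [Module k V] [AddCommGroup W] [Module k W]
    (a : A →ₐ[k] Module.End k V) (b : B →ₐ[k] Module.End k W) (x : A) (y : B) :
    act a b (x ⊗ₜ y) = TensorProduct.map (a x) (b y) := by
  simp [act, Module.endTensorEndAlgHom_apply]
  rfl

section ActLemmas

variable {A B C A' B' V W Z V' W' : Type u}
  [Ring A] [Algebra k A] [Ring B] [Algebra k B] [Ring C] [Algebra k C]
  [Ring A'] [Algebra k A'] [Ring B'] [Algebra k B']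
  [AddCommGroup V] [Module k V] [AddCommGroup W] [Module k W] [AddCommGroup Z] [Module k Z]
  [AddCommGroup V'] [Module k V'] [AddCommGroup W'] [Module k W']

theorem act_map (a : A →ₐ[k] Module.End k V) (b : B →ₐ[k] Module.End k W)
    (f : A' →ₐ[k] A) (g : B' →ₐ[k] B) (x : A' ⊗[k] B') :
    act (a.comp f) (b.comp g) x = act a b (Algebra.TensorProduct.map f g x) := by
  induction x using TensorProduct.induction_on with
  | zero => simp
  | tmul x y => simp
  | add x y hx hy => simp only [map_add, hx, hy]

theorem act_natural {a : A →ₐ[k] Module.End k V} {b : B →ₐ[k] Module.End k W}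
    {a' : A →ₐ[k] Module.End k V'} {b' : B →ₐ[k] Module.End k W'}
    {f : V →ₗ[k] V'} {g : W →ₗ[k] W'}
    (hf : ∀ x, f ∘ₗ a x = a' x ∘ₗ f) (hg : ∀ y, g ∘ₗ b y = b' y ∘ₗ g) (x : A ⊗[k] B) :
    TensorProduct.map f g ∘ₗ act a b x = act a' b' x ∘ₗ TensorProduct.map f g := by
  induction x using TensorProduct.induction_on with
  | zero => simp
  | tmul x y => simp only [act_tmul, ← TensorProduct.map_comp, hf, hg]
  | add x y hx hy => simp only [map_add, LinearMap.comp_add, LinearMap.add_comp, hx, hy]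

theorem act_assoc (a : A →ₐ[k] Module.End k V) (b : B →ₐ[k] Module.End k W)
    (c : C →ₐ[k] Module.End k Z) (x : (A ⊗[k] B) ⊗[k] C) :
    (TensorProduct.assoc k V W Z).toLinearMap ∘ₗ act (act a b) c x =
      act a (act b c) (reassoc k A B C x) ∘ₗ (TensorProduct.assoc k V W Z).toLinearMap := by
  induction x using TensorProduct.induction_on with
  | zero => simp
  | tmul x z =>
    induction x using TensorProduct.induction_on with
    | zero => simp
    | tmul x y => ext; simp
    | add x y hx hy =>
      simp only [TensorProduct.add_tmul, map_add, LinearMap.comp_add, LinearMap.add_comp, hx, hy]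
  | add x y hx hy => simp only [map_add, LinearMap.comp_add, LinearMap.add_comp, hx, hy]

theorem act_comm (a : A →ₐ[k] Module.End k V) (b : B →ₐ[k] Module.End k W) (x : A ⊗[k] B) :
    (TensorProduct.comm k V W).toLinearMap ∘ₗ act a b x =
      act b a (Algebra.TensorProduct.comm k A B x) ∘ₗ
        (TensorProduct.comm k V W).toLinearMap := by
  induction x using TensorProduct.induction_on with
  | zero => simp
  | tmul x y => ext; simp
  | add x y hx hy => simp only [map_add, LinearMap.comp_add, LinearMap.add_comp, hx, hy]

theorem act_lid (e : A →ₐ[k] k) (b : B →ₐ[k] Module.End k W) (x : A ⊗[k] B) :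
    (TensorProduct.lid k W).toLinearMap ∘ₗ act ((Algebra.lmul k k).comp e) b x =
      b (Algebra.TensorProduct.lid k B
        (Algebra.TensorProduct.map e (AlgHom.id k B) x)) ∘ₗ
          (TensorProduct.lid k W).toLinearMap := by
  induction x using TensorProduct.induction_on with
  | zero => simp
  | tmul x y => ext; simp
  | add x y hx hy => simp only [map_add, LinearMap.comp_add, LinearMap.add_comp, hx, hy]

theorem act_rid (a : A →ₐ[k] Module.End k V) (e : B →ₐ[k] k) (x : A ⊗[k] B) :
    (TensorProduct.rid k V).toLinearMap ∘ₗ act a ((Algebra.lmul k k).comp e) x =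
      a (Algebra.TensorProduct.rid k k A
        (Algebra.TensorProduct.map (AlgHom.id k A) e x)) ∘ₗ
          (TensorProduct.rid k V).toLinearMap := by
  induction x using TensorProduct.induction_on with
  | zero => simp
  | tmul x y => ext; simp
  | add x y hx hy => simp only [map_add, LinearMap.comp_add, LinearMap.add_comp, hx, hy]

/-- An invertible element of an algebra acts by a linear automorphism. -/
def actUnit (a : A →ₐ[k] Module.End k V) (x : Aˣ) : V ≃ₗ[k] V :=
  LinearEquiv.ofLinearMap (a x.val) (a x.inv)
    (by rw [← Module.End.mul_eq_comp, ← map_mul, x.val_inv, map_one]; rfl)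
    (by rw [← Module.End.mul_eq_comp, ← map_mul, x.inv_val, map_one]; rfl)

@[simp] theorem actUnit_coe (a : A →ₐ[k] Module.End k V) (x : Aˣ) :
    (actUnit a x).toLinearMap = a x.val := rfl

variable {X Y : Type u} [AddCommGroup X] [Module k X] [AddCommGroup Y] [Module k Y]
  (Q : QuasiBialgebra k H)
  (w : H →ₐ[k] Module.End k W) (x : H →ₐ[k] Module.End k X) (y : H →ₐ[k] Module.End k Y)
  (z : H →ₐ[k] Module.End k Z)

theorem act_comp_left (t : H ⊗[k] A) (a : A →ₐ[k] Module.End k Z) :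
    act ((act w x).comp Q.comul) a t =
      act (act w x) a (Algebra.TensorProduct.map Q.comul (AlgHom.id k A) t) :=
  act_map (act w x) a Q.comul (AlgHom.id k A) t

theorem act_comp_right (t : A ⊗[k] H) (a : A →ₐ[k] Module.End k Z) :
    act a ((act w x).comp Q.comul) t =
      act a (act w x) (Algebra.TensorProduct.map (AlgHom.id k A) Q.comul t) :=
  act_map a (act w x) (AlgHom.id k A) Q.comul t

theorem assoc_intertwines (h : H) :
    (act w (act x y) Q.phi.val ∘ₗ (TensorProduct.assoc k W X Y).toLinearMap) ∘ₗ
        act ((act w x).comp Q.comul) y (Q.comul h) =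
      act w ((act x y).comp Q.comul) (Q.comul h) ∘ₗ
        (act w (act x y) Q.phi.val ∘ₗ (TensorProduct.assoc k W X Y).toLinearMap) := by
  rw [act_comp_left, act_comp_right, LinearMap.comp_assoc, act_assoc, ← LinearMap.comp_assoc,
    ← LinearMap.comp_assoc, Q.quasi_coassoc]
  simp only [← Module.End.mul_eq_comp, ← map_mul]
  rw [mul_assoc, Q.phi.inv_val, mul_one]

theorem map_id_act (f : A' →ₐ[k] Module.End k V) (a : A →ₐ[k] Module.End k W) (t : A) :
    TensorProduct.map (LinearMap.id (R := k) (M := V)) (a t) = act f a (1 ⊗ₜ t) := by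
  rw [act_tmul, map_one]; rfl

theorem map_act_id (f : A' →ₐ[k] Module.End k V) (a : A →ₐ[k] Module.End k W) (t : A) :
    TensorProduct.map (a t) (LinearMap.id (R := k) (M := V)) = act a f (t ⊗ₜ 1) := by
  rw [act_tmul, map_one]; rfl

theorem map_id_comp_act (a : A →ₐ[k] Module.End k V) (b : B →ₐ[k] Module.End k W)
    (b' : B' →ₐ[k] Module.End k W') (g : W →ₗ[k] W') (f : B →ₐ[k] B')
    (h : ∀ t, g ∘ₗ b t = b' (f t) ∘ₗ g) (t : A ⊗[k] B) :
    TensorProduct.map LinearMap.id g ∘ₗ act a b t =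
      act a b' (Algebra.TensorProduct.map (AlgHom.id k A) f t) ∘ₗ
        TensorProduct.map LinearMap.id g := by
  rw [← act_map]
  exact act_natural (a := a) (a' := a.comp (AlgHom.id k A)) (b := b) (b' := b'.comp f)
    (fun _ => rfl) h t

theorem map_comp_act_id (a : A →ₐ[k] Module.End k V) (b : B →ₐ[k] Module.End k W)
    (a' : A' →ₐ[k] Module.End k V') (g : V →ₗ[k] V') (f : A →ₐ[k] A')
    (h : ∀ t, g ∘ₗ a t = a' (f t) ∘ₗ g) (t : A ⊗[k] B) :
    TensorProduct.map g LinearMap.id ∘ₗ act a b t =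
      act a' b (Algebra.TensorProduct.map f (AlgHom.id k B) t) ∘ₗ
        TensorProduct.map g LinearMap.id := by
  rw [← act_map]
  exact act_natural (a := a) (a' := a'.comp f) (b := b) (b' := b.comp (AlgHom.id k B))
    h (fun _ => rfl) t

theorem reassoc_phi_one (t : H ⊗[k] (H ⊗[k] H)) :
    Algebra.TensorProduct.map (AlgHom.id k H) (reassoc k H H H)
      (reassoc k H (H ⊗[k] H) H (t ⊗ₜ 1)) = padRight k H t := by
  induction t using TensorProduct.induction_on with
  | zero => simp
  | tmul a t =>
    induction t using TensorProduct.induction_on with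
    | zero => simp
    | tmul b c => simp [padRight]
    | add x y hx hy =>
      simp only [TensorProduct.tmul_add, TensorProduct.add_tmul, map_add, hx, hy]
  | add x y hx hy => simp only [TensorProduct.add_tmul, map_add, hx, hy]

theorem pentagon_linear :
    TensorProduct.map (LinearMap.id (R := k) (M := W))
        (act x (act y z) Q.phi.val ∘ₗ (TensorProduct.assoc k X Y Z).toLinearMap) ∘ₗ
      (act w (act ((act x y).comp Q.comul) z) Q.phi.val ∘ₗ
        (TensorProduct.assoc k W (X ⊗[k] Y) Z).toLinearMap) ∘ₗ
      TensorProduct.map (act w (act x y) Q.phi.val ∘ₗ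
        (TensorProduct.assoc k W X Y).toLinearMap) (LinearMap.id (R := k) (M := Z)) =
    (act w (act x ((act y z).comp Q.comul)) Q.phi.val ∘ₗ
        (TensorProduct.assoc k W X (Y ⊗[k] Z)).toLinearMap) ∘ₗ
      (act ((act w x).comp Q.comul) (act y z) Q.phi.val ∘ₗ
        (TensorProduct.assoc k (W ⊗[k] X) Y Z).toLinearMap) := by
  set A₄ := act w (act x (act y z)) with hA₄
  set l := TensorProduct.map (LinearMap.id (R := k) (M := W))
    (TensorProduct.assoc k X Y Z).toLinearMap with hl
  set r := TensorProduct.map (TensorProduct.assoc k W X Y).toLinearMap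
    (LinearMap.id (R := k) (M := Z)) with hr
  set as := (TensorProduct.assoc k W (X ⊗[k] Y) Z).toLinearMap with has
  have hcoh : l ∘ₗ as ∘ₗ r = (TensorProduct.assoc k W X (Y ⊗[k] Z)).toLinearMap ∘ₗ
      (TensorProduct.assoc k (W ⊗[k] X) Y Z).toLinearMap := by
    apply TensorProduct.ext_fourfold; intros; rfl
  have h1 : TensorProduct.map (LinearMap.id (R := k) (M := W))
        (act x (act y z) Q.phi.val ∘ₗ (TensorProduct.assoc k X Y Z).toLinearMap) =
      A₄ (padLeft k H Q.phi.val) ∘ₗ l := by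
    have := map_id_act w (act x (act y z)) Q.phi.val
    rw [padLeft, Algebra.TensorProduct.includeRight_apply, hA₄, ← this, hl,
      ← TensorProduct.map_comp, LinearMap.id_comp]
  have h2 : l ∘ₗ act w (act ((act x y).comp Q.comul) z) Q.phi.val =
      A₄ (comulSnd Q.comul Q.phi.val) ∘ₗ l :=
    map_id_comp_act w (act ((act x y).comp Q.comul) z) (act x (act y z)) _
      ((reassoc k H H H).comp (Algebra.TensorProduct.map Q.comul (AlgHom.id k H)))
      (fun t => by rw [act_comp_left, act_assoc]; rfl) Q.phi.val
  have h3 : TensorProduct.map (act w (act x y) Q.phi.val ∘ₗ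
        (TensorProduct.assoc k W X Y).toLinearMap) (LinearMap.id (R := k) (M := Z)) =
      act (act w (act x y)) z (Q.phi.val ⊗ₜ 1) ∘ₗ r := by
    rw [← map_act_id, hr, ← TensorProduct.map_comp, LinearMap.id_comp]
  have h4 : l ∘ₗ as ∘ₗ act (act w (act x y)) z (Q.phi.val ⊗ₜ 1) =
      A₄ (padRight k H Q.phi.val) ∘ₗ l ∘ₗ as := by
    rw [has, act_assoc, ← LinearMap.comp_assoc, hl,
      map_id_comp_act w (act (act x y) z) (act x (act y z)) _ (reassoc k H H H)
        (fun t => act_assoc x y z t), reassoc_phi_one, LinearMap.comp_assoc]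
  have h5 : act w (act x ((act y z).comp Q.comul)) Q.phi.val =
      A₄ (comulTrd Q.comul Q.phi.val) := by
    have : act x ((act y z).comp Q.comul) = (act x (act y z)).comp
        (Algebra.TensorProduct.map (AlgHom.id k H) Q.comul) :=
      AlgHom.ext fun t => act_comp_right Q y z t x
    rw [this]
    exact act_map w (act x (act y z)) (AlgHom.id k H) _ Q.phi.val
  have h6 : (TensorProduct.assoc k W X (Y ⊗[k] Z)).toLinearMap ∘ₗ
        act ((act w x).comp Q.comul) (act y z) Q.phi.val =
      A₄ (comulFst Q.comul Q.phi.val) ∘ₗ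
        (TensorProduct.assoc k W X (Y ⊗[k] Z)).toLinearMap := by
    rw [act_comp_left, act_assoc]; rfl
  calc _ = A₄ (padLeft k H Q.phi.val) ∘ₗ
        (l ∘ₗ act w (act ((act x y).comp Q.comul) z) Q.phi.val) ∘ₗ
        as ∘ₗ act (act w (act x y)) z (Q.phi.val ⊗ₜ 1) ∘ₗ r := by
        rw [h1, h3]; simp only [LinearMap.comp_assoc]
    _ = A₄ (padLeft k H Q.phi.val) ∘ₗ A₄ (comulSnd Q.comul Q.phi.val) ∘ₗ
        (l ∘ₗ as ∘ₗ act (act w (act x y)) z (Q.phi.val ⊗ₜ 1)) ∘ₗ r := by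
        rw [h2]; simp only [LinearMap.comp_assoc]
    _ = (A₄ (padLeft k H Q.phi.val) * A₄ (comulSnd Q.comul Q.phi.val) *
        A₄ (padRight k H Q.phi.val)) ∘ₗ (l ∘ₗ as ∘ₗ r) := by
        rw [h4]; simp only [LinearMap.comp_assoc, Module.End.mul_eq_comp]
    _ = (A₄ (comulTrd Q.comul Q.phi.val) * A₄ (comulFst Q.comul Q.phi.val)) ∘ₗ
        (l ∘ₗ as ∘ₗ r) := by
        simp only [← map_mul]; rw [Q.cocycle]
    _ = A₄ (comulTrd Q.comul Q.phi.val) ∘ₗ (A₄ (comulFst Q.comul Q.phi.val) ∘ₗ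
        (TensorProduct.assoc k W X (Y ⊗[k] Z)).toLinearMap) ∘ₗ
        (TensorProduct.assoc k (W ⊗[k] X) Y Z).toLinearMap := by
        rw [hcoh]; simp only [LinearMap.comp_assoc, Module.End.mul_eq_comp]
    _ = _ := by
        rw [← h6, h5]; simp only [LinearMap.comp_assoc]

theorem triangle_linear :
    TensorProduct.map (LinearMap.id (R := k) (M := W)) (TensorProduct.lid k X).toLinearMap ∘ₗ
      (act w (act ((Algebra.lmul k k).comp Q.counit) x) Q.phi.val ∘ₗ
        (TensorProduct.assoc k W k X).toLinearMap) =
    TensorProduct.map (TensorProduct.rid k W).toLinearMap (LinearMap.id (R := k) (M := X)) := by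
  have h := map_id_comp_act w (act ((Algebra.lmul k k).comp Q.counit) x) x
    (TensorProduct.lid k X).toLinearMap
    ((Algebra.TensorProduct.lid k H).toAlgHom.comp
      (Algebra.TensorProduct.map Q.counit (AlgHom.id k H)))
    (fun t => act_lid Q.counit x t) Q.phi.val
  rw [Q.normalized, map_one] at h
  rw [← LinearMap.comp_assoc, h]
  apply TensorProduct.ext_threefold; intro a b c
  simp [TensorProduct.smul_tmul]

theorem assoc_natural {W₁ X₁ Y₁ : Type u} [AddCommGroup W₁] [Module k W₁]
    [AddCommGroup X₁] [Module k X₁] [AddCommGroup Y₁] [Module k Y₁]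
    (w₁ : H →ₐ[k] Module.End k W₁) (x₁ : H →ₐ[k] Module.End k X₁)
    (y₁ : H →ₐ[k] Module.End k Y₁)
    {f : W →ₗ[k] W₁} {g : X →ₗ[k] X₁} {h : Y →ₗ[k] Y₁}
    (hf : ∀ t, f ∘ₗ w t = w₁ t ∘ₗ f) (hg : ∀ t, g ∘ₗ x t = x₁ t ∘ₗ g)
    (hh : ∀ t, h ∘ₗ y t = y₁ t ∘ₗ h) :
    (act w₁ (act x₁ y₁) Q.phi.val ∘ₗ (TensorProduct.assoc k W₁ X₁ Y₁).toLinearMap) ∘ₗ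
        TensorProduct.map (TensorProduct.map f g) h =
      TensorProduct.map f (TensorProduct.map g h) ∘ₗ
        (act w (act x y) Q.phi.val ∘ₗ (TensorProduct.assoc k W X Y).toLinearMap) := by
  have e := act_natural hf (act_natural hg hh) Q.phi.val
  rw [← LinearMap.comp_assoc, e, LinearMap.comp_assoc, LinearMap.comp_assoc]
  congr 1
  apply TensorProduct.ext_threefold; intros; rfl

theorem braid_intertwines (T : QuasitriangularQuasiHopfAlgebra k H) (h : H) :
    ((TensorProduct.comm k W X).toLinearMap ∘ₗ act w x T.R.val) ∘ₗ act w x (T.comul h) =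
      act x w (T.comul h) ∘ₗ ((TensorProduct.comm k W X).toLinearMap ∘ₗ act w x T.R.val) := by
  have e := act_comm w x (Algebra.TensorProduct.comm k H H (T.comul h))
  have e' : Algebra.TensorProduct.comm k H H
      (Algebra.TensorProduct.comm k H H (T.comul h)) = T.comul h :=
    (Algebra.TensorProduct.comm k H H).symm_apply_apply (T.comul h)
  rw [e'] at e
  rw [← LinearMap.comp_assoc (act w x T.R.val), ← e, LinearMap.comp_assoc, LinearMap.comp_assoc,
    ← Module.End.mul_eq_comp, ← Module.End.mul_eq_comp, ← map_mul, ← map_mul, T.quasi_cocomm]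

theorem braid_natural {W₁ X₁ : Type u} [AddCommGroup W₁] [Module k W₁]
    [AddCommGroup X₁] [Module k X₁]
    (w₁ : H →ₐ[k] Module.End k W₁) (x₁ : H →ₐ[k] Module.End k X₁)
    {f : W →ₗ[k] W₁} {g : X →ₗ[k] X₁}
    (hf : ∀ t, f ∘ₗ w t = w₁ t ∘ₗ f) (hg : ∀ t, g ∘ₗ x t = x₁ t ∘ₗ g) (R : H ⊗[k] H) :
    ((TensorProduct.comm k W₁ X₁).toLinearMap ∘ₗ act w₁ x₁ R) ∘ₗ TensorProduct.map f g =
      TensorProduct.map g f ∘ₗ ((TensorProduct.comm k W X).toLinearMap ∘ₗ act w x R) := by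
  have e := act_natural hf hg R
  rw [LinearMap.comp_assoc, ← e, ← LinearMap.comp_assoc, ← LinearMap.comp_assoc]
  congr 1
  apply TensorProduct.ext'; intros; rfl

/-- Induction for identities that are additive in an element of a threefold tensor power. -/
theorem three_induction {p : H ⊗[k] (H ⊗[k] H) → Prop} (t : H ⊗[k] (H ⊗[k] H)) (h0 : p 0)
    (h : ∀ a b c, p (a ⊗ₜ (b ⊗ₜ c))) (hadd : ∀ s t, p s → p t → p (s + t)) : p t := by
  induction t using TensorProduct.induction_on with
  | zero => exact h0
  | tmul a t =>
    induction t using TensorProduct.induction_on with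
    | zero => rw [TensorProduct.tmul_zero]; exact h0
    | tmul b c => exact h a b c
    | add x y hx hy => rw [TensorProduct.tmul_add]; exact hadd _ _ hx hy
  | add x y hx hy => exact hadd _ _ hx hy

theorem leg312_leg231 (t : H ⊗[k] (H ⊗[k] H)) : leg312 k H (leg231 k H t) = t := by
  induction t using three_induction with
  | h0 => simp
  | h a b c => simp [leg312, leg231]
  | hadd s t hs ht => simp only [map_add, hs, ht]

theorem leg231_leg312 (t : H ⊗[k] (H ⊗[k] H)) : leg231 k H (leg312 k H t) = t := by
  induction t using three_induction with
  | h0 => simp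
  | h a b c => simp [leg312, leg231]
  | hadd s t hs ht => simp only [map_add, hs, ht]

theorem perm_312 (t : H ⊗[k] (H ⊗[k] H)) :
    ((TensorProduct.assoc k X Y W).toLinearMap ∘ₗ
        (TensorProduct.comm k W (X ⊗[k] Y)).toLinearMap) ∘ₗ act w (act x y) t =
      act x (act y w) (leg312 k H t) ∘ₗ ((TensorProduct.assoc k X Y W).toLinearMap ∘ₗ
        (TensorProduct.comm k W (X ⊗[k] Y)).toLinearMap) := by
  induction t using three_induction with
  | h0 => simp
  | h a b c => ext; simp [leg312]
  | hadd s t hs ht => simp only [map_add, LinearMap.comp_add, LinearMap.add_comp, hs, ht]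

theorem perm_231 (t : H ⊗[k] (H ⊗[k] H)) :
    ((TensorProduct.comm k (W ⊗[k] X) Y).toLinearMap ∘ₗ
        (TensorProduct.assoc k W X Y).symm.toLinearMap) ∘ₗ act w (act x y) t =
      act y (act w x) (leg231 k H t) ∘ₗ ((TensorProduct.comm k (W ⊗[k] X) Y).toLinearMap ∘ₗ
        (TensorProduct.assoc k W X Y).symm.toLinearMap) := by
  induction t using three_induction with
  | h0 => simp
  | h a b c => ext; simp [leg231]
  | hadd s t hs ht => simp only [map_add, LinearMap.comp_add, LinearMap.add_comp, hs, ht]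

theorem perm_132 (t : H ⊗[k] (H ⊗[k] H)) :
    TensorProduct.map (LinearMap.id (R := k) (M := W)) (TensorProduct.comm k X Y).toLinearMap ∘ₗ
        act w (act x y) t =
      act w (act y x) (leg132 k H t) ∘ₗ
        TensorProduct.map LinearMap.id (TensorProduct.comm k X Y).toLinearMap := by
  induction t using three_induction with
  | h0 => simp
  | h a b c => ext; simp [leg132]
  | hadd s t hs ht => simp only [map_add, LinearMap.comp_add, LinearMap.add_comp, hs, ht]

/-- The permutation `w ⊗ x ⊗ y ↦ x ⊗ w ⊗ y`. -/
noncomputable def swap12 (k W X Y : Type u) [CommRing k] [AddCommGroup W] [Module k W]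
    [AddCommGroup X] [Module k X] [AddCommGroup Y] [Module k Y] :
    W ⊗[k] (X ⊗[k] Y) →ₗ[k] X ⊗[k] (W ⊗[k] Y) :=
  (TensorProduct.assoc k X W Y).toLinearMap ∘ₗ
    TensorProduct.map (TensorProduct.comm k W X).toLinearMap LinearMap.id ∘ₗ
      (TensorProduct.assoc k W X Y).symm.toLinearMap

theorem perm_213 (t : H ⊗[k] (H ⊗[k] H)) :
    swap12 k W X Y ∘ₗ act w (act x y) t = act x (act w y) (leg213 k H t) ∘ₗ swap12 k W X Y := by
  induction t using three_induction with
  | h0 => simp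
  | h a b c => ext; simp [leg213, swap12]
  | hadd s t hs ht => simp only [map_add, LinearMap.comp_add, LinearMap.add_comp, hs, ht]

theorem leg132_leg132 (t : H ⊗[k] (H ⊗[k] H)) : leg132 k H (leg132 k H t) = t := by
  induction t using three_induction with
  | h0 => simp
  | h a b c => simp [leg132]
  | hadd s t hs ht => simp only [map_add, hs, ht]

theorem leg213_leg213 (t : H ⊗[k] (H ⊗[k] H)) : leg213 k H (leg213 k H t) = t := by
  induction t using three_induction with
  | h0 => simp
  | h a b c => simp [leg213]
  | hadd s t hs ht => simp only [map_add, hs, ht]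

theorem leg213_leg23 (t : H ⊗[k] H) : leg213 k H (leg23 k H t) = leg13 k H t := by
  induction t using TensorProduct.induction_on with
  | zero => simp
  | tmul a b => simp [leg213, leg23, leg13]
  | add s t hs ht => simp only [map_add, hs, ht]

theorem leg132_leg12 (t : H ⊗[k] H) : leg132 k H (leg12 k H t) = leg13 k H t := by
  induction t using TensorProduct.induction_on with
  | zero => simp
  | tmul a b => simp [leg132, leg12, leg13]
  | add s t hs ht => simp only [map_add, hs, ht]

theorem map_act_right (t : H ⊗[k] H) :
    TensorProduct.map (LinearMap.id (R := k) (M := W)) (act x y t) =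
      act w (act x y) (leg23 k H t) := map_id_act w (act x y) t

theorem map_act_left (t : H ⊗[k] H) :
    (TensorProduct.assoc k W X Y).toLinearMap ∘ₗ
      TensorProduct.map (act w x t) (LinearMap.id (R := k) (M := Y)) =
      act w (act x y) (leg12 k H t) ∘ₗ (TensorProduct.assoc k W X Y).toLinearMap := by
  induction t using TensorProduct.induction_on with
  | zero => simp [TensorProduct.map_zero_left]
  | tmul a b => ext; simp [leg12]
  | add s t hs ht =>
    simp only [map_add, LinearMap.comp_add, LinearMap.add_comp, hs, ht,
      TensorProduct.map_add_left]

theorem hexagon_forward_linear (T : QuasitriangularQuasiHopfAlgebra k H) :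
    (act x (act y w) T.phi.val ∘ₗ (TensorProduct.assoc k X Y W).toLinearMap) ∘ₗ
      ((TensorProduct.comm k W (X ⊗[k] Y)).toLinearMap ∘ₗ
        act w ((act x y).comp T.comul) T.R.val) ∘ₗ
      (act w (act x y) T.phi.val ∘ₗ (TensorProduct.assoc k W X Y).toLinearMap) =
    TensorProduct.map (LinearMap.id (R := k) (M := X))
        ((TensorProduct.comm k W Y).toLinearMap ∘ₗ act w y T.R.val) ∘ₗ
      (act x (act w y) T.phi.val ∘ₗ (TensorProduct.assoc k X W Y).toLinearMap) ∘ₗ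
      TensorProduct.map ((TensorProduct.comm k W X).toLinearMap ∘ₗ act w x T.R.val)
        (LinearMap.id (R := k) (M := Y)) := by
  set A := act w (act x y) with hA
  set P := (TensorProduct.assoc k X Y W).toLinearMap ∘ₗ
        (TensorProduct.comm k W (X ⊗[k] Y)).toLinearMap with hP
  set as := (TensorProduct.assoc k W X Y).toLinearMap with has
  have h1 : act x (act y w) T.phi.val ∘ₗ P = P ∘ₗ A (leg231 k H T.phi.val) := by
    rw [hP, hA, perm_312, leg312_leg231]
  have h2 : act w ((act x y).comp T.comul) T.R.val =
      A (leg231 k H T.phi.inv * leg13 k H T.R.val * leg213 k H T.phi.val *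
        leg12 k H T.R.val * T.phi.inv) := by
    rw [act_comp_right, T.hexagon_snd]
  have h3 : (TensorProduct.assoc k X W Y).toLinearMap ∘ₗ
      TensorProduct.map ((TensorProduct.comm k W X).toLinearMap ∘ₗ act w x T.R.val)
        (LinearMap.id (R := k) (M := Y)) =
      swap12 k W X Y ∘ₗ A (leg12 k H T.R.val) ∘ₗ as := by
    rw [hA, has, ← map_act_left]
    ext; simp [swap12]
  have h4 : act x (act w y) T.phi.val ∘ₗ swap12 k W X Y =
      swap12 k W X Y ∘ₗ A (leg213 k H T.phi.val) := by
    rw [hA, perm_213, leg213_leg213]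
  have h5 : act x (act w y) (leg23 k H T.R.val) ∘ₗ swap12 k W X Y =
      swap12 k W X Y ∘ₗ A (leg13 k H T.R.val) := by
    rw [hA, ← leg213_leg23, perm_213, leg213_leg213]
  have h6 : TensorProduct.map (LinearMap.id (R := k) (M := X))
      ((TensorProduct.comm k W Y).toLinearMap ∘ₗ act w y T.R.val) =
      TensorProduct.map LinearMap.id (TensorProduct.comm k W Y).toLinearMap ∘ₗ
        act x (act w y) (leg23 k H T.R.val) := by
    rw [← map_act_right, ← TensorProduct.map_comp, LinearMap.id_comp]
  have h7 : TensorProduct.map LinearMap.id (TensorProduct.comm k W Y).toLinearMap ∘ₗ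
      swap12 k W X Y = P := by
    ext; simp [swap12, hP]
  have hm : leg231 k H T.phi.val * (leg231 k H T.phi.inv * leg13 k H T.R.val *
      leg213 k H T.phi.val * leg12 k H T.R.val * T.phi.inv) * T.phi.val =
      leg13 k H T.R.val * leg213 k H T.phi.val * leg12 k H T.R.val := by
    simp only [← mul_assoc]
    rw [← map_mul, T.phi.val_inv, map_one, one_mul, mul_assoc _ T.phi.inv, T.phi.inv_val, mul_one]
  calc _ = (act x (act y w) T.phi.val ∘ₗ P) ∘ₗ
        act w ((act x y).comp T.comul) T.R.val ∘ₗ A T.phi.val ∘ₗ as := by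
        simp only [hP, LinearMap.comp_assoc]
    _ = P ∘ₗ (A (leg231 k H T.phi.val) * A (leg231 k H T.phi.inv * leg13 k H T.R.val *
        leg213 k H T.phi.val * leg12 k H T.R.val * T.phi.inv) * A T.phi.val) ∘ₗ as := by
        rw [h1, h2]; simp only [LinearMap.comp_assoc, Module.End.mul_eq_comp]
    _ = P ∘ₗ (A (leg13 k H T.R.val) * A (leg213 k H T.phi.val) *
        A (leg12 k H T.R.val)) ∘ₗ as := by
        simp only [← map_mul]; rw [hm]
    _ = TensorProduct.map LinearMap.id (TensorProduct.comm k W Y).toLinearMap ∘ₗ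
        (swap12 k W X Y ∘ₗ A (leg13 k H T.R.val)) ∘ₗ A (leg213 k H T.phi.val) ∘ₗ
        A (leg12 k H T.R.val) ∘ₗ as := by
        rw [← h7]; simp only [LinearMap.comp_assoc, Module.End.mul_eq_comp]
    _ = TensorProduct.map LinearMap.id (TensorProduct.comm k W Y).toLinearMap ∘ₗ
        act x (act w y) (leg23 k H T.R.val) ∘ₗ (swap12 k W X Y ∘ₗ A (leg213 k H T.phi.val)) ∘ₗ
        A (leg12 k H T.R.val) ∘ₗ as := by
        rw [← h5]; simp only [LinearMap.comp_assoc]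
    _ = _ := by
        rw [← h4, h6]; simp only [LinearMap.comp_assoc]; rw [h3]

theorem hexagon_reverse_linear (T : QuasitriangularQuasiHopfAlgebra k H) :
    ((TensorProduct.assoc k Y W X).symm.toLinearMap ∘ₗ act y (act w x) T.phi.inv) ∘ₗ
      ((TensorProduct.comm k (W ⊗[k] X) Y).toLinearMap ∘ₗ
        act ((act w x).comp T.comul) y T.R.val) ∘ₗ
      ((TensorProduct.assoc k W X Y).symm.toLinearMap ∘ₗ act w (act x y) T.phi.inv) =
    TensorProduct.map ((TensorProduct.comm k W Y).toLinearMap ∘ₗ act w y T.R.val)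
        (LinearMap.id (R := k) (M := X)) ∘ₗ
      ((TensorProduct.assoc k W Y X).symm.toLinearMap ∘ₗ act w (act y x) T.phi.inv) ∘ₗ
      TensorProduct.map (LinearMap.id (R := k) (M := W))
        ((TensorProduct.comm k X Y).toLinearMap ∘ₗ act x y T.R.val) := by
  set A := act w (act x y) with hA
  set P := (TensorProduct.comm k (W ⊗[k] X) Y).toLinearMap ∘ₗ
        (TensorProduct.assoc k W X Y).symm.toLinearMap with hP
  set S := TensorProduct.map (LinearMap.id (R := k) (M := W))
    (TensorProduct.comm k X Y).toLinearMap with hS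
  have h1 : act y (act w x) T.phi.inv ∘ₗ P = P ∘ₗ A (leg312 k H T.phi.inv) := by
    rw [hP, hA, perm_231, leg231_leg312]
  have h2 : act ((act w x).comp T.comul) y T.R.val ∘ₗ
        (TensorProduct.assoc k W X Y).symm.toLinearMap =
      (TensorProduct.assoc k W X Y).symm.toLinearMap ∘ₗ
      A (leg312 k H T.phi.val * leg13 k H T.R.val * leg132 k H T.phi.inv *
        leg23 k H T.R.val * T.phi.val) := by
    rw [act_comp_left, ← T.hexagon_fst]
    have := act_assoc w x y (Algebra.TensorProduct.map T.comul (AlgHom.id k H) T.R.val)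
    apply LinearMap.ext; intro v
    apply (TensorProduct.assoc k W X Y).injective
    simpa using LinearMap.congr_fun this ((TensorProduct.assoc k W X Y).symm v)
  have h3 : TensorProduct.map ((TensorProduct.comm k W Y).toLinearMap ∘ₗ act w y T.R.val)
        (LinearMap.id (R := k) (M := X)) ∘ₗ (TensorProduct.assoc k W Y X).symm.toLinearMap =
      TensorProduct.map (TensorProduct.comm k W Y).toLinearMap LinearMap.id ∘ₗ
        (TensorProduct.assoc k W Y X).symm.toLinearMap ∘ₗ
          act w (act y x) (leg12 k H T.R.val) := by
    have := map_act_left w y x T.R.val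
    apply LinearMap.ext; intro v
    have := LinearMap.congr_fun this ((TensorProduct.assoc k W Y X).symm v)
    simp only [LinearMap.comp_apply, LinearEquiv.coe_coe, LinearEquiv.apply_symm_apply] at this ⊢
    rw [← this, LinearEquiv.symm_apply_apply, ← LinearMap.comp_apply, ← TensorProduct.map_comp,
      LinearMap.id_comp]
  have h4 : act w (act y x) T.phi.inv ∘ₗ S = S ∘ₗ A (leg132 k H T.phi.inv) := by
    rw [hS, hA, perm_132, leg132_leg132]
  have h5 : act w (act y x) (leg12 k H T.R.val) ∘ₗ S = S ∘ₗ A (leg13 k H T.R.val) := by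
    rw [hS, hA, ← leg132_leg12, perm_132, leg132_leg132]
  have h6 : TensorProduct.map (LinearMap.id (R := k) (M := W))
        ((TensorProduct.comm k X Y).toLinearMap ∘ₗ act x y T.R.val) =
      S ∘ₗ A (leg23 k H T.R.val) := by
    rw [hA, ← map_act_right, hS, ← TensorProduct.map_comp, LinearMap.id_comp]
  have h7 : TensorProduct.map (TensorProduct.comm k W Y).toLinearMap LinearMap.id ∘ₗ
        (TensorProduct.assoc k W Y X).symm.toLinearMap ∘ₗ S =
      (TensorProduct.assoc k Y W X).symm.toLinearMap ∘ₗ P := by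
    ext; simp [hS, hP]
  have hm : leg312 k H T.phi.inv * (leg312 k H T.phi.val * leg13 k H T.R.val *
      leg132 k H T.phi.inv * leg23 k H T.R.val * T.phi.val) * T.phi.inv =
      leg13 k H T.R.val * leg132 k H T.phi.inv * leg23 k H T.R.val := by
    simp only [← mul_assoc]
    rw [← map_mul, T.phi.inv_val, map_one, one_mul, mul_assoc _ T.phi.val, T.phi.val_inv, mul_one]
  calc _ = (TensorProduct.assoc k Y W X).symm.toLinearMap ∘ₗ act y (act w x) T.phi.inv ∘ₗ
        (TensorProduct.comm k (W ⊗[k] X) Y).toLinearMap ∘ₗ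
        (act ((act w x).comp T.comul) y T.R.val ∘ₗ
        (TensorProduct.assoc k W X Y).symm.toLinearMap) ∘ₗ A T.phi.inv := by
        simp only [LinearMap.comp_assoc]
    _ = (TensorProduct.assoc k Y W X).symm.toLinearMap ∘ₗ (act y (act w x) T.phi.inv ∘ₗ P) ∘ₗ
        A (leg312 k H T.phi.val * leg13 k H T.R.val * leg132 k H T.phi.inv *
          leg23 k H T.R.val * T.phi.val) ∘ₗ A T.phi.inv := by
        rw [h2, hP]; simp only [LinearMap.comp_assoc]
    _ = ((TensorProduct.assoc k Y W X).symm.toLinearMap ∘ₗ P) ∘ₗ (A (leg312 k H T.phi.inv) *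
        A (leg312 k H T.phi.val * leg13 k H T.R.val * leg132 k H T.phi.inv *
          leg23 k H T.R.val * T.phi.val) * A T.phi.inv) := by
        rw [h1]; simp only [LinearMap.comp_assoc, Module.End.mul_eq_comp]
    _ = ((TensorProduct.assoc k Y W X).symm.toLinearMap ∘ₗ P) ∘ₗ (A (leg13 k H T.R.val) *
        A (leg132 k H T.phi.inv) * A (leg23 k H T.R.val)) := by
        simp only [← map_mul]; rw [hm]
    _ = TensorProduct.map (TensorProduct.comm k W Y).toLinearMap LinearMap.id ∘ₗ
        (TensorProduct.assoc k W Y X).symm.toLinearMap ∘ₗ (S ∘ₗ A (leg13 k H T.R.val)) ∘ₗ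
        A (leg132 k H T.phi.inv) ∘ₗ A (leg23 k H T.R.val) := by
        rw [← h7]; simp only [LinearMap.comp_assoc, Module.End.mul_eq_comp]
    _ = (TensorProduct.map (TensorProduct.comm k W Y).toLinearMap LinearMap.id ∘ₗ
        (TensorProduct.assoc k W Y X).symm.toLinearMap ∘ₗ
          act w (act y x) (leg12 k H T.R.val)) ∘ₗ (S ∘ₗ
        A (leg132 k H T.phi.inv)) ∘ₗ A (leg23 k H T.R.val) := by
        rw [← h5]; simp only [LinearMap.comp_assoc]
    _ = _ := by
        rw [← h3, ← h4, h6]; simp only [LinearMap.comp_assoc]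

end ActLemmas

namespace QMod

variable {Q : QuasiBialgebra k H}

/-- The tensor product of modules: `h` acts on `M ⊗ N` through `Δ h`. -/
noncomputable def tensor (M N : QMod Q) : QMod Q where
  V := M.V ⊗[k] N.V
  ρ := (act M.ρ N.ρ).comp Q.comul

/-- The trivial module `k`, on which `h` acts by `ε(h)`. -/
noncomputable def unit (Q : QuasiBialgebra k H) : QMod Q where
  V := k
  ρ := (Algebra.lmul k k).comp Q.counit

/-- The tensor product of morphisms. -/
noncomputable def tensorMap {M N M' N' : QMod Q} (f : M ⟶ M') (g : N ⟶ N') :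
    tensor M N ⟶ tensor M' N' :=
  ⟨TensorProduct.map (Hom.toLin f) (Hom.toLin g), fun h =>
    act_natural (toLin_comm f) (toLin_comm g) (Q.comul h)⟩

/-- The associativity isomorphism `(M ⊗ N) ⊗ P ≅ M ⊗ (N ⊗ P)`, given by
`(v ⊗ w) ⊗ z ↦ φ¹ v ⊗ (φ² w ⊗ φ³ z)`. -/
noncomputable def assocIso (M N P : QMod Q) :
    tensor (tensor M N) P ≅ tensor M (tensor N P) :=
  isoMk ((TensorProduct.assoc k M.V N.V P.V).trans
    (actUnit (act M.ρ (act N.ρ P.ρ)) Q.phi)) (assoc_intertwines Q M.ρ N.ρ P.ρ)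

/-- The left unit isomorphism. -/
noncomputable def lunitIso (M : QMod Q) : tensor (unit Q) M ≅ M :=
  isoMk (TensorProduct.lid k M.V) (fun h => by
    have := act_lid Q.counit M.ρ (Q.comul h)
    rw [Q.counit_left] at this
    exact this)

/-- The right unit isomorphism. -/
noncomputable def runitIso (M : QMod Q) : tensor M (unit Q) ≅ M :=
  isoMk (TensorProduct.rid k M.V) (fun h => by
    have := act_rid M.ρ Q.counit (Q.comul h)
    rw [Q.counit_right] at this
    exact this)

/-- The monoidal category of modules over a quasi-bialgebra. -/
noncomputable instance : MonoidalCategory (QMod Q) where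
  tensorObj := tensor
  whiskerLeft M _ _ g := tensorMap (𝟙 M) g
  whiskerRight f N := tensorMap f (𝟙 N)
  tensorHom := tensorMap
  tensorUnit := unit Q
  associator := assocIso
  leftUnitor := lunitIso
  rightUnitor := runitIso
  tensorHom_def _ _ := hom_ext (TensorProduct.ext' fun _ _ => rfl)
  id_tensorHom_id _ _ := hom_ext (TensorProduct.ext' fun _ _ => rfl)
  tensorHom_comp_tensorHom _ _ _ _ := hom_ext (TensorProduct.ext' fun _ _ => rfl)
  whiskerLeft_id _ _ := hom_ext (TensorProduct.ext' fun _ _ => rfl)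
  id_whiskerRight _ _ := hom_ext (TensorProduct.ext' fun _ _ => rfl)
  associator_naturality f g h := hom_ext (assoc_natural Q _ _ _ _ _ _
    (toLin_comm f) (toLin_comm g) (toLin_comm h))
  leftUnitor_naturality f := hom_ext (TensorProduct.ext' fun (a : k) v =>
    ((Hom.toLin f).map_smul a v).symm)
  rightUnitor_naturality f := hom_ext (TensorProduct.ext' fun v (a : k) =>
    ((Hom.toLin f).map_smul a v).symm)
  pentagon W X Y Z := hom_ext (pentagon_linear Q W.ρ X.ρ Y.ρ Z.ρ)
  triangle X Y := hom_ext (triangle_linear Q X.ρ Y.ρ)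

/-- The braiding `v ⊗ w ↦ R² w ⊗ R¹ v` on modules over a quasitriangular quasi-Hopf algebra. -/
noncomputable def braidIso (T : QuasitriangularQuasiHopfAlgebra k H)
    (M N : QMod T.toQuasiBialgebra) : tensor M N ≅ tensor N M :=
  isoMk ((actUnit (act M.ρ N.ρ) T.R).trans (TensorProduct.comm k M.V N.V))
    (braid_intertwines M.ρ N.ρ T)

/-- The modules over a quasitriangular quasi-Hopf algebra form a braided category. -/
noncomputable instance (T : QuasitriangularQuasiHopfAlgebra k H) :
    BraidedCategory (QMod T.toQuasiBialgebra) where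
  braiding := braidIso T
  braiding_naturality_right X _ _ f := hom_ext
    (braid_natural _ _ _ _ (fun _ => rfl : ∀ t, LinearMap.id ∘ₗ X.ρ t = X.ρ t ∘ₗ LinearMap.id)
      (toLin_comm f) T.R.val)
  braiding_naturality_left f Z := hom_ext
    (braid_natural _ _ _ _ (toLin_comm f)
      (fun _ => rfl : ∀ t, LinearMap.id ∘ₗ Z.ρ t = Z.ρ t ∘ₗ LinearMap.id) T.R.val)
  hexagon_forward X Y Z := hom_ext (hexagon_forward_linear X.ρ Y.ρ Z.ρ T)
  hexagon_reverse X Y Z := hom_ext (hexagon_reverse_linear X.ρ Y.ρ Z.ρ T)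

end QMod

end Modules

section Double

variable {k : Type u} [CommRing k] {H D : Type u} [Ring H] [Algebra k H] [Ring D] [Algebra k D]

/-- The left regular module of the algebra. -/
noncomputable def QMod.regular (Q : QuasiBialgebra k H) : QMod Q where
  V := H
  ρ := Algebra.lmul k H

/-- The coaction `V → H ⊗ V`, `v ↦ λ(v ⊗ 1)`, of an object `(V, λ)` of the double category, where
`λ : V ⊗ H → H ⊗ V` is the component of the half-braiding at the left regular module. -/
noncomputable def coaction {Q : QuasiBialgebra k H} (X : Center (QMod Q)) (v : X.1.V) :
    H ⊗[k] X.1.V :=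
  QMod.Hom.toLin (X.2.β (QMod.regular Q)).hom (v ⊗ₜ[k] (1 : H))

/-- Exhibits the quasitriangular quasi-Hopf algebra `T` (on the algebra `D`) as a quantum double
of the quasi-Hopf algebra `A` (on the algebra `H`): the category of `D`-modules is identified, as
a braided monoidal category over `k`-modules, with the double category of the monoidal category
of `H`-modules. The double category is the category of pairs `(V, λ)` of an object and a
monoidal natural isomorphism `λ_W : V ⊗ W ≅ W ⊗ V`, with braiding `λ`.

The identification `θ` of underlying `k`-modules is compatible with morphisms, tensor products
and units, which is what makes `D`, with its coproduct, unique up to isomorphism (and not merely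
up to twisting). -/
structure QuantumDouble (A : QuasiHopfAlgebra k H) (T : QuasitriangularQuasiHopfAlgebra k D) where
  /-- the functor from `D`-modules to the double category of `H`-modules -/
  F : QMod T.toQuasiBialgebra ⥤ Center (QMod A.toQuasiBialgebra)
  /-- it is a braided (strong) monoidal functor -/
  [braided : F.Braided]
  /-- it is an equivalence of categories -/
  isEquivalence : F.IsEquivalence
  /-- the identification of the underlying `k`-modules -/
  θ : ∀ M : QMod T.toQuasiBialgebra, (F.obj M).1.V ≃ₗ[k] M.V
  natural : ∀ {M N : QMod T.toQuasiBialgebra} (f : M ⟶ N) (v : (F.obj M).1.V),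
    θ N (QMod.Hom.toLin (F.map f).f v) = QMod.Hom.toLin f (θ M v)
  tensor : ∀ (M N : QMod T.toQuasiBialgebra) (v : (F.obj M).1.V) (w : (F.obj N).1.V),
    θ (M ⊗ N) (QMod.Hom.toLin (Functor.LaxMonoidal.μ F M N).f (v ⊗ₜ[k] w)) =
      θ M v ⊗ₜ[k] θ N w
  unit : θ (𝟙_ (QMod T.toQuasiBialgebra))
    (QMod.Hom.toLin (Functor.LaxMonoidal.ε F).f (1 : k)) = (1 : k)

end Double

section FunctionAlgebra

/-- A (normalised) group 3-cocycle on `G` with values in `kˣ`. -/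
structure Cocycle₃ (k G : Type u) [CommRing k] [Group G] where
  /-- the values of the cocycle -/
  val : G → G → G → kˣ
  cocycle : ∀ x y s t : G,
    val y s t * val x (y * s) t * val x y s = val x y (s * t) * val (x * y) s t
  normalized : ∀ x y : G, val x 1 y = 1

variable {k G : Type u} [CommRing k]

/-- The Kronecker delta-function `δ_x ∈ k(G)`. -/
def δ (k : Type u) {G : Type u} [CommRing k] [DecidableEq G] (x : G) : G → k := Pi.single x 1

theorem δ_apply [DecidableEq G] (x y : G) : δ k x y = if y = x then 1 else 0 := by
  simp [δ, Pi.single_apply]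

/-- Evaluation of functions at a group element. -/
def ev (k : Type u) {G : Type u} [CommRing k] (a : G) : (G → k) →ₐ[k] k := Pi.evalAlgHom k _ a

@[simp] theorem ev_apply (a : G) (f : G → k) : ev k a f = f a := rfl

/-- The tensor product of two characters. -/
noncomputable def evt {A B : Type u} [Ring A] [Algebra k A] [Ring B] [Algebra k B]
    (f : A →ₐ[k] k) (g : B →ₐ[k] k) : A ⊗[k] B →ₐ[k] k :=
  Algebra.TensorProduct.lift f g (fun _ _ => Commute.all _ _)

@[simp] theorem evt_tmul {A B : Type u} [Ring A] [Algebra k A] [Ring B] [Algebra k B]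
    (f : A →ₐ[k] k) (g : B →ₐ[k] k) (x : A) (y : B) : evt f g (x ⊗ₜ y) = f x * g y := by
  simp [evt]

theorem evt_map {A B A' B' : Type u} [Ring A] [Algebra k A] [Ring B] [Algebra k B]
    [Ring A'] [Algebra k A'] [Ring B'] [Algebra k B']
    (f : A →ₐ[k] k) (g : B →ₐ[k] k) (p : A' →ₐ[k] A) (q : B' →ₐ[k] B) (t : A' ⊗[k] B') :
    evt f g (Algebra.TensorProduct.map p q t) = evt (f.comp p) (g.comp q) t := by
  induction t using TensorProduct.induction_on with
  | zero => simp
  | tmul a b => simp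
  | add s t hs ht => simp only [map_add, hs, ht]

theorem evt_reassoc {A B C : Type u} [Ring A] [Algebra k A] [Ring B] [Algebra k B]
    [Ring C] [Algebra k C] (f : A →ₐ[k] k) (g : B →ₐ[k] k) (h : C →ₐ[k] k)
    (t : (A ⊗[k] B) ⊗[k] C) :
    evt f (evt g h) (reassoc k A B C t) = evt (evt f g) h t := by
  induction t using TensorProduct.induction_on with
  | zero => simp
  | tmul t c =>
    induction t using TensorProduct.induction_on with
    | zero => simp
    | tmul a b => simp [mul_assoc]
    | add s t hs ht => simp only [TensorProduct.add_tmul, map_add, hs, ht]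
  | add s t hs ht => simp only [map_add, hs, ht]

/-- A family of characters that separates the elements of an algebra. -/
def Separates {B ι : Type u} [Ring B] [Algebra k B] (e : ι → (B →ₐ[k] k)) : Prop :=
  ∀ s t : B, (∀ i, e i s = e i t) → s = t

theorem separates_ev : Separates (fun a : G => ev k a) := fun _ _ h => funext h

variable [Group G]

theorem separates_evt [Fintype G] [DecidableEq G] {B ι : Type u} [Ring B] [Algebra k B] {e : ι → (B →ₐ[k] k)}
    (he : Separates e) :
    Separates (fun p : G × ι => evt (ev k p.1) (e p.2)) := by
  have key : ∀ t : (G → k) ⊗[k] B, t = ∑ a : G, δ k a ⊗ₜ[k]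
      (TensorProduct.lid k B (TensorProduct.map (ev k a).toLinearMap LinearMap.id t)) := by
    intro t
    induction t using TensorProduct.induction_on with
    | zero => simp
    | tmul f b =>
      have hf : f = ∑ a : G, f a • δ k a := by
        funext y; simp [δ_apply]
      conv_lhs => rw [hf, TensorProduct.sum_tmul]
      simp [TensorProduct.smul_tmul]
    | add s t hs ht =>
      simp only [map_add, TensorProduct.tmul_add, Finset.sum_add_distrib]
      rw [← hs, ← ht]
  have key2 : ∀ (a : G) (i : ι) (t : (G → k) ⊗[k] B),
      e i (TensorProduct.lid k B (TensorProduct.map (ev k a).toLinearMap LinearMap.id t)) =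
        evt (ev k a) (e i) t := by
    intro a i t
    induction t using TensorProduct.induction_on with
    | zero => simp
    | tmul f b => simp
    | add s t hs ht => simp only [map_add, hs, ht]
  intro s t h
  rw [key s, key t]
  refine Finset.sum_congr rfl fun a _ => ?_
  congr 1
  refine he _ _ fun i => ?_
  rw [key2, key2]
  exact h (a, i)

/-- The antipode `(S f)(x) = f(x⁻¹)` of `k(G)`. -/
def funAntipode (k G : Type u) [CommRing k] [Group G] : (G → k) ≃ₐ[k] (G → k)ᵐᵒᵖ :=
  AlgEquiv.ofLinearEquiv
    ((LinearEquiv.funCongrLeft k k (Equiv.inv G)).trans (MulOpposite.opLinearEquiv k))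
    rfl (fun f g => by
      apply MulOpposite.unop_injective
      funext x
      exact mul_comm (f x⁻¹) (g x⁻¹))

theorem funAntipode_apply (f : G → k) (x : G) :
    (funAntipode k G f).unop x = f x⁻¹ := rfl

theorem cocycle_inv (φ : Cocycle₃ k G) (s : G) :
    φ.val s⁻¹ s s⁻¹ * φ.val s s⁻¹ s = 1 := by
  have h := φ.cocycle s s⁻¹ s s⁻¹
  have h1 : ∀ x y, φ.val 1 x y = 1 := fun x y => by
    have := φ.cocycle 1 1 x y
    simp only [φ.normalized, one_mul, mul_one] at this
    simpa using this
  have h2 : ∀ x y, φ.val x y 1 = 1 := fun x y => by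
    have := φ.cocycle x y 1 1
    simp only [φ.normalized, one_mul, mul_one] at this
    simpa using this
  simpa [h1, h2, φ.normalized] using h

/-- The function `χ(x, y) ∈ k(G)`,
`χ(x, y)(s) = φ(x, y, y⁻¹x⁻¹sxy) φ(s, x, y) / φ(x, x⁻¹sx, y)`. -/
def chi (φ : Cocycle₃ k G) (x y s : G) : kˣ :=
  φ.val x y (y⁻¹ * x⁻¹ * s * x * y) * φ.val s x y / φ.val x (x⁻¹ * s * x) y

/-- The coefficient `φ(x, x⁻¹ax, x⁻¹bx) φ(a, b, x) / φ(a, x, x⁻¹bx)`. -/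
def gam (φ : Cocycle₃ k G) (x a b : G) : kˣ :=
  φ.val x (x⁻¹ * a * x) (x⁻¹ * b * x) * φ.val a b x / φ.val a x (x⁻¹ * b * x)

variable [Fintype G] [DecidableEq G]

theorem separates₂ {s t : (G → k) ⊗[k] (G → k)}
    (h : ∀ a b, evt (ev k a) (ev k b) s = evt (ev k a) (ev k b) t) : s = t :=
  separates_evt separates_ev s t fun p => h p.1 p.2

theorem separates₃ {s t : (G → k) ⊗[k] ((G → k) ⊗[k] (G → k))}
    (h : ∀ a b c, evt (ev k a) (evt (ev k b) (ev k c)) s =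
      evt (ev k a) (evt (ev k b) (ev k c)) t) : s = t :=
  separates_evt (separates_evt separates_ev) s t fun p => h p.1 p.2.1 p.2.2

theorem separates₄ {s t : (G → k) ⊗[k] ((G → k) ⊗[k] ((G → k) ⊗[k] (G → k)))}
    (h : ∀ a b c d, evt (ev k a) (evt (ev k b) (evt (ev k c) (ev k d))) s =
      evt (ev k a) (evt (ev k b) (evt (ev k c) (ev k d))) t) : s = t :=
  separates_evt (separates_evt (separates_evt separates_ev)) s t
    fun p => h p.1 p.2.1 p.2.2.1 p.2.2.2

/-- The element of `k(G) ⊗ k(G)` corresponding to a function of two variables. -/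
noncomputable def fun₂ (F : G → G → k) : (G → k) ⊗[k] (G → k) :=
  ∑ a : G, ∑ b : G, F a b • (δ k a ⊗ₜ[k] δ k b)

/-- The element of `k(G) ⊗ k(G) ⊗ k(G)` corresponding to a function of three variables. -/
noncomputable def fun₃ (F : G → G → G → k) : (G → k) ⊗[k] ((G → k) ⊗[k] (G → k)) :=
  ∑ a : G, ∑ b : G, ∑ c : G, F a b c • (δ k a ⊗ₜ[k] (δ k b ⊗ₜ[k] δ k c))

@[simp] theorem evt_fun₂ (F : G → G → k) (a b : G) : evt (ev k a) (ev k b) (fun₂ F) = F a b := by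
  simp [fun₂, δ_apply]

@[simp] theorem evt_fun₃ (F : G → G → G → k) (a b c : G) :
    evt (ev k a) (evt (ev k b) (ev k c)) (fun₃ F) = F a b c := by
  simp [fun₃, δ_apply]

/-- The coproduct of `k(G)`: `Δ f` is the function `(a, b) ↦ f(ab)` of two variables. -/
noncomputable def funComul (k G : Type u) [CommRing k] [Group G] [Fintype G] [DecidableEq G] :
    (G → k) →ₐ[k] (G → k) ⊗[k] (G → k) where
  toFun f := fun₂ fun a b => f (a * b)
  map_one' := separates₂ fun a b => by rw [map_one, evt_fun₂]; rfl
  map_mul' f g := separates₂ fun a b => by rw [map_mul]; simp only [evt_fun₂]; rfl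
  map_zero' := separates₂ fun a b => by rw [map_zero, evt_fun₂]; rfl
  map_add' f g := separates₂ fun a b => by rw [map_add]; simp only [evt_fun₂]; rfl
  commutes' c := separates₂ fun a b => by rw [AlgHom.commutes, evt_fun₂]; rfl

theorem evt_comp_funComul (a b : G) :
    (evt (ev k a) (ev k b)).comp (funComul k G) = ev k (a * b) :=
  AlgHom.ext fun f => evt_fun₂ (fun a b => f (a * b)) a b

theorem evt_comulFst (a b c d : G) (t : (G → k) ⊗[k] ((G → k) ⊗[k] (G → k))) :
    evt (ev k a) (evt (ev k b) (evt (ev k c) (ev k d))) (comulFst (funComul k G) t) =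
      evt (ev k (a * b)) (evt (ev k c) (ev k d)) t := by
  rw [comulFst, AlgHom.comp_apply, evt_reassoc, evt_map, evt_comp_funComul]; rfl

theorem evt_comulSnd (a b c d : G) (t : (G → k) ⊗[k] ((G → k) ⊗[k] (G → k))) :
    evt (ev k a) (evt (ev k b) (evt (ev k c) (ev k d))) (comulSnd (funComul k G) t) =
      evt (ev k a) (evt (ev k (b * c)) (ev k d)) t := by
  have h : (evt (ev k b) (evt (ev k c) (ev k d))).comp ((reassoc k (G → k) (G → k) (G → k)).comp
      (Algebra.TensorProduct.map (funComul k G) (AlgHom.id k (G → k)))) =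
      evt (ev k (b * c)) (ev k d) := AlgHom.ext fun t => by
    rw [AlgHom.comp_apply, AlgHom.comp_apply, evt_reassoc, evt_map, evt_comp_funComul]; rfl
  rw [comulSnd, evt_map, h]; rfl

theorem evt_comulTrd (a b c d : G) (t : (G → k) ⊗[k] ((G → k) ⊗[k] (G → k))) :
    evt (ev k a) (evt (ev k b) (evt (ev k c) (ev k d))) (comulTrd (funComul k G) t) =
      evt (ev k a) (evt (ev k b) (ev k (c * d))) t := by
  have h : (evt (ev k b) (evt (ev k c) (ev k d))).comp
      (Algebra.TensorProduct.map (AlgHom.id k (G → k)) (funComul k G)) =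
      evt (ev k b) (ev k (c * d)) := AlgHom.ext fun t => by
    rw [AlgHom.comp_apply, evt_map, evt_comp_funComul]; rfl
  rw [comulTrd, evt_map, h]; rfl

theorem evt_padLeft (a b c d : G) (t : (G → k) ⊗[k] ((G → k) ⊗[k] (G → k))) :
    evt (ev k a) (evt (ev k b) (evt (ev k c) (ev k d))) (padLeft k (G → k) t) =
      evt (ev k b) (evt (ev k c) (ev k d)) t := by
  rw [padLeft, Algebra.TensorProduct.includeRight_apply, evt_tmul, map_one, one_mul]

theorem evt_padRight (a b c d : G) (t : (G → k) ⊗[k] ((G → k) ⊗[k] (G → k))) :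
    evt (ev k a) (evt (ev k b) (evt (ev k c) (ev k d))) (padRight k (G → k) t) =
      evt (ev k a) (evt (ev k b) (ev k c)) t := by
  induction t using three_induction with
  | h0 => simp
  | h f g h => simp [padRight]
  | hadd s t hs ht => simp only [map_add, hs, ht]

/-- The associator of `k^φ(G)`: the cocycle `φ` as an invertible element of
`k(G) ⊗ k(G) ⊗ k(G)`. -/
noncomputable def Cocycle₃.unit (φ : Cocycle₃ k G) :
    ((G → k) ⊗[k] ((G → k) ⊗[k] (G → k)))ˣ where
  val := fun₃ fun a b c => (φ.val a b c : k)
  inv := fun₃ fun a b c => ((φ.val a b c)⁻¹ : kˣ)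
  val_inv := separates₃ fun a b c => by rw [map_mul, map_one]; simp
  inv_val := separates₃ fun a b c => by rw [map_mul, map_one]; simp

/-- The quasi-Hopf algebra `k^φ(G)`: the Hopf algebra `k(G)` of functions on the finite group
`G`, with the 3-cocycle `φ` as associator. -/
noncomputable def funAlg (φ : Cocycle₃ k G) : QuasiHopfAlgebra k (G → k) where
  comul := funComul k G
  counit := ev k 1
  phi := φ.unit
  quasi_coassoc f := separates₃ fun a b c => by
    rw [map_mul, map_mul, mul_right_comm, ← map_mul _ φ.unit.val, φ.unit.val_inv, map_one, one_mul,
      evt_map, evt_reassoc, evt_map, evt_comp_funComul, evt_comp_funComul]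
    change evt (ev k a) (ev k (b * c)) (fun₂ _) = evt (ev k (a * b)) (ev k c) (fun₂ _)
    simp [mul_assoc]
  counit_left f := funext fun x => by
    have h : ∀ t : (G → k) ⊗[k] (G → k), Algebra.TensorProduct.lid k (G → k)
        (Algebra.TensorProduct.map (ev k 1) (AlgHom.id k (G → k)) t) x =
          evt (ev k 1) (ev k x) t := fun t => by
      induction t using TensorProduct.induction_on with
      | zero => simp
      | tmul a b => simp
      | add s t hs ht => simp only [map_add, Pi.add_apply, hs, ht]
    rw [h]
    change evt (ev k 1) (ev k x) (fun₂ _) = _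
    rw [evt_fun₂, one_mul]
  counit_right f := funext fun x => by simp [funComul, fun₂, δ_apply]
  cocycle := separates₄ fun a b c d => by
    simp only [map_mul, evt_padLeft, evt_padRight, evt_comulFst, evt_comulSnd, evt_comulTrd]
    simp only [Cocycle₃.unit, evt_fun₃]
    exact_mod_cast congrArg Units.val (φ.cocycle a b c d)
  normalized := separates₂ fun a b => by
    have h : (ev k b).comp ((Algebra.TensorProduct.lid k (G → k)).toAlgHom.comp
        (Algebra.TensorProduct.map (ev k (1 : G)) (AlgHom.id k (G → k)))) =
        evt (ev k 1) (ev k b) := by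
      apply Algebra.TensorProduct.ext' ; intro f g; simp
    rw [evt_map, h, map_one]
    change evt (ev k a) (evt (ev k 1) (ev k b)) (fun₃ _) = 1
    rw [evt_fun₃, φ.normalized, Units.val_one]
  S := funAntipode k G
  α := 1
  β := fun s => ((φ.val s s⁻¹ s)⁻¹ : kˣ)
  antipode_left f := funext fun x => by
    have h : ∀ a : G, x = a⁻¹ ↔ a = x⁻¹ := fun a => by
      rw [eq_inv_iff_mul_eq_one, eq_inv_iff_mul_eq_one, mul_eq_one_comm]
    simp [funComul, fun₂, δ_apply, funAntipode_apply, h]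
  antipode_right f := funext fun x => by
    simp [funComul, fun₂, δ_apply, funAntipode_apply]
  antipode_phi := funext fun x => by
    simp [Cocycle₃.unit, fun₃, δ_apply, funAntipode_apply]
  antipode_phi_inv := funext fun x => by
    have h : (φ.val x⁻¹ x x⁻¹)⁻¹ = φ.val x x⁻¹ x := inv_eq_of_mul_eq_one_right (cocycle_inv φ x)
    simp [Cocycle₃.unit, fun₃, δ_apply, funAntipode_apply, h]

end FunctionAlgebra

end QuasiHopf

/-! A module over `k^φ(G)` is a G-graded module, degrees multiply under tensor products, and φ(a, b,
c) is the scalar by which the associator acts on homogeneous vectors. Let (V, λ) be an object of the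
double category. A vector w of degree x is the image of 1 under a module map k(G) → W, so naturality
forces λ(v ⊗ w) = w ⊗ op_x(v) for operators op_x that do not depend on W (`DoubleObj.braiding_tm`).
Each axiom on λ becomes a condition on these operators. Linearity over k(G) says that op_x takes
degree s to x⁻¹sx (`op_hasDegree`). Compatibility with W ⊗ W' gives op_x op_y = χ(y, x)(t) op_{yx}
in degree t (`op_op`). The tensor product of the double category multiplies op_x ⊗ op_x by the
coefficient γ, called `gam` (`op_tensor`). Its braiding is v ⊗ w ↦ ∑ δ_b w ⊗ op_b(v), which is the
action of the stated R. Letting x ⊗ δ_s act as op_x after projection to degree s therefore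
identifies the double category with the modules over `D^φ(G)`.

It must be known that `D^φ(G)` is a quasitriangular quasi-Hopf algebra. The idempotents e ⊗ δ_s sum
to 1, so each axiom can be tested after right multiplication by them, where it becomes a scalar
identity. Associativity, multiplicativity of Δ and quasi-coassociativity are `chi_cocycle`,
`gam_chi` and `gam_assoc`, three consequences of the 3-cocycle condition. Quasi-cocommutativity and
the hexagons hold by cancellation in the definitions of χ and γ. The pentagon is inherited from
`k^φ(G)`.

Uniqueness is Tannakian reconstruction. For any quantum double D, the algebra `D^φ(G)` acts on every
D-module through the identification with the double category, naturally in the module. A natural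
endomorphism of the underlying k-module is multiplication by its value at 1 in the regular module,
which gives an algebra map `comparison` from `D^φ(G)` to D. It is bijective because the regular
`D^φ(G)`-module, seen in the double category, is free on one generator and corresponds to some
D-module (`comparison_bijective`). Compatibility with tensor products, units, associators and
braidings, evaluated at 1 ⊗ 1 and 1 ⊗ 1 ⊗ 1, shows that it carries Δ, ε, the associator and R to
those of D. -/

namespace QuasiHopf

/-! ### Identities between χ, γ and φ -/

namespace Cocycle₃

variable {k G : Type u} [CommRing k] [Group G] (φ : Cocycle₃ k G)

/-- The cocycle in additive notation. -/
def log (x y z : G) : Additive kˣ := Additive.ofMul (φ.val x y z)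

theorem log_cocycle (x y s t : G) :
    φ.log y s t + φ.log x (y * s) t + φ.log x y s = φ.log x y (s * t) + φ.log (x * y) s t :=
  congrArg Additive.ofMul (φ.cocycle x y s t)

@[simp] theorem val_one_mid (x y : G) : φ.val x 1 y = 1 := φ.normalized x y

@[simp] theorem val_one_left (x y : G) : φ.val 1 x y = 1 := by
  have := φ.cocycle 1 1 x y
  simp only [φ.normalized, one_mul, mul_one] at this
  simpa using this

@[simp] theorem val_one_right (x y : G) : φ.val x y 1 = 1 := by
  have := φ.cocycle x y 1 1
  simp only [φ.normalized, one_mul, mul_one] at this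
  simpa using this

theorem ofMul_chi (x y s : G) : Additive.ofMul (chi φ x y s) =
    φ.log x y (y⁻¹ * x⁻¹ * s * x * y) + φ.log s x y - φ.log x (x⁻¹ * s * x) y := rfl

theorem ofMul_gam (x a b : G) : Additive.ofMul (gam φ x a b) =
    φ.log x (x⁻¹ * a * x) (x⁻¹ * b * x) + φ.log a b x - φ.log a x (x⁻¹ * b * x) := rfl

@[simp] theorem chi_one_left (x s : G) : chi φ 1 x s = 1 := by simp [chi]

@[simp] theorem chi_one_right (x s : G) : chi φ x 1 s = 1 := by simp [chi]

@[simp] theorem chi_one (x y : G) : chi φ x y 1 = 1 := by simp [chi]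

@[simp] theorem gam_one (a b : G) : gam φ 1 a b = 1 := by simp [gam]

@[simp] theorem gam_one_left (x b : G) : gam φ x 1 b = 1 := by simp [gam]

@[simp] theorem gam_one_right (x a : G) : gam φ x a 1 = 1 := by simp [gam]

/-- `χ` is a 2-cocycle on the action groupoid of `G` acting on itself by conjugation. -/
theorem chi_cocycle (x y z r : G) :
    chi φ y x (z⁻¹ * r * z) * chi φ z (y * x) r = chi φ z y r * chi φ (z * y) x r := by
  apply Additive.ofMul.injective
  -- The instances are the shuffles of r into the word (z, y, x), with r conjugated by each letter
  -- that it passes. With arguments in a common normal form, the claim is an integer combination of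
  -- them.
  have h1 := φ.log_cocycle r z y x
  have h2 := φ.log_cocycle z (z⁻¹ * r * z) y x
  have h3 := φ.log_cocycle z y (y⁻¹ * z⁻¹ * r * z * y) x
  have h4 := φ.log_cocycle z y x (x⁻¹ * y⁻¹ * z⁻¹ * r * z * y * x)
  simp only [ofMul_mul, ofMul_chi]
  simp only [mul_assoc, mul_inv_rev, mul_inv_cancel_left] at h1 h2 h3 h4 ⊢
  grind

/-- The compatibility of `γ` with `χ`. -/
theorem gam_chi (x y a b : G) :
    gam φ y a b * gam φ x (y⁻¹ * a * y) (y⁻¹ * b * y) * (chi φ y x a * chi φ y x b) =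
      chi φ y x (a * b) * gam φ (y * x) a b := by
  apply Additive.ofMul.injective
  -- Here the instances are the six shuffles of the words (a, b) and (y, x), with a and b conjugated
  -- by the letters that they pass.
  have h1 := φ.log_cocycle a b y x
  have h2 := φ.log_cocycle a y (y⁻¹ * b * y) x
  have h3 := φ.log_cocycle a y x (x⁻¹ * y⁻¹ * b * y * x)
  have h4 := φ.log_cocycle y (y⁻¹ * a * y) (y⁻¹ * b * y) x
  have h5 := φ.log_cocycle y (y⁻¹ * a * y) x (x⁻¹ * y⁻¹ * b * y * x)
  have h6 := φ.log_cocycle y x (x⁻¹ * y⁻¹ * a * y * x) (x⁻¹ * y⁻¹ * b * y * x)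
  simp only [ofMul_mul, ofMul_chi, ofMul_gam]
  simp only [mul_assoc, mul_inv_rev, mul_inv_cancel_left] at h1 h2 h3 h4 h5 h6 ⊢
  grind

/-- The compatibility of `γ` with the cocycle. -/
theorem gam_assoc (x a b c : G) :
    φ.val a b c * (gam φ x a (b * c) * gam φ x b c) =
      gam φ x (a * b) c * gam φ x a b *
        φ.val (x⁻¹ * a * x) (x⁻¹ * b * x) (x⁻¹ * c * x) := by
  apply Additive.ofMul.injective
  -- The four positions of x in the word (a, b, c), where the letters to the right of x are
  -- conjugated by it.
  have h1 := φ.log_cocycle a b c x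
  have h2 := φ.log_cocycle a b x (x⁻¹ * c * x)
  have h3 := φ.log_cocycle a x (x⁻¹ * b * x) (x⁻¹ * c * x)
  have h4 := φ.log_cocycle x (x⁻¹ * a * x) (x⁻¹ * b * x) (x⁻¹ * c * x)
  have h0 : Additive.ofMul (φ.val a b c) = φ.log a b c := rfl
  have h0' : Additive.ofMul (φ.val (x⁻¹ * a * x) (x⁻¹ * b * x) (x⁻¹ * c * x)) =
    φ.log (x⁻¹ * a * x) (x⁻¹ * b * x) (x⁻¹ * c * x) := rfl
  simp only [ofMul_mul, ofMul_gam, h0, h0']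
  simp only [mul_assoc, mul_inv_cancel_left] at h1 h2 h3 h4 ⊢
  grind

/-- The compatibility of `γ` with `χ` that expresses quasi-cocommutativity. -/
theorem gam_swap (x a b : G) :
    chi φ x (x⁻¹ * b * x) a * gam φ x a b = gam φ x b (b⁻¹ * a * b) * chi φ b x a := by
  apply Additive.ofMul.injective
  -- No cocycle identity is needed: after cancellation both sides are φ(a, b, x) φ(x, x⁻¹bx,
  -- x⁻¹b⁻¹abx).
  simp only [ofMul_mul, ofMul_chi, ofMul_gam]
  simp only [mul_assoc, mul_inv_rev, inv_inv, mul_inv_cancel_left]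
  abel

theorem chi_inv_left (x a : G) : chi φ x⁻¹ x (x⁻¹ * a * x) = chi φ x x⁻¹ a := by
  simpa using φ.chi_cocycle x x⁻¹ x a

/-- The coefficient of the antipode. -/
def sig (x a : G) : kˣ := (gam φ x a a⁻¹ * chi φ x x⁻¹ a⁻¹)⁻¹

@[simp] theorem sig_one_left (a : G) : φ.sig 1 a = 1 := by simp [sig]

/-- The coefficient `sig` is forced by the antipode axiom with α = 1, and this identity makes the
antipode antimultiplicative. It comes from `gam_chi` on the pair (t, t⁻¹), whose product has trivial
χ, and two instances of `chi_cocycle`. -/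
theorem sig_mul (x y t : G) :
    chi φ y x t * φ.sig (y * x) t =
      φ.sig y t * φ.sig x (y⁻¹ * t * y) * chi φ x⁻¹ y⁻¹ (x⁻¹ * y⁻¹ * t⁻¹ * y * x) := by
  have h1 := φ.gam_chi x y t t⁻¹
  have h3 := φ.chi_cocycle y⁻¹ x⁻¹ (y * x) t⁻¹
  have h4 := φ.chi_cocycle x⁻¹ x y t⁻¹
  apply Additive.ofMul.injective
  replace h1 := congrArg Additive.ofMul h1
  replace h3 := congrArg Additive.ofMul h3
  replace h4 := congrArg Additive.ofMul h4
  simp only [mul_assoc, mul_inv_rev, mul_inv_cancel, inv_inv, sig, ofMul_mul, ofMul_inv, chi_one, chi_one_right, ofMul_one,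
    mul_one] at h1 h3 h4 ⊢
  grind

/-- This is `gam_assoc` on the triple (a, a⁻¹, a), where two of the four γ-factors are trivial. It
gives the antipode axiom that involves β. -/
theorem sig_inv (x a : G) :
    gam φ x a a⁻¹ * φ.sig x a⁻¹ * (φ.val a a⁻¹ a)⁻¹ * chi φ x⁻¹ x (x⁻¹ * a * x) =
      (φ.val (x⁻¹ * a * x) (x⁻¹ * a⁻¹ * x) (x⁻¹ * a * x))⁻¹ := by
  have h := congrArg Additive.ofMul (φ.gam_assoc x a a⁻¹ a)
  rw [chi_inv_left]
  apply Additive.ofMul.injective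
  simp only [sig, inv_inv, inv_mul_cancel, mul_inv_cancel, gam_one_left, gam_one_right, ofMul_mul,
    ofMul_inv, ofMul_one] at h ⊢
  grind

end Cocycle₃
end QuasiHopf

/-! ### The algebra `D^φ(G)` -/

namespace QuasiHopf

namespace TwistedDouble

variable {k G : Type u} [CommRing k] [Group G] [Fintype G] [DecidableEq G] (φ : Cocycle₃ k G)

omit [Group G] [DecidableEq G] in
/-- Induction for statements about functions on `G × G`. -/
theorem fun_induction {p : (G × G → k) → Prop} (a : G × G → k) (h0 : p 0)
    (he : ∀ x s, p (Pi.basisFun k (G × G) (x, s))) (hadd : ∀ a b, p a → p b → p (a + b))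
    (hsmul : ∀ (c : k) a, p a → p (c • a)) : p a := by
  have h : a ∈ Submodule.span k (Set.range (Pi.basisFun k (G × G))) :=
    (Pi.basisFun k (G × G)).mem_span a
  induction h using Submodule.span_induction with
  | mem x hx => obtain ⟨q, rfl⟩ := hx; exact he q.1 q.2
  | zero => exact h0
  | add a b _ _ ha hb => exact hadd a b ha hb
  | smul c a _ ha => exact hsmul c a ha

/-- The multiplication of `D^φ(G)` as a bilinear map on functions on `G × G`. -/
noncomputable def mulMap : (G × G → k) →ₗ[k] (G × G → k) →ₗ[k] (G × G → k) :=
  (Pi.basisFun k (G × G)).constr k fun p => (Pi.basisFun k (G × G)).constr k fun q =>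
    if q.1 * p.2 * q.1⁻¹ = q.2 then (chi φ q.1 p.1 q.2 : k) • Pi.basisFun k (G × G) (q.1 * p.1, q.2) else 0

theorem mulMap_e (x s y t : G) : mulMap φ (Pi.basisFun k (G × G) (x, s)) (Pi.basisFun k (G × G) (y, t)) =
    if y * s * y⁻¹ = t then (chi φ y x t : k) • Pi.basisFun k (G × G) (y * x, t) else 0 := by
  rw [mulMap, Module.Basis.constr_basis, Module.Basis.constr_basis]

/-- The unit of `D^φ(G)`. -/
noncomputable def unit (k G : Type u) [CommRing k] [Group G] [Fintype G] : G × G → k :=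
  ∑ s, Pi.basisFun k (G × G) (1, s)

/-- Think of x ⊗ δ_s as an arrow from s to x⁻¹sx in the conjugation groupoid; the product is
composition twisted by χ. Both bracketings vanish unless the arrows compose, and then they agree by
`chi_cocycle`. -/
theorem mulMap_assoc (a b c : G × G → k) :
    mulMap φ (mulMap φ a b) c = mulMap φ a (mulMap φ b c) := by
  induction a using fun_induction with
  | h0 => simp
  | hadd a a' h h' => simp only [map_add, LinearMap.add_apply, h, h']
  | hsmul r a h => simp only [map_smul, LinearMap.smul_apply, h]
  | he x s =>
  induction b using fun_induction with
  | h0 => simp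
  | hadd a a' h h' => simp only [map_add, LinearMap.add_apply, h, h']
  | hsmul r a h => simp only [map_smul, LinearMap.smul_apply, h]
  | he y t =>
  induction c using fun_induction with
  | h0 => simp
  | hadd a a' h h' => simp only [map_add, h, h']
  | hsmul r a h => simp only [map_smul, h]
  | he z r =>
    rw [mulMap_e, mulMap_e]
    by_cases h2 : z * t * z⁻¹ = r
    · subst h2
      by_cases h1 : y * s * y⁻¹ = t
      · subst h1
        rw [if_pos rfl, if_pos rfl, map_smul, map_smul, LinearMap.smul_apply, mulMap_e, mulMap_e,
          if_pos rfl, if_pos (by group), smul_smul, smul_smul, mul_assoc z y x]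
        have := φ.chi_cocycle x y z (z * (y * s * y⁻¹) * z⁻¹)
        rw [show z⁻¹ * (z * (y * s * y⁻¹) * z⁻¹) * z = y * s * y⁻¹ by group] at this
        rw [← Units.val_mul, ← Units.val_mul, this]
      · rw [if_neg h1, if_pos rfl, map_smul, mulMap_e, if_neg]
        · simp
        · contrapose! h1
          apply mul_left_cancel (a := z)
          apply mul_right_cancel (b := z⁻¹)
          rw [← h1]
          group
    · rw [if_neg h2]
      split_ifs
      · rw [map_smul, LinearMap.smul_apply, mulMap_e, if_neg h2, smul_zero, map_zero]
      · simp

theorem mulMap_unit_left (a : G × G → k) : mulMap φ (unit k G) a = a := by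
  induction a using fun_induction with
  | h0 => simp
  | hadd a a' h h' => simp only [map_add, h, h']
  | hsmul r a h => simp only [map_smul, h]
  | he x s =>
    have h : ∀ t, x * t * x⁻¹ = s ↔ t = x⁻¹ * s * x := fun t => by
      rw [mul_inv_eq_iff_eq_mul, ← eq_inv_mul_iff_mul_eq, mul_assoc]
    simp [unit, -Pi.basisFun_apply, mulMap_e, h]

theorem mulMap_unit_right (a : G × G → k) : mulMap φ a (unit k G) = a := by
  induction a using fun_induction with
  | h0 => simp
  | hadd a a' h h' => simp only [map_add, LinearMap.add_apply, h, h']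
  | hsmul r a h => simp only [map_smul, LinearMap.smul_apply, h]
  | he x s => simp [unit, -Pi.basisFun_apply, mulMap_e]

end TwistedDouble

/-- The algebra `D^φ(G)`, with underlying module the functions on `G × G`. -/
def TwistedDouble {k G : Type u} [CommRing k] [Group G] (_ : Cocycle₃ k G) : Type u := G × G → k

namespace TwistedDouble

variable {k G : Type u} [CommRing k] [Group G] [Fintype G] [DecidableEq G] (φ : Cocycle₃ k G)

noncomputable instance : Ring (TwistedDouble φ) where
  __ := (inferInstance : AddCommGroup (G × G → k))
  mul a b := mulMap φ a b
  one := unit k G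
  mul_assoc := mulMap_assoc φ
  one_mul := mulMap_unit_left φ
  mul_one := mulMap_unit_right φ
  left_distrib a := map_add (mulMap φ a)
  right_distrib := (mulMap φ).map_add₂
  zero_mul := (mulMap φ).map_zero₂
  mul_zero a := map_zero (mulMap φ a)

noncomputable instance : Algebra k (TwistedDouble φ) :=
  letI : Module k (TwistedDouble φ) := inferInstanceAs (Module k (G × G → k))
  Algebra.ofModule
    (mulMap φ).map_smul₂
    (fun r a b => (mulMap φ a).map_smul r b)

/-- The basis of `D^φ(G)` consisting of the elements `x ⊗ δ_s`. -/
noncomputable def basis : Module.Basis (G × G) k (TwistedDouble φ) := Pi.basisFun k (G × G)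

/-- The element `x ⊗ δ_s` of `D^φ(G)`. -/
noncomputable def e (x s : G) : TwistedDouble φ := basis φ (x, s)

variable {φ} in
theorem induction {p : TwistedDouble φ → Prop} (a : TwistedDouble φ) (h0 : p 0)
    (he : ∀ x s, p (e φ x s)) (hadd : ∀ a b, p a → p b → p (a + b))
    (hsmul : ∀ (c : k) a, p a → p (c • a)) : p a :=
  fun_induction a h0 he hadd hsmul

theorem e_mul_e (x s y t : G) : e φ x s * e φ y t =
    if y * s * y⁻¹ = t then (chi φ y x t : k) • e φ (y * x) t else 0 := mulMap_e φ x s y t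

theorem one_def : (1 : TwistedDouble φ) = ∑ s, e φ 1 s := rfl

/-- Solving the condition for s lets a sum over the left index collapse to one term. -/
theorem e_mul_e_eq (x s y t : G) : e φ x s * e φ y t =
    if y⁻¹ * t * y = s then (chi φ y x t : k) • e φ (y * x) t else 0 := by
  rw [e_mul_e]
  congr 1
  rw [mul_inv_eq_iff_eq_mul, ← eq_inv_mul_iff_mul_eq, ← mul_assoc]
  exact propext eq_comm

theorem e_mul_idem (x s t : G) : e φ x s * e φ 1 t = if s = t then e φ x s else 0 := by
  rw [e_mul_e]
  split_ifs <;> simp_all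

theorem idem_mul_e (s y t : G) : e φ 1 s * e φ y t = if y⁻¹ * t * y = s then e φ y t else 0 := by
  rw [e_mul_e_eq]
  split_ifs <;> simp

/-- The element `x ⊗ 1` of `D^φ(G)`. -/
noncomputable def grp (x : G) : TwistedDouble φ := ∑ s, e φ x s

theorem grp_mul_e (x y t : G) : grp φ x * e φ y t = (chi φ y x t : k) • e φ (y * x) t := by
  simp [grp, Finset.sum_mul, e_mul_e_eq]

theorem grp_mul_idem (x s : G) : grp φ x * e φ 1 s = e φ x s := by
  simp [grp_mul_e]

-- The idempotents `e φ 1 s` sum to 1, so an identity may be tested on each of them.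
variable {φ} in
theorem ext_mul_idem {a b : TwistedDouble φ} (h : ∀ s, a * e φ 1 s = b * e φ 1 s) : a = b := by
  rw [← mul_one a, ← mul_one b, one_def, Finset.mul_sum, Finset.mul_sum]
  exact Finset.sum_congr rfl fun s _ => h s

/-- The inverse of `x ⊗ 1`. -/
noncomputable def grpInv (x : G) : TwistedDouble φ :=
  ∑ s, ((chi φ x⁻¹ x s)⁻¹ : kˣ).val • e φ x⁻¹ s

/-- The element `x ⊗ 1` is invertible. -/
noncomputable def grpUnit (x : G) : (TwistedDouble φ)ˣ where
  val := grp φ x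
  inv := grpInv φ x
  val_inv := by simp [grpInv, Finset.mul_sum, grp_mul_e, smul_smul, one_def]
  -- In this order the inverse scalar is taken at x⁻¹sx and the product contributes χ(x, x⁻¹)(s);
  -- `chi_inv_left` says that they cancel.
  inv_val := ext_mul_idem fun s => by
    rw [mul_assoc, grp_mul_idem, grpInv, Finset.sum_mul]
    simp only [smul_mul_assoc, e_mul_e_eq, smul_ite, smul_zero, Finset.sum_ite_eq,
      Finset.mem_univ, if_true, φ.chi_inv_left, smul_smul, one_mul]
    simp

/-- The inclusion of `k(G)` in `D^φ(G)`. -/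
noncomputable def incl : (G → k) →ₐ[k] TwistedDouble φ :=
  AlgHom.ofLinearMap (Fintype.linearCombination k (e φ 1))
    (by simp [Fintype.linearCombination_apply, one_def])
    (fun f g => by
      simp [Fintype.linearCombination_apply, Finset.sum_mul, Finset.mul_sum, e_mul_idem, smul_smul,
        mul_comm])

theorem incl_apply (f : G → k) : incl φ f = ∑ s, f s • e φ 1 s := rfl

@[simp] theorem incl_δ (s : G) : incl φ (δ k s) = e φ 1 s := by
  simp [incl_apply, δ_apply]

theorem incl_mul_e (f : G → k) (y t : G) : incl φ f * e φ y t = f (y⁻¹ * t * y) • e φ y t := by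
  simp [incl_apply, Finset.sum_mul, idem_mul_e]

end TwistedDouble
end QuasiHopf

/-! ### Coproduct, counit, associator and quasi-coassociativity -/

namespace QuasiHopf

namespace TwistedDouble

variable {k G : Type u} [CommRing k] [Group G] [Fintype G] [DecidableEq G] (φ : Cocycle₃ k G)

section Separation

variable {φ} {A : Type u} [Ring A] [Algebra k A]

/-- The second factor carries an arbitrary partition of unity, so that the lemma can be iterated to
threefold tensor powers. -/
theorem ext_tmul_idem {ι : Type u} [Fintype ι] {f : ι → A} (hf : ∑ i, f i = 1)
    {X Y : TwistedDouble φ ⊗[k] A}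
    (h : ∀ s i, X * (e φ 1 s ⊗ₜ f i) = Y * (e φ 1 s ⊗ₜ f i)) : X = Y := by
  rw [← mul_one X, ← mul_one Y, Algebra.TensorProduct.one_def, one_def, ← hf,
    TensorProduct.sum_tmul]
  simp only [TensorProduct.tmul_sum, Finset.mul_sum, h]

theorem sum_idem₂ :
    ∑ p : G × G, e φ 1 p.1 ⊗ₜ[k] e φ 1 p.2 = (1 : TwistedDouble φ ⊗[k] TwistedDouble φ) := by
  rw [Algebra.TensorProduct.one_def, one_def, TensorProduct.sum_tmul, Fintype.sum_prod_type]
  simp only [TensorProduct.tmul_sum]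

theorem ext_idem₂ {X Y : TwistedDouble φ ⊗[k] TwistedDouble φ}
    (h : ∀ a b, X * (e φ 1 a ⊗ₜ e φ 1 b) = Y * (e φ 1 a ⊗ₜ e φ 1 b)) : X = Y :=
  ext_tmul_idem (one_def φ).symm h

theorem ext_idem₃ {X Y : TwistedDouble φ ⊗[k] (TwistedDouble φ ⊗[k] TwistedDouble φ)}
    (h : ∀ a b c, X * (e φ 1 a ⊗ₜ (e φ 1 b ⊗ₜ e φ 1 c)) =
      Y * (e φ 1 a ⊗ₜ (e φ 1 b ⊗ₜ e φ 1 c))) : X = Y :=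
  ext_tmul_idem sum_idem₂ fun a p => h a p.1 p.2

end Separation

/-- The coproduct of `D^φ(G)` as a linear map. -/
noncomputable def comulMap : TwistedDouble φ →ₗ[k] TwistedDouble φ ⊗[k] TwistedDouble φ :=
  (basis φ).constr k fun p => ∑ a, ∑ c, if a * c = p.2 then
    (gam φ p.1 a c : k) • (e φ p.1 a ⊗ₜ[k] e φ p.1 c) else 0

theorem comulMap_e (x s : G) : comulMap φ (e φ x s) = ∑ a, ∑ c, if a * c = s then
    (gam φ x a c : k) • (e φ x a ⊗ₜ[k] e φ x c) else 0 := by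
  rw [comulMap, e, Module.Basis.constr_basis]

/-- Right multiplication keeps only the summand whose degrees are the end points of the arrows (y,
a) and (z, b). The case y ≠ z is needed for quasi-cocommutativity, where R has moved only one leg.
-/
theorem comulMap_e_mul (x s y a z b : G) :
    comulMap φ (e φ x s) * (e φ y a ⊗ₜ e φ z b) =
      if (y⁻¹ * a * y) * (z⁻¹ * b * z) = s then
        (gam φ x (y⁻¹ * a * y) (z⁻¹ * b * z) * chi φ y x a * chi φ z x b : k) •
          (e φ (y * x) a ⊗ₜ[k] e φ (z * x) b) else 0 := by
  rw [comulMap_e, Finset.sum_mul, Finset.sum_eq_single (y⁻¹ * a * y), Finset.sum_mul,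
    Finset.sum_eq_single (z⁻¹ * b * z)]
  · split_ifs
    · simp [e_mul_e_eq, smul_smul, TensorProduct.smul_tmul', TensorProduct.tmul_smul, mul_assoc,
        mul_comm, mul_left_comm]
    · simp
  · intro c _ hc
    split_ifs <;> simp [e_mul_e_eq, hc.symm]
  · simp
  · intro c _ hc
    rw [Finset.sum_mul]
    refine Finset.sum_eq_zero fun f _ => ?_
    split_ifs <;> simp [e_mul_e_eq, hc.symm]
  · simp

theorem comulMap_e_mul_idem (x s a b : G) :
    comulMap φ (e φ x s) * (e φ 1 a ⊗ₜ e φ 1 b) =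
      if a * b = s then (gam φ x a b : k) • (e φ x a ⊗ₜ[k] e φ x b) else 0 := by
  simp [comulMap_e_mul]

theorem comulMap_one : comulMap φ 1 = 1 :=
  ext_idem₂ fun a b => by
    simp [one_def, Finset.sum_mul, comulMap_e_mul_idem]

/-- On basis elements, tested against the idempotents, this is `gam_chi`; conjugation by y matches
the supports of the two sides. -/
theorem comulMap_mul (a b : TwistedDouble φ) :
    comulMap φ (a * b) = comulMap φ a * comulMap φ b := by
  induction a using induction with
  | h0 => simp
  | hadd a a' h h' => simp only [map_add, add_mul, h, h']
  | hsmul r a h => simp only [map_smul, smul_mul_assoc, h]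
  | he x s =>
  induction b using induction with
  | h0 => simp
  | hadd a a' h h' => simp only [map_add, mul_add, h, h']
  | hsmul r a h => simp only [map_smul, mul_smul_comm, h]
  | he y t =>
  refine ext_idem₂ fun a b => ?_
  rw [mul_assoc, comulMap_e_mul_idem, e_mul_e_eq, mul_ite, mul_smul_comm, comulMap_e_mul]
  have h : y⁻¹ * a * y * (y⁻¹ * b * y) = y⁻¹ * (a * b) * y := by group
  rw [h]
  by_cases h1 : y⁻¹ * t * y = s
  · subst h1
    rw [if_pos rfl, map_smul, smul_mul_assoc, comulMap_e_mul_idem]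
    by_cases h2 : a * b = t
    · subst h2
      simp only [if_true, smul_smul, ← Units.val_mul]
      rw [← φ.gam_chi]
      simp only [mul_assoc]
    · have h3 : ¬ y⁻¹ * (a * b) * y = y⁻¹ * t * y := by simpa using h2
      simp [h2]
  · rw [if_neg h1, map_zero, zero_mul]
    split_ifs with h2 h3
    · subst h2; exact absurd h3 h1
    · simp
    · simp

/-- The coproduct of `D^φ(G)`. -/
noncomputable def comul : TwistedDouble φ →ₐ[k] TwistedDouble φ ⊗[k] TwistedDouble φ :=
  AlgHom.ofLinearMap (comulMap φ) (comulMap_one φ) (comulMap_mul φ)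

theorem comul_e (x s : G) : comul φ (e φ x s) = ∑ a, ∑ c, if a * c = s then
    (gam φ x a c : k) • (e φ x a ⊗ₜ[k] e φ x c) else 0 := comulMap_e φ x s

theorem comul_e_mul (x s y a z b : G) :
    comul φ (e φ x s) * (e φ y a ⊗ₜ e φ z b) =
      if (y⁻¹ * a * y) * (z⁻¹ * b * z) = s then
        (gam φ x (y⁻¹ * a * y) (z⁻¹ * b * z) * chi φ y x a * chi φ z x b : k) •
          (e φ (y * x) a ⊗ₜ[k] e φ (z * x) b) else 0 := comulMap_e_mul φ x s y a z b

theorem comul_e_mul_idem (x s a b : G) :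
    comul φ (e φ x s) * (e φ 1 a ⊗ₜ e φ 1 b) =
      if a * b = s then (gam φ x a b : k) • (e φ x a ⊗ₜ[k] e φ x b) else 0 :=
  comulMap_e_mul_idem φ x s a b

/-- The linear map underlying the counit of `D^φ(G)`. -/
noncomputable def counitMap : TwistedDouble φ →ₗ[k] k :=
  (basis φ).constr k fun p => if p.2 = 1 then 1 else 0

theorem counitMap_e (x s : G) : counitMap φ (e φ x s) = if s = 1 then 1 else 0 := by
  rw [counitMap, e, Module.Basis.constr_basis]

/-- The counit of `D^φ(G)`. -/
noncomputable def counit : TwistedDouble φ →ₐ[k] k :=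
  AlgHom.ofLinearMap (counitMap φ) (by simp [one_def, counitMap_e]) (fun a b => by
    induction a using induction with
    | h0 => simp
    | hadd a a' h h' => simp only [map_add, add_mul, h, h']
    | hsmul r a h => simp only [map_smul, smul_mul_assoc, h]
    | he x s =>
    induction b using induction with
    | h0 => simp
    | hadd a a' h h' => simp only [map_add, mul_add, h, h']
    | hsmul r a h => simp only [map_smul, mul_smul_comm, h]
    | he y t =>
    rw [e_mul_e_eq, counitMap_e, counitMap_e]
    by_cases h1 : y⁻¹ * t * y = s
    · subst h1
      rw [if_pos rfl, map_smul, counitMap_e]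
      by_cases h2 : t = 1
      · subst h2; simp
      · have h3 : ¬ y⁻¹ * t * y = 1 := by
          rw [mul_assoc, inv_mul_eq_one]
          contrapose! h2
          simpa using h2.symm
        simp [h2]
    · rw [if_neg h1]
      split_ifs with h2 h3
      · subst h2 h3; simp at h1
      · simp
      · simp
      · simp)

@[simp] theorem counit_e (x s : G) : counit φ (e φ x s) = if s = 1 then 1 else 0 :=
  counitMap_e φ x s

/-- The inclusion of `k(G)` in `D^φ(G)` on threefold tensor powers. -/
noncomputable def incl₃ : (G → k) ⊗[k] ((G → k) ⊗[k] (G → k)) →ₐ[k]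
    TwistedDouble φ ⊗[k] (TwistedDouble φ ⊗[k] TwistedDouble φ) :=
  Algebra.TensorProduct.map (incl φ) (Algebra.TensorProduct.map (incl φ) (incl φ))

/-- The associator of `D^φ(G)`. -/
noncomputable def phi : (TwistedDouble φ ⊗[k] (TwistedDouble φ ⊗[k] TwistedDouble φ))ˣ :=
  Units.map (incl₃ φ).toMonoidHom φ.unit

theorem phi_val : (phi φ).val = incl₃ φ φ.unit.val := rfl

theorem phi_inv : (phi φ).inv = incl₃ φ φ.unit.inv := rfl

/-- Functions multiply basis elements from the left by their value at the end points of the arrows,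
so the associator and its inverse act diagonally. -/
theorem incl₃_mul_e (t : (G → k) ⊗[k] ((G → k) ⊗[k] (G → k))) (x a y b z c : G) :
    incl₃ φ t * (e φ x a ⊗ₜ (e φ y b ⊗ₜ e φ z c)) =
      evt (ev k (x⁻¹ * a * x)) (evt (ev k (y⁻¹ * b * y)) (ev k (z⁻¹ * c * z))) t •
        (e φ x a ⊗ₜ (e φ y b ⊗ₜ e φ z c)) := by
  induction t using three_induction with
  | h0 => simp
  | h f g h => simp [incl₃, incl_mul_e, ← TensorProduct.smul_tmul', TensorProduct.tmul_smul,
      smul_smul, mul_comm]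
  | hadd s t hs ht => simp only [map_add, add_mul, add_smul, hs, ht]

theorem phi_mul_e (x a y b z c : G) :
    (phi φ).val * (e φ x a ⊗ₜ (e φ y b ⊗ₜ e φ z c)) =
      (φ.val (x⁻¹ * a * x) (y⁻¹ * b * y) (z⁻¹ * c * z) : k) •
        (e φ x a ⊗ₜ (e φ y b ⊗ₜ e φ z c)) := by
  rw [phi_val, incl₃_mul_e]; simp [Cocycle₃.unit]

theorem phi_inv_mul_e (x a y b z c : G) :
    (phi φ).inv * (e φ x a ⊗ₜ (e φ y b ⊗ₜ e φ z c)) =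
      ((φ.val (x⁻¹ * a * x) (y⁻¹ * b * y) (z⁻¹ * c * z))⁻¹ : kˣ).val •
        (e φ x a ⊗ₜ (e φ y b ⊗ₜ e φ z c)) := by
  rw [phi_inv, incl₃_mul_e]; simp [Cocycle₃.unit]

theorem map_id_comul_mul_idem (x s a b c : G) :
    Algebra.TensorProduct.map (AlgHom.id k _) (comul φ) (comul φ (e φ x s)) *
      (e φ 1 a ⊗ₜ (e φ 1 b ⊗ₜ e φ 1 c)) =
    if a * (b * c) = s then (gam φ x a (b * c) * gam φ x b c : k) •
      (e φ x a ⊗ₜ (e φ x b ⊗ₜ e φ x c)) else 0 := by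
  rw [comul_e, map_sum, Finset.sum_mul, Finset.sum_eq_single a, map_sum, Finset.sum_mul,
    Finset.sum_eq_single (b * c)]
  · split_ifs
    · simp [comul_e_mul_idem, e_mul_idem, smul_smul]
    · simp
  · intro d _ hd
    split_ifs
    · simp [comul_e_mul_idem, hd.symm]
    · simp
  · simp
  · intro d _ hd
    rw [map_sum, Finset.sum_mul]
    refine Finset.sum_eq_zero fun f _ => ?_
    split_ifs
    · simp [e_mul_idem, hd]
    · simp
  · simp

/-- Moves a multiplication inside the rebracketing, where the formula for Δ on the first two legs
applies. -/
theorem reassoc_mul_tmul (t : TwistedDouble φ ⊗[k] TwistedDouble φ) (a b c d : TwistedDouble φ) :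
    reassoc k _ _ _ (t ⊗ₜ[k] d) * (a ⊗ₜ (b ⊗ₜ c)) =
      reassoc k _ _ _ ((t * (a ⊗ₜ b)) ⊗ₜ[k] (d * c)) := by
  rw [← Algebra.TensorProduct.tmul_mul_tmul, map_mul]
  simp

theorem map_comul_id_mul_idem (x s a b c : G) :
    reassoc k _ _ _ (Algebra.TensorProduct.map (comul φ) (AlgHom.id k _) (comul φ (e φ x s))) *
      (e φ 1 a ⊗ₜ (e φ 1 b ⊗ₜ e φ 1 c)) =
    if a * b * c = s then (gam φ x (a * b) c * gam φ x a b : k) •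
      (e φ x a ⊗ₜ (e φ x b ⊗ₜ e φ x c)) else 0 := by
  rw [comul_e, map_sum, map_sum, Finset.sum_mul, Finset.sum_eq_single (a * b), map_sum, map_sum,
    Finset.sum_mul, Finset.sum_eq_single c]
  · split_ifs
    · simp only [map_smul, Algebra.TensorProduct.map_tmul, smul_mul_assoc, reassoc_mul_tmul]
      simp [comul_e_mul_idem, e_mul_idem, smul_smul, TensorProduct.smul_tmul']
    · simp
  · intro d _ hd
    split_ifs
    · simp only [map_smul, Algebra.TensorProduct.map_tmul, smul_mul_assoc, reassoc_mul_tmul]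
      simp [e_mul_idem, hd]
    · simp
  · simp
  · intro d _ hd
    rw [map_sum, map_sum, Finset.sum_mul]
    refine Finset.sum_eq_zero fun f _ => ?_
    split_ifs
    · simp only [map_smul, Algebra.TensorProduct.map_tmul, smul_mul_assoc, reassoc_mul_tmul]
      simp [comul_e_mul_idem, hd.symm]
    · simp
  · simp

theorem quasi_coassoc (h : TwistedDouble φ) :
    Algebra.TensorProduct.map (AlgHom.id k _) (comul φ) (comul φ h) =
      (phi φ).val * reassoc k _ _ _
        (Algebra.TensorProduct.map (comul φ) (AlgHom.id k _) (comul φ h)) * (phi φ).inv := by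
  -- With the inverse cleared, the associator multiplies basis tensors on both sides and the claim
  -- becomes `gam_assoc`.
  suffices H : Algebra.TensorProduct.map (AlgHom.id k _) (comul φ) (comul φ h) * (phi φ).val =
      (phi φ).val * reassoc k _ _ _
        (Algebra.TensorProduct.map (comul φ) (AlgHom.id k _) (comul φ h)) by
    rw [← H, mul_assoc, (phi φ).val_inv, mul_one]
  induction h using induction with
  | h0 => simp
  | hadd a a' h h' => simp only [map_add, mul_add, add_mul, h, h']
  | hsmul r a h => simp only [map_smul, mul_smul_comm, smul_mul_assoc, h]
  | he x s =>
  refine ext_idem₃ fun a b c => ?_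
  rw [mul_assoc, mul_assoc, phi_mul_e, mul_smul_comm, map_id_comul_mul_idem,
    map_comul_id_mul_idem, ← mul_assoc]
  split_ifs
  · rw [mul_smul_comm, phi_mul_e, smul_smul, smul_smul]
    simpa using congrArg (fun u : kˣ => u.val • (e φ x a ⊗ₜ[k] (e φ x b ⊗ₜ[k] e φ x c)))
      (φ.gam_assoc x a b c)
  · simp

end TwistedDouble
end QuasiHopf

/-! ### The R-matrix and the hexagon identities -/

namespace QuasiHopf

namespace TwistedDouble

variable {k G : Type u} [CommRing k] [Group G] [Fintype G] [DecidableEq G] (φ : Cocycle₃ k G)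

omit [Group G] [Fintype G] in
theorem δ_mul_δ (a b : G) : δ k a * δ k b = if a = b then δ k a else 0 := by
  funext x
  simp only [Pi.mul_apply, δ_apply]
  split_ifs <;> simp_all [δ_apply]

omit [Group G] in
theorem sum_δ : ∑ a : G, δ k a = 1 := by
  funext x
  simp [δ_apply]

/-- The element `∑ (x ⊗ 1) ⊗ δ_x` of `D^φ(G) ⊗ k(G)`. -/
noncomputable def halfR : (TwistedDouble φ ⊗[k] (G → k))ˣ where
  val := ∑ x, grp φ x ⊗ₜ δ k x
  inv := ∑ x, grpInv φ x ⊗ₜ δ k x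
  val_inv := by
    have h : ∀ x, grp φ x * grpInv φ x = 1 := fun x => (grpUnit φ x).val_inv
    simp [Finset.sum_mul, Finset.mul_sum, δ_mul_δ, TensorProduct.tmul_ite, h,
      ← TensorProduct.tmul_sum, sum_δ, Algebra.TensorProduct.one_def]
  inv_val := by
    have h : ∀ x, grpInv φ x * grp φ x = 1 := fun x => (grpUnit φ x).inv_val
    simp [Finset.sum_mul, Finset.mul_sum, δ_mul_δ, TensorProduct.tmul_ite, h,
      ← TensorProduct.tmul_sum, sum_δ, Algebra.TensorProduct.one_def]

/-- The quasitriangular structure of `D^φ(G)`. -/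
noncomputable def R : (TwistedDouble φ ⊗[k] TwistedDouble φ)ˣ :=
  Units.map (Algebra.TensorProduct.map (AlgHom.id k _) (incl φ)).toMonoidHom (halfR φ)

theorem R_val : (R φ).val = ∑ x, grp φ x ⊗ₜ e φ 1 x := by
  change Algebra.TensorProduct.map (AlgHom.id k _) (incl φ) (halfR φ).val = _
  simp [halfR]

/-- The second leg of R reads off the degree y⁻¹by of the right factor, and the first leg then acts
on the left factor by that group element. -/
theorem R_mul_e (x a y b : G) :
    (R φ).val * (e φ x a ⊗ₜ e φ y b) =
      (chi φ x (y⁻¹ * b * y) a : k) • (e φ (x * (y⁻¹ * b * y)) a ⊗ₜ e φ y b) := by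
  rw [R_val, Finset.sum_mul, Finset.sum_eq_single (y⁻¹ * b * y)]
  · simp [grp_mul_e, idem_mul_e, TensorProduct.smul_tmul']
  · intro c _ hc
    simp [idem_mul_e, hc.symm]
  · simp

theorem quasi_cocomm (h : TwistedDouble φ) :
    Algebra.TensorProduct.comm k _ _ (comul φ h) * (R φ).val = (R φ).val * comul φ h := by
  induction h using induction with
  | h0 => simp
  | hadd a a' h h' => simp only [map_add, mul_add, add_mul, h, h']
  | hsmul r a h => simp only [map_smul, mul_smul_comm, smul_mul_assoc, h]
  | he x s =>
  refine ext_idem₂ fun a b => ?_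
  have hc : ∀ (t : TwistedDouble φ ⊗[k] TwistedDouble φ) (u v : TwistedDouble φ),
      Algebra.TensorProduct.comm k _ _ t * (u ⊗ₜ v) =
        Algebra.TensorProduct.comm k _ _ (t * (v ⊗ₜ u)) := fun t u v => by
    rw [map_mul, Algebra.TensorProduct.comm_tmul]
  -- R changes the degree of the first factor from a to b⁻¹ab; after the flip the total degree is
  -- still ab, so both sides have the same support. The scalars agree by `gam_swap`.
  have h1 : b * (b⁻¹ * a * b) = a * b := by group
  rw [mul_assoc, mul_assoc, R_mul_e, comul_e_mul_idem, mul_smul_comm, hc, comul_e_mul]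
  simp only [inv_one, one_mul, mul_one, h1]
  split_ifs with h2
  · have h3 : x * (x⁻¹ * b * x) = b * x := by group
    rw [mul_smul_comm, R_mul_e, h3]
    simp only [map_smul, Algebra.TensorProduct.comm_tmul, smul_smul]
    simpa [mul_comm] using congrArg (fun u : kˣ => u.val • (e φ (b * x) a ⊗ₜ[k] e φ x b))
      (φ.gam_swap x a b).symm
  · simp

theorem leg312_mul_e (t : (G → k) ⊗[k] ((G → k) ⊗[k] (G → k))) (x a y b z c : G) :
    leg312 k _ (incl₃ φ t) * (e φ x a ⊗ₜ (e φ y b ⊗ₜ e φ z c)) =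
      evt (ev k (z⁻¹ * c * z)) (evt (ev k (x⁻¹ * a * x)) (ev k (y⁻¹ * b * y))) t •
        (e φ x a ⊗ₜ (e φ y b ⊗ₜ e φ z c)) := by
  induction t using three_induction with
  | h0 => simp
  | h f g h =>
    simp [leg312, incl₃, incl_mul_e, ← TensorProduct.smul_tmul', TensorProduct.tmul_smul,
      smul_smul, mul_comm]
    congr 1
    ring
  | hadd s t hs ht => simp only [map_add, add_mul, add_smul, hs, ht]

theorem leg231_mul_e (t : (G → k) ⊗[k] ((G → k) ⊗[k] (G → k))) (x a y b z c : G) :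
    leg231 k _ (incl₃ φ t) * (e φ x a ⊗ₜ (e φ y b ⊗ₜ e φ z c)) =
      evt (ev k (y⁻¹ * b * y)) (evt (ev k (z⁻¹ * c * z)) (ev k (x⁻¹ * a * x))) t •
        (e φ x a ⊗ₜ (e φ y b ⊗ₜ e φ z c)) := by
  induction t using three_induction with
  | h0 => simp
  | h f g h => simp [leg231, incl₃, incl_mul_e, ← TensorProduct.smul_tmul',
      TensorProduct.tmul_smul, smul_smul, mul_comm, mul_left_comm]
  | hadd s t hs ht => simp only [map_add, add_mul, add_smul, hs, ht]

theorem leg132_mul_e (t : (G → k) ⊗[k] ((G → k) ⊗[k] (G → k))) (x a y b z c : G) :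
    leg132 k _ (incl₃ φ t) * (e φ x a ⊗ₜ (e φ y b ⊗ₜ e φ z c)) =
      evt (ev k (x⁻¹ * a * x)) (evt (ev k (z⁻¹ * c * z)) (ev k (y⁻¹ * b * y))) t •
        (e φ x a ⊗ₜ (e φ y b ⊗ₜ e φ z c)) := by
  induction t using three_induction with
  | h0 => simp
  | h f g h => simp [leg132, incl₃, incl_mul_e, ← TensorProduct.smul_tmul',
      TensorProduct.tmul_smul, smul_smul, mul_comm]
  | hadd s t hs ht => simp only [map_add, add_mul, add_smul, hs, ht]

theorem leg213_mul_e (t : (G → k) ⊗[k] ((G → k) ⊗[k] (G → k))) (x a y b z c : G) :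
    leg213 k _ (incl₃ φ t) * (e φ x a ⊗ₜ (e φ y b ⊗ₜ e φ z c)) =
      evt (ev k (y⁻¹ * b * y)) (evt (ev k (x⁻¹ * a * x)) (ev k (z⁻¹ * c * z))) t •
        (e φ x a ⊗ₜ (e φ y b ⊗ₜ e φ z c)) := by
  induction t using three_induction with
  | h0 => simp
  | h f g h => simp [leg213, incl₃, incl_mul_e, ← TensorProduct.smul_tmul',
      TensorProduct.tmul_smul, smul_smul, mul_comm, mul_left_comm]
  | hadd s t hs ht => simp only [map_add, add_mul, add_smul, hs, ht]

theorem leg12_R_mul_e (x a y b : G) (u : TwistedDouble φ) :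
    leg12 k _ (R φ).val * (e φ x a ⊗ₜ (e φ y b ⊗ₜ u)) =
      (chi φ x (y⁻¹ * b * y) a : k) • (e φ (x * (y⁻¹ * b * y)) a ⊗ₜ (e φ y b ⊗ₜ u)) := by
  have h : ∀ t : TwistedDouble φ ⊗[k] TwistedDouble φ, leg12 k _ t * (e φ x a ⊗ₜ (e φ y b ⊗ₜ u)) =
      reassoc k _ _ _ ((t * (e φ x a ⊗ₜ e φ y b)) ⊗ₜ u) := fun t => by
    induction t using TensorProduct.induction_on with
    | zero => simp
    | tmul a b => simp [leg12]
    | add s t hs ht => simp only [map_add, add_mul, TensorProduct.add_tmul, hs, ht]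
  rw [h, R_mul_e, ← TensorProduct.smul_tmul']
  simp

theorem leg13_R_mul_e (x a y b : G) (u : TwistedDouble φ) :
    leg13 k _ (R φ).val * (e φ x a ⊗ₜ (u ⊗ₜ e φ y b)) =
      (chi φ x (y⁻¹ * b * y) a : k) • (e φ (x * (y⁻¹ * b * y)) a ⊗ₜ (u ⊗ₜ e φ y b)) := by
  rw [R_val, map_sum, Finset.sum_mul, Finset.sum_eq_single (y⁻¹ * b * y)]
  · simp [leg13, grp_mul_e, idem_mul_e, TensorProduct.smul_tmul']
  · intro c _ hc
    simp [leg13, idem_mul_e, hc.symm]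
  · simp

theorem leg23_R_mul_e (x a y b : G) (u : TwistedDouble φ) :
    leg23 k _ (R φ).val * (u ⊗ₜ (e φ x a ⊗ₜ e φ y b)) =
      (chi φ x (y⁻¹ * b * y) a : k) • (u ⊗ₜ (e φ (x * (y⁻¹ * b * y)) a ⊗ₜ e φ y b)) := by
  simp [leg23, R_mul_e]

theorem comul_grp_mul_idem (g a b : G) :
    comul φ (grp φ g) * (e φ 1 a ⊗ₜ e φ 1 b) = (gam φ g a b : k) • (e φ g a ⊗ₜ e φ g b) := by
  simp [grp, Finset.sum_mul, comul_e_mul_idem]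

/-- On the idempotents of degrees a, b, c the right-hand side yields φ(a, b, c), φ(a, c, c⁻¹bc)⁻¹
and φ(c, c⁻¹ac, c⁻¹bc). Their product is the definition of γ, the coefficient of Δ(c ⊗ 1). -/
theorem hexagon_fst :
    reassoc k _ _ _ (Algebra.TensorProduct.map (comul φ) (AlgHom.id k _) (R φ).val) =
      leg312 k _ (phi φ).val * leg13 k _ (R φ).val * leg132 k _ (phi φ).inv *
        leg23 k _ (R φ).val * (phi φ).val := by
  refine ext_idem₃ fun a b c => ?_
  -- Only the summand indexed by c survives the idempotent in the third slot; `← R_val` refolds the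
  -- copies of R on the other side.
  rw [R_val, map_sum, map_sum, Finset.sum_mul, Finset.sum_eq_single c, ← R_val]
  · rw [Algebra.TensorProduct.map_tmul, reassoc_mul_tmul, comul_grp_mul_idem]
    simp only [mul_assoc]
    rw [phi_mul_e]
    simp only [mul_smul_comm]
    rw [leg23_R_mul_e]
    simp only [mul_smul_comm]
    rw [phi_inv, leg132_mul_e]
    simp only [mul_smul_comm]
    rw [leg13_R_mul_e]
    simp only [mul_smul_comm]
    rw [phi_val, leg312_mul_e]
    simp only [inv_one, one_mul, mul_one, smul_smul, Cocycle₃.unit, evt_fun₃, e_mul_idem,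
      AlgHom.id_apply, if_true, ← TensorProduct.smul_tmul', map_smul, φ.chi_one_left,
      Units.val_one]
    rw [show reassoc k _ _ _ ((e φ c a ⊗ₜ[k] e φ c b) ⊗ₜ[k] e φ 1 c) =
      e φ c a ⊗ₜ[k] (e φ c b ⊗ₜ[k] e φ 1 c) from rfl]
    simp [gam, div_eq_mul_inv, mul_comm, mul_left_comm]
  · intro d _ hd
    rw [Algebra.TensorProduct.map_tmul, reassoc_mul_tmul]
    simp [e_mul_idem, hd]
  · simp

/-- Here the left-hand side has coefficient 1, since Δ of e ⊗ δ_s has γ = 1. On the right, χ(b,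
c)(a) is exactly inverse to the three values of φ that occur. -/
theorem hexagon_snd :
    Algebra.TensorProduct.map (AlgHom.id k _) (comul φ) (R φ).val =
      leg231 k _ (phi φ).inv * leg13 k _ (R φ).val * leg213 k _ (phi φ).val *
        leg12 k _ (R φ).val * (phi φ).inv := by
  refine ext_idem₃ fun a b c => ?_
  rw [R_val, map_sum, Finset.sum_mul, Finset.sum_eq_single (b * c), ← R_val]
  · rw [Algebra.TensorProduct.map_tmul, Algebra.TensorProduct.tmul_mul_tmul, comul_e_mul_idem]
    simp only [mul_assoc]
    rw [phi_inv_mul_e]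
    simp only [mul_smul_comm]
    rw [leg12_R_mul_e]
    simp only [mul_smul_comm]
    rw [phi_val, leg213_mul_e]
    simp only [mul_smul_comm]
    rw [leg13_R_mul_e]
    simp only [mul_smul_comm]
    rw [phi_inv, leg231_mul_e]
    simp only [inv_one, one_mul, mul_one, smul_smul, Cocycle₃.unit, evt_fun₃, grp_mul_idem,
      AlgHom.id_apply, if_true, φ.chi_one_left, φ.gam_one, one_smul, Units.val_one, mul_inv_rev,
      ← Units.val_mul]
    have h : (φ.val a b c)⁻¹ * φ.val b (b⁻¹ * a * b) c * chi φ b c a *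
        (φ.val b c (c⁻¹ * b⁻¹ * a * (b * c)))⁻¹ = 1 := by
      simp only [chi, mul_assoc, div_eq_mul_inv]
      apply Additive.ofMul.injective
      simp only [ofMul_mul, ofMul_inv, ofMul_one]
      abel
    rw [← mul_assoc, ← mul_assoc, h, Units.val_one, one_smul]
  · intro d _ hd
    simp [comul_e_mul_idem, hd.symm]
  · simp

end TwistedDouble
end QuasiHopf

/-! ### Pentagon, counit and antipode -/

namespace QuasiHopf

namespace TwistedDouble

variable {k G : Type u} [CommRing k] [Group G] [Fintype G] [DecidableEq G] (φ : Cocycle₃ k G)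

theorem phi_eq : (phi φ).val = ∑ x, ∑ y, ∑ z,
    (φ.val x y z : k) • (e φ 1 x ⊗ₜ[k] (e φ 1 y ⊗ₜ[k] e φ 1 z)) := by
  rw [phi_val]
  simp [Cocycle₃.unit, fun₃, incl₃]

theorem phi_inv_eq : (phi φ).inv = ∑ x, ∑ y, ∑ z,
    ((φ.val x y z)⁻¹ : kˣ).val • (e φ 1 x ⊗ₜ[k] (e φ 1 y ⊗ₜ[k] e φ 1 z)) := by
  rw [phi_inv]
  simp [Cocycle₃.unit, fun₃, incl₃]

/-- Because γ is trivial at x = 1, the inclusion of k(G) respects coproducts strictly. The pentagon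
can therefore be transported along it. -/
theorem comul_incl (f : G → k) :
    comul φ (incl φ f) = Algebra.TensorProduct.map (incl φ) (incl φ) (funComul k G f) := by
  refine ext_idem₂ fun a b => ?_
  have h : ∀ t : (G → k) ⊗[k] (G → k), Algebra.TensorProduct.map (incl φ) (incl φ) t *
      (e φ 1 a ⊗ₜ e φ 1 b) = evt (ev k a) (ev k b) t • (e φ 1 a ⊗ₜ e φ 1 b) := fun t => by
    induction t using TensorProduct.induction_on with
    | zero => simp
    | tmul f g => simp [incl_mul_e, ← TensorProduct.smul_tmul', TensorProduct.tmul_smul,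
        smul_smul, mul_comm]
    | add s t hs ht => simp only [map_add, add_mul, add_smul, hs, ht]
  have h' := AlgHom.congr_fun (evt_comp_funComul (k := k) a b) f
  rw [AlgHom.comp_apply, ev_apply] at h'
  rw [h, h', incl_apply]
  simp [Finset.sum_mul, comul_e_mul_idem]

/-- The inclusion of `k(G)` in `D^φ(G)` on fourfold tensor powers. -/
noncomputable def incl₄ :=
  Algebra.TensorProduct.map (incl φ) (incl₃ φ)

theorem incl₄_padLeft (t : (G → k) ⊗[k] ((G → k) ⊗[k] (G → k))) :
    incl₄ φ (padLeft k (G → k) t) = padLeft k _ (incl₃ φ t) := by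
  simp [incl₄, padLeft]

theorem incl₄_padRight (t : (G → k) ⊗[k] ((G → k) ⊗[k] (G → k))) :
    incl₄ φ (padRight k (G → k) t) = padRight k _ (incl₃ φ t) := by
  induction t using three_induction with
  | h0 => simp
  | h f g h => simp [incl₄, padRight, incl₃]
  | hadd s t hs ht => simp only [map_add, hs, ht]

theorem incl₄_comulFst (t : (G → k) ⊗[k] ((G → k) ⊗[k] (G → k))) :
    incl₄ φ (comulFst (funComul k G) t) = comulFst (comul φ) (incl₃ φ t) := by
  induction t using three_induction with
  | h0 => simp only [map_zero]
  | h f g h =>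
    simp only [comulFst, AlgHom.comp_apply, Algebra.TensorProduct.map_tmul, incl₃, comul_incl]
    generalize funComul k G f = s
    induction s using TensorProduct.induction_on with
    | zero => simp only [map_zero, TensorProduct.zero_tmul]
    | tmul a b => rfl
    | add s t hs ht => simp only [map_add, TensorProduct.add_tmul, hs, ht]
  | hadd s t hs ht => simp only [map_add, hs, ht]

theorem incl₄_comulSnd (t : (G → k) ⊗[k] ((G → k) ⊗[k] (G → k))) :
    incl₄ φ (comulSnd (funComul k G) t) = comulSnd (comul φ) (incl₃ φ t) := by
  induction t using three_induction with
  | h0 => simp only [map_zero]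
  | h f g h =>
    simp only [comulSnd, AlgHom.comp_apply, Algebra.TensorProduct.map_tmul, incl₃, comul_incl]
    generalize funComul k G g = s
    induction s using TensorProduct.induction_on with
    | zero => simp only [map_zero, TensorProduct.zero_tmul, TensorProduct.tmul_zero]
    | tmul a b => rfl
    | add s t hs ht =>
      simp only [map_add, TensorProduct.add_tmul, TensorProduct.tmul_add, hs, ht]
  | hadd s t hs ht => simp only [map_add, hs, ht]

theorem incl₄_comulTrd (t : (G → k) ⊗[k] ((G → k) ⊗[k] (G → k))) :
    incl₄ φ (comulTrd (funComul k G) t) = comulTrd (comul φ) (incl₃ φ t) := by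
  induction t using three_induction with
  | h0 => simp only [map_zero]
  | h f g h => simp [incl₄, comulTrd, incl₃, comul_incl]
  | hadd s t hs ht => simp only [map_add, hs, ht]

theorem cocycle :
    padLeft k _ (phi φ).val * comulSnd (comul φ) (phi φ).val * padRight k _ (phi φ).val =
      comulTrd (comul φ) (phi φ).val * comulFst (comul φ) (phi φ).val := by
  rw [phi_val, ← incl₄_padLeft, ← incl₄_padRight, ← incl₄_comulFst, ← incl₄_comulSnd,
    ← incl₄_comulTrd, ← map_mul, ← map_mul, ← map_mul]
  exact congrArg (incl₄ φ) (funAlg φ).cocycle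

theorem normalized : Algebra.TensorProduct.map (AlgHom.id k _)
    ((Algebra.TensorProduct.lid k _).toAlgHom.comp
      (Algebra.TensorProduct.map (counit φ) (AlgHom.id k _))) (phi φ).val = 1 := by
  rw [phi_eq, ← sum_idem₂, Fintype.sum_prod_type]
  simp only [map_sum]
  refine Finset.sum_congr rfl fun x _ => ?_
  rw [Finset.sum_eq_single 1]
  · simp
  · intro y _ hy
    simp [hy]
  · simp

theorem counit_left (h : TwistedDouble φ) : Algebra.TensorProduct.lid k _
    (Algebra.TensorProduct.map (counit φ) (AlgHom.id k _) (comul φ h)) = h := by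
  induction h using induction with
  | h0 => simp
  | hadd a a' h h' => simp only [map_add, h, h']
  | hsmul r a h => simp only [map_smul, h]
  | he x s =>
    rw [comul_e, map_sum, map_sum, Finset.sum_eq_single 1]
    · simp
    · intro a _ ha
      simp [apply_ite (Algebra.TensorProduct.map (counit φ) (AlgHom.id k (TwistedDouble φ))), ha]
    · simp

theorem counit_right (h : TwistedDouble φ) : Algebra.TensorProduct.rid k k _
    (Algebra.TensorProduct.map (AlgHom.id k _) (counit φ) (comul φ h)) = h := by
  induction h using induction with
  | h0 => simp
  | hadd a a' h h' => simp only [map_add, h, h']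
  | hsmul r a h => simp only [map_smul, h]
  | he x s =>
    rw [comul_e, Finset.sum_comm, map_sum, map_sum, Finset.sum_eq_single 1]
    · simp
    · intro a _ ha
      simp [apply_ite (Algebra.TensorProduct.map (AlgHom.id k (TwistedDouble φ)) (counit φ)), ha]
    · simp

/-- The involution `(x, s) ↦ (x⁻¹, x⁻¹ s⁻¹ x)`. -/
def antipodeEquiv (G : Type u) [Group G] : G × G ≃ G × G where
  toFun p := (p.1⁻¹, p.1⁻¹ * p.2⁻¹ * p.1)
  invFun p := (p.1⁻¹, p.1⁻¹ * p.2⁻¹ * p.1)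
  left_inv p := Prod.ext (inv_inv _) (by simp [mul_assoc])
  right_inv p := Prod.ext (inv_inv _) (by simp [mul_assoc])

/-- The linear map underlying the antipode of `D^φ(G)`. -/
noncomputable def antipodeMap : TwistedDouble φ ≃ₗ[k] TwistedDouble φ :=
  -- A basis is sent to a permuted basis rescaled by units, so bijectivity is built in.
  (basis φ).equiv (((basis φ).reindex (antipodeEquiv G).symm).unitsSMul
    fun p => φ.sig p.1 p.2) (Equiv.refl _)

theorem antipodeMap_e (x s : G) :
    antipodeMap φ (e φ x s) = (φ.sig x s : k) • e φ x⁻¹ (x⁻¹ * s⁻¹ * x) := by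
  rw [antipodeMap, e, Module.Basis.equiv_apply, Module.Basis.unitsSMul_apply,
    Module.Basis.reindex_apply]
  rfl

theorem antipodeMap_one : antipodeMap φ 1 = 1 := by
  simp only [one_def, map_sum, antipodeMap_e, inv_one, one_mul, mul_one, φ.sig_one_left,
    Units.val_one, one_smul]
  exact Fintype.sum_equiv (Equiv.inv G) _ _ fun _ => rfl

theorem antipodeMap_mul (a b : TwistedDouble φ) :
    antipodeMap φ (a * b) = antipodeMap φ b * antipodeMap φ a := by
  induction a using induction with
  | h0 => simp
  | hadd a a' h h' => simp only [map_add, mul_add, add_mul, h, h']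
  | hsmul r a h => simp only [map_smul, mul_smul_comm, smul_mul_assoc, h]
  | he x s =>
  induction b using induction with
  | h0 => simp
  | hadd a a' h h' => simp only [map_add, mul_add, add_mul, h, h']
  | hsmul r a h => simp only [map_smul, mul_smul_comm, smul_mul_assoc, h]
  | he y t =>
  have h : x⁻¹⁻¹ * (x⁻¹ * s⁻¹ * x) * x⁻¹ = y⁻¹ * t⁻¹ * y ↔ y⁻¹ * t * y = s := by
    rw [← inv_inj, eq_comm]
    simp [mul_assoc]
  rw [antipodeMap_e, antipodeMap_e, smul_mul_smul_comm, e_mul_e_eq, e_mul_e_eq]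
  simp only [h]
  split_ifs with h1
  · subst h1
    have h2 := congrArg Units.val (φ.sig_mul x y t)
    simp only [map_smul, antipodeMap_e, smul_smul, mul_inv_rev, Units.val_mul] at h2 ⊢
    simp only [mul_assoc, inv_inv] at h2 ⊢
    rw [h2]
  · simp

/-- The antipode of `D^φ(G)`. -/
noncomputable def antipode : TwistedDouble φ ≃ₐ[k] (TwistedDouble φ)ᵐᵒᵖ :=
  AlgEquiv.ofLinearEquiv ((antipodeMap φ).trans (MulOpposite.opLinearEquiv k))
    (congrArg MulOpposite.op (antipodeMap_one φ))
    (fun a b => congrArg MulOpposite.op (antipodeMap_mul φ a b))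

theorem antipode_e (x s : G) : (antipode φ (e φ x s)).unop =
    (φ.sig x s : k) • e φ x⁻¹ (x⁻¹ * s⁻¹ * x) := antipodeMap_e φ x s

/-- The element `β` of `D^φ(G)`. -/
noncomputable def beta : TwistedDouble φ := incl φ fun s => ((φ.val s s⁻¹ s)⁻¹ : kˣ)

theorem beta_mul_e (y t : G) : beta φ * e φ y t =
    ((φ.val (y⁻¹ * t * y) (y⁻¹ * t * y)⁻¹ (y⁻¹ * t * y))⁻¹ : kˣ).val • e φ y t :=
  incl_mul_e φ _ y t

/-- Common shape of both antipode axioms: S inverts degrees, so only the summands with c = a⁻¹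
contribute, and these occur in Δ(x ⊗ δ_s) only for s = 1. -/
theorem map_comul_e (L : TwistedDouble φ ⊗[k] TwistedDouble φ →ₗ[k] TwistedDouble φ) (x s : G)
    (F : G → TwistedDouble φ) (h : ∀ a c, L (e φ x a ⊗ₜ e φ x c) = if c = a⁻¹ then F a else 0) :
    L (comul φ (e φ x s)) = if s = 1 then ∑ a, (gam φ x a a⁻¹ : k) • F a else 0 := by
  rw [comul_e]
  simp only [map_sum, apply_ite L, map_smul, h, map_zero]
  rw [← Finset.sum_const_zero (s := (Finset.univ : Finset G)),
    ← apply_ite (fun f : G → TwistedDouble φ => ∑ c, f c) (s = 1)]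
  refine Finset.sum_congr rfl fun a _ => ?_
  rw [Finset.sum_eq_single a⁻¹]
  · by_cases hs : s = 1
    · simp [hs]
    · simp [hs, Ne.symm hs]
  · intro c _ hc
    simp [hc]
  · simp

theorem antipode_left (h : TwistedDouble φ) :
    TensorProduct.lift ((LinearMap.mul k _).compl₁₂
      (LinearMap.mulRight k 1 ∘ₗ (MulOpposite.opLinearEquiv k).symm.toLinearMap ∘ₗ
        (antipode φ).toLinearMap) LinearMap.id) (comul φ h) =
      counit φ h • (1 : TwistedDouble φ) := by
  induction h using induction with
  | h0 => simp
  | hadd a a' h h' => simp only [map_add, add_smul, h, h']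
  | hsmul r a h => simp only [map_smul, smul_eq_mul, mul_smul, h]
  | he x s =>
  rw [map_comul_e φ _ x s (fun a => (φ.sig x a * chi φ x x⁻¹ a⁻¹ : kˣ).val • e φ 1 a⁻¹)
    fun a c => ?_]
  · rw [counit_e, ite_smul, one_smul, zero_smul, one_def]
    refine if_congr Iff.rfl (Fintype.sum_equiv (Equiv.inv G) _ _ fun a => ?_) rfl
    -- `sig` is by definition the inverse of the remaining factors γ and χ.
    rw [smul_smul, ← Units.val_mul, ← mul_assoc, mul_right_comm, Cocycle₃.sig, mul_inv_cancel,
      Units.val_one, one_smul]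
    rfl
  · by_cases hc : c = a⁻¹
    · simp [hc, antipode_e, e_mul_e_eq, smul_smul]
    · simp [hc, antipode_e, e_mul_e_eq]

theorem antipode_right (h : TwistedDouble φ) :
    TensorProduct.lift ((LinearMap.mul k _).compl₁₂
      (LinearMap.mulRight k (beta φ))
      ((MulOpposite.opLinearEquiv k).symm.toLinearMap ∘ₗ (antipode φ).toLinearMap)) (comul φ h) =
      counit φ h • beta φ := by
  induction h using induction with
  | h0 => simp
  | hadd a a' h h' => simp only [map_add, add_smul, h, h']
  | hsmul r a h => simp only [map_smul, smul_eq_mul, mul_smul, h]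
  | he x s =>
  rw [map_comul_e φ _ x s (fun a => (φ.sig x a⁻¹ * (φ.val a a⁻¹ a)⁻¹ *
    chi φ x⁻¹ x (x⁻¹ * a * x) : kˣ).val • e φ 1 (x⁻¹ * a * x)) fun a c => ?_]
  · rw [counit_e, ite_smul, one_smul, zero_smul, beta, incl_apply]
    -- The term at a is a multiple of e ⊗ δ at x⁻¹ax; after this reindexing its coefficient is that
    -- of β, by `sig_inv`.
    refine if_congr Iff.rfl (Fintype.sum_equiv (MulAut.conj x⁻¹).toEquiv _ _ fun a => ?_) rfl
    have h1 : x⁻¹ * a⁻¹ * x = (x⁻¹ * a * x)⁻¹ := by group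
    rw [smul_smul, ← Units.val_mul, ← mul_assoc, ← mul_assoc, φ.sig_inv, h1]
    simp
  · have h1 : x⁻¹⁻¹ * (x⁻¹ * c⁻¹ * x) * x⁻¹ = c⁻¹ := by group
    simp only [TensorProduct.lift.tmul, LinearMap.compl₁₂_apply, LinearMap.mul_apply',
      LinearMap.mulRight_apply, LinearMap.comp_apply, LinearEquiv.coe_coe,
      AlgEquiv.toLinearMap_apply, MulOpposite.coe_opLinearEquiv_symm, antipode_e, mul_smul_comm]
    rw [mul_assoc (e φ x a), beta_mul_e, mul_smul_comm, e_mul_e_eq, h1]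
    by_cases h2 : c = a⁻¹
    · subst h2
      simp [smul_smul, mul_assoc]
    · have h3 : c⁻¹ ≠ a := fun h => h2 (inv_eq_iff_eq_inv.mp h)
      simp [h2, h3]

/-- Only the triples (x, x⁻¹, x) survive, and β was chosen inverse to φ(x, x⁻¹, x). -/
theorem antipode_phi :
    TensorProduct.lift ((LinearMap.mul k _).compl₁₂
      (LinearMap.mulRight k (beta φ))
      (TensorProduct.lift ((LinearMap.mul k _).compl₁₂
        (LinearMap.mulRight k 1 ∘ₗ (MulOpposite.opLinearEquiv k).symm.toLinearMap ∘ₗ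
          (antipode φ).toLinearMap) LinearMap.id))) (phi φ).val = 1 := by
  rw [phi_eq]
  simp [antipode_e, mul_assoc, e_mul_idem, beta_mul_e, smul_smul]
  rw [Finset.sum_comm, one_def]
  refine Fintype.sum_equiv (Equiv.inv G) _ _ fun y => ?_
  simp [← Units.val_mul]

theorem antipode_phi_inv :
    TensorProduct.lift ((LinearMap.mul k _).compl₁₂
      (LinearMap.mulRight k 1 ∘ₗ (MulOpposite.opLinearEquiv k).symm.toLinearMap ∘ₗ
        (antipode φ).toLinearMap)
      (TensorProduct.lift ((LinearMap.mul k _).compl₁₂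
        (LinearMap.mulRight k (beta φ))
        ((MulOpposite.opLinearEquiv k).symm.toLinearMap ∘ₗ
          (antipode φ).toLinearMap)))) (phi φ).inv = 1 := by
  rw [phi_inv_eq]
  simp [antipode_e, mul_assoc, e_mul_idem, beta_mul_e, smul_smul]
  rw [Finset.sum_comm, one_def]
  refine Finset.sum_congr rfl fun y _ => ?_
  rw [Finset.sum_eq_single y⁻¹, Finset.sum_eq_single y⁻¹]
  -- For the inverse associator the surviving triples are (y⁻¹, y, y⁻¹), so β cancels only by way of
  -- `cocycle_inv`.
  · have h : (φ.val y⁻¹ y y⁻¹)⁻¹ * (φ.val y y⁻¹ y)⁻¹ = 1 := by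
      rw [← mul_inv_rev, mul_comm, cocycle_inv, inv_one]
    simp [← Units.val_mul, h]
  · intro z _ hz
    have h : y ≠ z⁻¹ := fun h => hz (by rw [h, inv_inv])
    simp [h]
  · simp
  · intro x _ hx
    simp [inv_eq_iff_eq_inv, hx]
  · simp

/-- The quasitriangular quasi-Hopf algebra `D^φ(G)`. -/
noncomputable def quasiHopf : QuasitriangularQuasiHopfAlgebra k (TwistedDouble φ) where
  comul := comul φ
  counit := counit φ
  phi := phi φ
  quasi_coassoc := quasi_coassoc φ
  counit_left := counit_left φ
  counit_right := counit_right φ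
  cocycle := cocycle φ
  normalized := normalized φ
  S := antipode φ
  α := 1
  β := beta φ
  antipode_left := antipode_left φ
  antipode_right := antipode_right φ
  antipode_phi := antipode_phi φ
  antipode_phi_inv := antipode_phi_inv φ
  R := R φ
  quasi_cocomm := quasi_cocomm φ
  hexagon_fst := hexagon_fst φ
  hexagon_snd := hexagon_snd φ

end TwistedDouble
end QuasiHopf

/-! ### Modules over `k^φ(G)` as graded modules -/

namespace QuasiHopf

variable {k G : Type u} [CommRing k] [Group G] [Fintype G] [DecidableEq G] {φ : Cocycle₃ k G}

/-- The category of modules over `k^φ(G)`, that is of `G`-graded modules. -/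
abbrev FunMod (φ : Cocycle₃ k G) : Type (u + 1) := QMod (funAlg φ).toQuasiBialgebra

/-- The vector `v` is homogeneous of degree `a`. -/
def HasDegree (M : FunMod φ) (a : G) (v : M.V) : Prop := ∀ f, M.ρ f v = f a • v

theorem hasDegree_proj (M : FunMod φ) (a : G) (v : M.V) : HasDegree M a (M.ρ (δ k a) v) :=
  fun f => by
    rw [← Module.End.mul_apply, ← map_mul]
    have h : f * δ k a = f a • δ k a := by
      funext x
      simp only [Pi.mul_apply, Pi.smul_apply, δ_apply, smul_eq_mul]
      split_ifs with h <;> simp [h]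
    rw [h, map_smul, LinearMap.smul_apply]

theorem sum_proj (M : FunMod φ) (v : M.V) : ∑ a, M.ρ (δ k a) v = v := by
  rw [← LinearMap.sum_apply, ← map_sum, TwistedDouble.sum_δ, map_one, Module.End.one_apply]

theorem HasDegree.proj {M : FunMod φ} {a : G} {v : M.V} (h : HasDegree M a v) (s : G) :
    M.ρ (δ k s) v = if a = s then v else 0 := by
  rw [h, δ_apply]; split_ifs <;> simp

section Ext

variable {X : Type*} [AddCommGroup X] [Module k X]

/-- Every vector is the sum of its homogeneous components, since the delta-functions sum to 1. -/
theorem ext_degree {M : FunMod φ} {f g : M.V →ₗ[k] X}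
    (h : ∀ a v, HasDegree M a v → f v = g v) : f = g :=
  LinearMap.ext fun v => by
    rw [← sum_proj M v, map_sum, map_sum]
    exact Finset.sum_congr rfl fun a _ => h a _ (hasDegree_proj M a v)

theorem ext_degree₂ {M N : FunMod φ} {f g : M.V ⊗[k] N.V →ₗ[k] X}
    (h : ∀ a v b w, HasDegree M a v → HasDegree N b w → f (v ⊗ₜ w) = g (v ⊗ₜ w)) : f = g :=
  TensorProduct.ext (ext_degree fun a v hv => ext_degree fun b w hw => h a v b w hv hw)

end Ext

/-- The second algebra is arbitrary and acts through a character, so that applying the lemma twice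
covers threefold tensors and hence the associator. -/
theorem act_hasDegree {A : Type u} [Ring A] [Algebra k A] {W : Type u} [AddCommGroup W]
    [Module k W] {M : FunMod φ} {a : G} {v : M.V} (hv : HasDegree M a v)
    {r : A →ₐ[k] Module.End k W} {w : W} {e : A →ₐ[k] k} (hw : ∀ x, r x w = e x • w)
    (t : (G → k) ⊗[k] A) : act M.ρ r t (v ⊗ₜ w) = evt (ev k a) e t • (v ⊗ₜ w) := by
  induction t using TensorProduct.induction_on with
  | zero => simp
  | tmul f g => simp [hv f, hw g, ← TensorProduct.smul_tmul', TensorProduct.tmul_smul, smul_smul,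
      mul_comm]
  | add s t hs ht => simp only [map_add, LinearMap.add_apply, add_smul, hs, ht]

section Tm

variable {H : Type u} [Ring H] [Algebra k H] {Q : QuasiBialgebra k H} {M N P : QMod Q}

/-- The pure tensor `v ⊗ w` as an element of the tensor product of modules. -/
noncomputable def tm (v : M.V) (w : N.V) : (M ⊗ N).V := v ⊗ₜ[k] w

theorem tm_add (v : M.V) (w w' : N.V) : tm v (w + w') = tm v w + tm v w' :=
  TensorProduct.tmul_add v w w'

theorem add_tm (v v' : M.V) (w : N.V) : tm (v + v') w = tm v w + tm v' w :=
  TensorProduct.add_tmul v v' w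

theorem tm_smul (c : k) (v : M.V) (w : N.V) : tm v (c • w) = c • tm v w :=
  TensorProduct.tmul_smul c v w

theorem smul_tm (c : k) (v : M.V) (w : N.V) : tm (c • v) w = c • tm v w :=
  TensorProduct.smul_tmul' c v w

/-- The pure tensor as a bilinear map. -/
noncomputable def tmMap (M N : QMod Q) : M.V →ₗ[k] N.V →ₗ[k] (M ⊗ N).V :=
  LinearMap.mk₂ k tm add_tm smul_tm tm_add tm_smul

theorem tmMap_apply (v : M.V) (w : N.V) : tmMap M N v w = tm v w := rfl

theorem tm_sum {ι : Type*} (s : Finset ι) (v : M.V) (w : ι → N.V) :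
    tm v (∑ i ∈ s, w i) = ∑ i ∈ s, tm v (w i) := map_sum (tmMap M N v) w s

@[simp] theorem whiskerLeft_tm (f : N ⟶ P) (v : M.V) (w : N.V) :
    QMod.Hom.toLin (M ◁ f) (tm v w) = tm v (QMod.Hom.toLin f w) := rfl

@[simp] theorem whiskerRight_tm (f : M ⟶ P) (v : M.V) (w : N.V) :
    QMod.Hom.toLin (f ▷ N) (tm v w) = tm (QMod.Hom.toLin f v) w := rfl

theorem comp_toLin_apply (f : M ⟶ N) (g : N ⟶ P) (v : M.V) :
    QMod.Hom.toLin (f ≫ g) v = QMod.Hom.toLin g (QMod.Hom.toLin f v) := rfl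

theorem toLin_ρ (f : M ⟶ N) (h : H) (v : M.V) :
    QMod.Hom.toLin f (M.ρ h v) = N.ρ h (QMod.Hom.toLin f v) :=
  LinearMap.congr_fun (QMod.toLin_comm f h) v

theorem toLin_congr {f g : M ⟶ N} (h : f = g) (v : M.V) :
    QMod.Hom.toLin f v = QMod.Hom.toLin g v := by rw [h]

theorem toLin_hom_injective (f : M ≅ N) : Function.Injective (QMod.Hom.toLin f.hom) :=
  Function.LeftInverse.injective (g := QMod.Hom.toLin f.inv) fun v => by
    rw [← comp_toLin_apply, f.hom_inv_id]; rfl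

/-- Applying p to the first factor is a left inverse. With p evaluation at x and a = δ_x, this
permits cancelling delta-functions. -/
theorem tm_left_injective {p : M.V →ₗ[k] k} {a : M.V} (ha : p a = 1) :
    Function.Injective (tm (N := N) a) := fun v w h => by
  have := congrArg (fun t => TensorProduct.lid k N.V (TensorProduct.map p LinearMap.id t)) h
  simpa [ha, tm] using this

theorem tm_right_injective {p : M.V →ₗ[k] k} {a : M.V} (ha : p a = 1) :
    Function.Injective fun v : N.V => tm v a := fun _ _ h =>
  tm_left_injective ha (congrArg (TensorProduct.comm k N.V M.V) h)

variable {X : Type*} [AddCommGroup X] [Module k X]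

theorem tm_ext {f g : (M ⊗ N).V →ₗ[k] X} (h : ∀ v w, f (tm v w) = g (tm v w)) : f = g :=
  TensorProduct.ext' h

end Tm

section Ext

variable {X : Type*} [AddCommGroup X] [Module k X] {M N P : FunMod φ}

theorem tm_ext_degree {f g : (M ⊗ N).V →ₗ[k] X}
    (h : ∀ a v b w, HasDegree M a v → HasDegree N b w → f (tm v w) = g (tm v w)) : f = g :=
  ext_degree₂ h

theorem tm_ext_degree_right {f g : (M ⊗ (N ⊗ P)).V →ₗ[k] X}
    (h : ∀ a v b w c u, HasDegree M a v → HasDegree N b w → HasDegree P c u →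
      f (tm v (tm w u)) = g (tm v (tm w u))) : f = g :=
  TensorProduct.ext (ext_degree fun a v hv => ext_degree₂ fun b w c u hw hu =>
    h a v b w c u hv hw hu)

end Ext

theorem HasDegree.tm {M N : FunMod φ} {a b : G} {v : M.V} {w : N.V} (hv : HasDegree M a v)
    (hw : HasDegree N b w) : HasDegree (M ⊗ N) (a * b) (tm v w) := fun f => by
  have h := act_hasDegree hv (e := ev k b) hw (funComul k G f)
  have h' := AlgHom.congr_fun (evt_comp_funComul (k := k) a b) f
  rw [AlgHom.comp_apply, ev_apply] at h'
  rw [h'] at h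
  exact h

theorem associator_hom_tm {M N P : FunMod φ} {a b c : G} {v : M.V} {w : N.V} {u : P.V}
    (hv : HasDegree M a v) (hw : HasDegree N b w) (hu : HasDegree P c u) :
    QMod.Hom.toLin (α_ M N P).hom (tm (tm v w) u) = (φ.val a b c : k) • tm v (tm w u) := by
  have h := act_hasDegree hv (act_hasDegree hw (e := ev k c) hu) φ.unit.val
  rw [show evt (ev k a) (evt (ev k b) (ev k c)) φ.unit.val = φ.val a b c from
    evt_fun₃ _ a b c] at h
  exact h

theorem associator_inv_tm {M N P : FunMod φ} {a b c : G} {v : M.V} {w : N.V} {u : P.V}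
    (hv : HasDegree M a v) (hw : HasDegree N b w) (hu : HasDegree P c u) :
    QMod.Hom.toLin (α_ M N P).inv (tm v (tm w u)) =
      ((φ.val a b c)⁻¹ : kˣ).val • tm (tm v w) u := by
  apply toLin_hom_injective (α_ M N P)
  rw [map_smul, associator_hom_tm hv hw hu, smul_smul, ← Units.val_mul, inv_mul_cancel,
    ← comp_toLin_apply, Iso.inv_hom_id, Units.val_one, one_smul]
  rfl

theorem ρ_tm {M N : FunMod φ} {a : G} {v : M.V} (hv : HasDegree M a v) (w : N.V) (f : G → k) :
    (M ⊗ N).ρ f (tm v w) = tm v (N.ρ (fun b => f (a * b)) w) := by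
  have h : (M ⊗ N).ρ f ∘ₗ tmMap M N v =
      tmMap M N v ∘ₗ N.ρ (fun b => f (a * b)) := ext_degree fun b w hw => by
    rw [LinearMap.comp_apply, LinearMap.comp_apply, hw, map_smul, tmMap_apply, hv.tm hw]
  exact LinearMap.congr_fun h w

/-- The orbit map of a vector of a module. -/
noncomputable def orbitLin {H : Type u} [Ring H] [Algebra k H] {Q : QuasiBialgebra k H}
    (M : QMod Q) (v : M.V) : H →ₗ[k] M.V :=
  LinearMap.applyₗ v ∘ₗ M.ρ.toLinearMap

@[simp] theorem orbitLin_apply {H : Type u} [Ring H] [Algebra k H] {Q : QuasiBialgebra k H}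
    (M : QMod Q) (v : M.V) (h : H) : orbitLin M v h = M.ρ h v := rfl

/-- The orbit map of a vector, as a morphism from the regular module. -/
noncomputable def orbitMap {H : Type u} [Ring H] [Algebra k H] {Q : QuasiBialgebra k H}
    (M : QMod Q) (v : M.V) : QMod.regular Q ⟶ M :=
  ⟨orbitLin M v, fun h => LinearMap.ext fun (f : H) => by
    change M.ρ (h * f) v = M.ρ h (M.ρ f v)
    rw [map_mul, Module.End.mul_apply]⟩

/-- On a vector of degree x the orbit map is f ↦ f(x) w, so it factors through evaluation at x. -/
theorem map_orbitLin {W : FunMod φ} {V : Type u} [AddCommGroup V] [Module k V] {x : G} {w : W.V}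
    (hw : HasDegree W x w) (t : (G → k) ⊗[k] V) :
    TensorProduct.map (orbitLin W w) LinearMap.id t = w ⊗ₜ[k]
      TensorProduct.lid k V (TensorProduct.map (ev k x).toLinearMap LinearMap.id t) := by
  induction t using TensorProduct.induction_on with
  | zero => simp
  | tmul f v =>
    rw [TensorProduct.map_tmul, orbitLin_apply, hw]
    simp [TensorProduct.smul_tmul]
  | add s t hs ht => simp only [map_add, TensorProduct.tmul_add, hs, ht]

omit [Group G] [Fintype G] in
theorem ev_δ (x : G) : (ev k x).toLinearMap (δ k x) = 1 := by simp [δ_apply]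

/-- The regular module of `k^φ(G)`. -/
noncomputable abbrev funReg (φ : Cocycle₃ k G) : FunMod φ :=
  QMod.regular (funAlg φ).toQuasiBialgebra

/-- The delta-function as an element of the regular module. -/
noncomputable def regδ (φ : Cocycle₃ k G) (x : G) : (funReg φ).V := δ k x

theorem hasDegree_regδ (x : G) : HasDegree (funReg φ) x (regδ φ x) :=
  fun f => by
    have h : f * δ k x = f x • δ k x := by
      funext x
      simp only [Pi.mul_apply, Pi.smul_apply, δ_apply, smul_eq_mul]
      split_ifs with h <;> simp [h]
    exact h

theorem regδ_tm_injective {M : FunMod φ} (x : G) :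
    Function.Injective (tm (N := M) (regδ φ x)) :=
  tm_left_injective (M := funReg φ) (p := (ev k x).toLinearMap) (ev_δ x)

/-! ### Half-braidings as families of operators -/

namespace DoubleObj

variable (X Y : Center (FunMod φ))

/-- The operator `v ↦ ⟨x, β(v)⟩` on an object of the double category. -/
noncomputable def op (x : G) : X.1.V →ₗ[k] X.1.V :=
  (TensorProduct.lid k X.1.V).toLinearMap ∘ₗ
    TensorProduct.map (ev k x).toLinearMap LinearMap.id ∘ₗ
      QMod.Hom.toLin (X.2.β (QMod.regular (funAlg φ).toQuasiBialgebra)).hom ∘ₗ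
        (TensorProduct.mk k X.1.V (G → k)).flip 1

theorem op_apply (x : G) (v : X.1.V) : op X x v = TensorProduct.lid k X.1.V
    (TensorProduct.map (ev k x).toLinearMap LinearMap.id (coaction X v)) := rfl

variable {X Y}

/-- Naturality of the half-braiding along the orbit map k(G) → W, 1 ↦ w: the component at the
regular module determines all the others. -/
theorem braiding_tm {W : FunMod φ} {x : G} {w : W.V} (hw : HasDegree W x w) (v : X.1.V) :
    QMod.Hom.toLin (X.2.β W).hom (tm v w) = tm w (op X x v) := by
  have h := toLin_congr (X.2.naturality (orbitMap W w)) (tm v (1 : G → k))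
  have h1 : QMod.Hom.toLin (X.1 ◁ orbitMap W w ≫ (X.2.β W).hom) (tm v (1 : G → k)) =
      QMod.Hom.toLin (X.2.β W).hom (tm v w) := by
    change QMod.Hom.toLin (X.2.β W).hom (v ⊗ₜ[k] W.ρ 1 w) = _
    rw [map_one, Module.End.one_apply]
    rfl
  rw [h1] at h
  rw [h]
  exact map_orbitLin hw (coaction X v)

theorem op_hasDegree {s : G} {v : X.1.V} (hv : HasDegree X.1 s v) (x : G) :
    HasDegree X.1 (x⁻¹ * s * x) (op X x v) := fun f => by
  have hx := hasDegree_regδ (φ := φ) x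
  -- The shift by x⁻¹ compensates the degree x of δ_x, which stands in front of op_x(v) after the
  -- braiding.
  have h := toLin_ρ (X.2.β (funReg φ)).hom (fun b => f (x⁻¹ * b)) (tm v (regδ φ x))
  rw [hv.tm hx, map_smul, braiding_tm hx, ρ_tm hx] at h
  simp only [inv_mul_cancel_left] at h
  rw [← mul_assoc] at h
  apply regδ_tm_injective x
  rw [tm_smul]
  exact h.symm

/-- The half-braiding is invertible, and δ_x can be cancelled on either side of the tensor sign. -/
theorem op_injective (x : G) : Function.Injective (op X x) := fun v w h => by
  have hx := hasDegree_regδ (φ := φ) x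
  have h1 : tm v (regδ φ x) = tm w (regδ φ x) := by
    apply toLin_hom_injective (X.2.β (funReg φ))
    rw [braiding_tm hx, braiding_tm hx, h]
  exact tm_right_injective (M := funReg φ) (p := (ev k x).toLinearMap) (ev_δ x) h1

/-- The monoidality of the half-braiding, evaluated at v ⊗ (δ_y ⊗ δ_x). The three associators in it
produce the scalar inverse to χ. -/
theorem op_op {t : G} {v : X.1.V} (hv : HasDegree X.1 t v) (x y : G) :
    op X x (op X y v) = (chi φ y x t : k) • op X (y * x) v := by
  have hx := hasDegree_regδ (φ := φ) x
  have hy := hasDegree_regδ (φ := φ) y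
  have h := toLin_congr (X.2.monoidal (funReg φ) (funReg φ)) (tm v (tm (regδ φ y) (regδ φ x)))
  simp only [comp_toLin_apply] at h
  rw [braiding_tm (hy.tm hx), associator_inv_tm hv hy hx] at h
  simp only [map_smul, whiskerRight_tm, braiding_tm hy] at h
  rw [associator_hom_tm hy (op_hasDegree hv y) hx] at h
  simp only [map_smul, whiskerLeft_tm, braiding_tm hx] at h
  rw [associator_inv_tm hy hx (op_hasDegree (op_hasDegree hv y) x), smul_smul, smul_smul,
    ← tm_smul] at h
  -- Evaluation at (y, x) is the functional that lets δ_y ⊗ δ_x be cancelled.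
  have h1 : (evt (ev k y) (ev k x)).toLinearMap (tm (regδ φ y) (regδ φ x)) = 1 := by
    change evt (ev k y) (ev k x) (δ k y ⊗ₜ δ k x) = 1
    rw [evt_tmul]; simp [δ_apply]
  replace h := tm_left_injective (p := (evt (ev k y) (ev k x)).toLinearMap) h1 h
  have h2 : chi φ y x t * ((φ.val t y x)⁻¹ * φ.val y (y⁻¹ * t * y) x *
      (φ.val y x (x⁻¹ * (y⁻¹ * t * y) * x))⁻¹) = 1 := by
    apply Additive.ofMul.injective
    simp only [Cocycle₃.ofMul_chi, Cocycle₃.log, ofMul_mul, ofMul_inv, ofMul_one, mul_assoc]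
    abel
  rw [h, smul_smul]
  simp only [← Units.val_mul]
  rw [h2, Units.val_one, one_smul]

/-- By `op_op` this operator is idempotent, and an injective idempotent is the identity. -/
theorem op_one (v : X.1.V) : op X 1 v = v := by
  have h : op X 1 ∘ₗ op X 1 = op X 1 := ext_degree fun a v hv => by
    rw [LinearMap.comp_apply, op_op hv]
    simp
  exact op_injective 1 (LinearMap.congr_fun h v)

/-- The half-braiding of a tensor product passes through three associators, and the three values of
φ multiply to γ. -/
theorem op_tensor {a b : G} {v : X.1.V} {w : Y.1.V} (hv : HasDegree X.1 a v)
    (hw : HasDegree Y.1 b w) (x : G) :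
    op (X ⊗ Y) x (tm v w) = (gam φ x a b : k) • (tm (op X x v) (op Y x w)) := by
  have hx := hasDegree_regδ (φ := φ) x
  apply regδ_tm_injective (φ := φ) x
  have h : tm (regδ φ x) (op (X ⊗ Y) x (tm v w)) = QMod.Hom.toLin
      ((α_ X.1 Y.1 (funReg φ)).hom ≫ X.1 ◁ (Y.2.β (funReg φ)).hom ≫ (α_ _ _ _).inv ≫
        (X.2.β (funReg φ)).hom ▷ Y.1 ≫ (α_ _ _ _).hom) (tm (tm v w) (regδ φ x)) :=
    (braiding_tm (X := X ⊗ Y) hx (tm v w)).symm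
  simp only [comp_toLin_apply] at h
  rw [associator_hom_tm hv hw hx] at h
  simp only [map_smul, whiskerLeft_tm, braiding_tm hx] at h
  rw [associator_inv_tm hv hx (op_hasDegree hw x)] at h
  simp only [map_smul, whiskerRight_tm, braiding_tm hx] at h
  rw [associator_hom_tm hx (op_hasDegree hv x) (op_hasDegree hw x), smul_smul, smul_smul] at h
  have h1 : φ.val a b x * (φ.val a x (x⁻¹ * b * x))⁻¹ * φ.val x (x⁻¹ * a * x) (x⁻¹ * b * x) =
      gam φ x a b := by
    rw [gam, div_eq_mul_inv, mul_right_comm, mul_comm (φ.val a b x)]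
  rw [← Units.val_mul, ← Units.val_mul, h1] at h
  exact h.trans (tm_smul (M := funReg φ) (N := X.1 ⊗ Y.1) _ _ _).symm

theorem op_unit (x : G) (c : k) : op (𝟙_ (Center (FunMod φ))) x c = c := by
  have hx := hasDegree_regδ (φ := φ) x
  have h := braiding_tm (X := 𝟙_ (Center (FunMod φ))) hx c
  apply regδ_tm_injective (M := 𝟙_ (FunMod φ)) x
  refine h.symm.trans ?_
  change (TensorProduct.rid k (G → k)).symm (TensorProduct.lid k (G → k) (c ⊗ₜ δ k x)) = _
  rw [TensorProduct.lid_tmul, TensorProduct.rid_symm_apply, TensorProduct.smul_tmul, smul_eq_mul,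
    mul_one]
  rfl

theorem op_natural (f : X ⟶ Y) (x : G) (v : X.1.V) :
    QMod.Hom.toLin f.f (op X x v) = op Y x (QMod.Hom.toLin f.f v) := by
  have hx := hasDegree_regδ (φ := φ) x
  have h := toLin_congr (f.comm (funReg φ)) (tm v (regδ φ x))
  simp only [comp_toLin_apply, braiding_tm hx, whiskerLeft_tm, whiskerRight_tm] at h
  exact (regδ_tm_injective x h).symm

end DoubleObj

end QuasiHopf

/-! ### Objects of the double category as `D^φ(G)`-modules -/

namespace QuasiHopf

variable {k G : Type u} [CommRing k] [Group G] [Fintype G] [DecidableEq G] {φ : Cocycle₃ k G}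

theorem TwistedDouble.algHom_ext {B : Type*} [Semiring B] [Algebra k B]
    {f g : TwistedDouble φ →ₐ[k] B} (h : ∀ x s, f (e φ x s) = g (e φ x s)) : f = g :=
  AlgHom.ext fun d => by
    induction d using TwistedDouble.induction with
    | h0 => simp only [map_zero]
    | hadd a a' h h' => rw [map_add, map_add, h, h']
    | hsmul c a h => rw [map_smul, map_smul, h]
    | he x s => exact h x s

namespace DoubleObj

open TwistedDouble

variable (X Y : Center (FunMod φ))

/-- The action of `D^φ(G)` on an object of the double category, as a linear map. -/
noncomputable def repMap : TwistedDouble φ →ₗ[k] Module.End k X.1.V :=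
  (basis φ).constr k fun p => op X p.1 ∘ₗ X.1.ρ (δ k p.2)

theorem repMap_e (x s : G) (v : X.1.V) : repMap X (e φ x s) v = op X x (X.1.ρ (δ k s) v) := by
  rw [repMap, e, Module.Basis.constr_basis]; rfl

theorem repMap_e_hasDegree (x s : G) {r : G} {v : X.1.V} (hv : HasDegree X.1 r v) :
    repMap X (e φ x s) v = if r = s then op X x v else 0 := by
  rw [repMap_e, hv.proj]; split_ifs <;> simp

theorem repMap_one : repMap X 1 = 1 := ext_degree fun a v hv => by
  simp [one_def, LinearMap.sum_apply, repMap_e_hasDegree X 1 _ hv, op_one]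

/-- On a vector of degree r, `op_hasDegree` produces the support condition of the product and
`op_op` its coefficient. -/
theorem repMap_mul (a b : TwistedDouble φ) : repMap X (a * b) = repMap X a * repMap X b := by
  induction a using TwistedDouble.induction with
  | h0 => simp
  | hadd a a' h h' => rw [add_mul, map_add, map_add, add_mul, h, h']
  | hsmul c a h => rw [smul_mul_assoc, map_smul, map_smul, smul_mul_assoc, h]
  | he x s =>
    induction b using TwistedDouble.induction with
    | h0 => simp
    | hadd a a' h h' => rw [mul_add, map_add, map_add, mul_add, h, h']
    | hsmul c a h => rw [mul_smul_comm, map_smul, map_smul, mul_smul_comm, h]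
    | he y t =>
      refine ext_degree fun r v hv => ?_
      rw [Module.End.mul_apply, repMap_e_hasDegree X y t hv, e_mul_e_eq]
      by_cases h : r = t
      · subst h
        rw [if_pos rfl, repMap_e_hasDegree X x s (op_hasDegree hv y)]
        split_ifs
        · rw [map_smul, LinearMap.smul_apply, repMap_e_hasDegree X _ _ hv, if_pos rfl, op_op hv]
        · simp
      · rw [if_neg h, map_zero]
        split_ifs
        · rw [map_smul, LinearMap.smul_apply, repMap_e_hasDegree X _ _ hv, if_neg h, smul_zero]
        · simp

/-- The action of `D^φ(G)` on an object of the double category. -/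
noncomputable def rep : TwistedDouble φ →ₐ[k] Module.End k X.1.V :=
  AlgHom.ofLinearMap (repMap X) (repMap_one X) (repMap_mul X)

theorem rep_e (x s : G) (v : X.1.V) : rep X (e φ x s) v = op X x (X.1.ρ (δ k s) v) :=
  repMap_e X x s v

theorem rep_e_hasDegree (x s : G) {r : G} {v : X.1.V} (hv : HasDegree X.1 r v) :
    rep X (e φ x s) v = if r = s then op X x v else 0 := repMap_e_hasDegree X x s hv

theorem rep_incl (f : G → k) : rep X (incl φ f) = X.1.ρ f := ext_degree fun a v hv => by
  simp [incl_apply, LinearMap.sum_apply, rep_e_hasDegree X 1 _ hv, op_one, hv f]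

theorem rep_grp (x : G) : rep X (grp φ x) = op X x := ext_degree fun a v hv => by
  simp [grp, LinearMap.sum_apply, rep_e_hasDegree X x _ hv]

variable {X Y}

theorem rep_natural (f : X ⟶ Y) (d : TwistedDouble φ) (v : X.1.V) :
    QMod.Hom.toLin f.f (rep X d v) = rep Y d (QMod.Hom.toLin f.f v) := by
  induction d using TwistedDouble.induction with
  | h0 => simp
  | hadd a a' h h' => simp only [map_add, LinearMap.add_apply, h, h']
  | hsmul c a h => simp only [map_smul, LinearMap.smul_apply, h]
  | he x s => rw [rep_e, rep_e, op_natural, toLin_ρ]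

/-- Splitting w into homogeneous components shows that the half-braiding is given by the elements x
⊗ 1; this is the source of the formula for R. -/
theorem braiding_tm_sum (v : X.1.V) {W : FunMod φ} (w : W.V) :
    QMod.Hom.toLin (X.2.β W).hom (tm v w) = ∑ b, tm (W.ρ (δ k b) w) (op X b v) := by
  conv_lhs => rw [← sum_proj W w, tm_sum, map_sum]
  exact Finset.sum_congr rfl fun b _ => braiding_tm (hasDegree_proj _ b w) v

theorem braiding_hom_tm (v : X.1.V) (w : Y.1.V) :
    QMod.Hom.toLin (β_ X Y).hom.f (tm v w) =
      ∑ b, tm (rep Y (e φ 1 b) w) (rep X (grp φ b) v) := by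
  have h : ∀ b, rep Y (e φ 1 b) = Y.1.ρ (δ k b) := fun b => by rw [← incl_δ, rep_incl]
  simp only [h, rep_grp]
  exact braiding_tm_sum v w

/-- A linear map that commutes with the action of `D^φ(G)` is a morphism of the double
category. -/
noncomputable def homOfRep (l : X.1.V →ₗ[k] Y.1.V)
    (h : ∀ d v, l (rep X d v) = rep Y d (l v)) : X ⟶ Y where
  f := ⟨l, fun f => LinearMap.ext fun v => by
    have := h (incl φ f) v
    rwa [rep_incl, rep_incl] at this⟩
  comm U := QMod.hom_ext <| tm_ext fun v u => by
    rw [comp_toLin_apply, comp_toLin_apply, whiskerRight_tm, braiding_tm_sum, braiding_tm_sum,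
      map_sum]
    refine Finset.sum_congr rfl fun b _ => ?_
    rw [whiskerLeft_tm, ← rep_grp, ← rep_grp]
    exact congrArg _ (h _ v).symm

theorem hom_ext {f g : X ⟶ Y} (h : ∀ v, QMod.Hom.toLin f.f v = QMod.Hom.toLin g.f v) : f = g :=
  Center.ext _ _ (QMod.hom_ext (LinearMap.ext h))

/-- A linear equivalence that commutes with the action of `D^φ(G)` is an isomorphism of the
double category. -/
noncomputable def isoOfRep (l : X.1.V ≃ₗ[k] Y.1.V)
    (h : ∀ d v, l (rep X d v) = rep Y d (l v)) : X ≅ Y where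
  hom := homOfRep l.toLinearMap h
  inv := homOfRep l.symm.toLinearMap fun d v => by
    apply l.injective
    simp [h]
  hom_inv_id := hom_ext l.symm_apply_apply
  inv_hom_id := hom_ext l.apply_symm_apply

theorem act_comul_e {a b : G} {v : X.1.V} {w : Y.1.V} (hv : HasDegree X.1 a v)
    (hw : HasDegree Y.1 b w) (x s : G) :
    act (rep X) (rep Y) (comul φ (e φ x s)) (v ⊗ₜ w) =
      if a * b = s then (gam φ x a b : k) • (op X x v ⊗ₜ[k] op Y x w) else 0 := by
  -- The idempotents of degrees a and b fix v ⊗ w. Inserting them reduces Δ(x ⊗ δ_s) to a single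
  -- term.
  have h : act (rep X) (rep Y) (e φ 1 a ⊗ₜ e φ 1 b) (v ⊗ₜ w) = v ⊗ₜ w := by
    rw [act_tmul, TensorProduct.map_tmul, rep_e_hasDegree X 1 a hv, rep_e_hasDegree Y 1 b hw,
      if_pos rfl, if_pos rfl, op_one, op_one]
  conv_lhs => rw [← h, ← Module.End.mul_apply, ← map_mul, comul_e_mul_idem]
  split_ifs
  · rw [map_smul, LinearMap.smul_apply, act_tmul, TensorProduct.map_tmul,
      rep_e_hasDegree X x a hv, rep_e_hasDegree Y x b hw, if_pos rfl, if_pos rfl]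
  · rw [map_zero, LinearMap.zero_apply]

theorem rep_tensor : rep (X ⊗ Y) = (act (rep X) (rep Y)).comp (comul φ) :=
  algHom_ext (f := rep (X ⊗ Y)) fun x s => ext_degree₂ fun a v b w hv hw => by
    refine Eq.trans ?_ (act_comul_e hv hw x s).symm
    refine (rep_e_hasDegree (X ⊗ Y) x s (hv.tm hw)).trans ?_
    rw [op_tensor hv hw]
    rfl

theorem rep_unit (d : TwistedDouble φ) (c : k) :
    rep (𝟙_ (Center (FunMod φ))) d c = counit φ d * c := by
  induction d using TwistedDouble.induction with
  | h0 => simp only [map_zero, zero_mul]; rfl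
  | hadd a a' h h' => rw [map_add, map_add, add_mul, ← h, ← h']; rfl
  | hsmul r a h => rw [map_smul, map_smul, smul_mul_assoc, ← h]; rfl
  | he x s =>
    refine (rep_e (𝟙_ (Center (FunMod φ))) x s c).trans ?_
    refine (op_unit x (δ k s 1 * c)).trans ?_
    have h : δ k s (1 : G) = counit φ (e φ x s) := by
      rw [counit_e, δ_apply]
      by_cases h : s = 1 <;> simp [h, eq_comm]
    exact congrArg (· * c) h

end DoubleObj

end QuasiHopf

/-! ### The braided equivalence from `D^φ(G)`-modules to the double category -/

namespace QuasiHopf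

variable {k G : Type u} [CommRing k] [Group G] [Fintype G] [DecidableEq G] {φ : Cocycle₃ k G}

namespace TwistedDouble

/-- The category of modules over `D^φ(G)`. -/
abbrev DMod (φ : Cocycle₃ k G) : Type (u + 1) := QMod (quasiHopf φ).toQuasiBialgebra

/-- Restriction of a module over `D^φ(G)` to `k^φ(G)`. -/
noncomputable def res (M : DMod φ) : FunMod φ := ⟨M.V, M.ρ.comp (incl φ)⟩

/-- The action of `D^φ(G)` on the restriction of a module. -/
noncomputable def resRep (M : DMod φ) : TwistedDouble φ →ₐ[k] Module.End k (res M).V := M.ρ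

variable {M N : DMod φ} {W : FunMod φ}

theorem resRep_incl (f : G → k) : resRep M (incl φ f) = (res M).ρ f := rfl

theorem resRep_e_hasDegree {r : G} {v : (res M).V} (hv : HasDegree (res M) r v) (x s : G) :
    resRep M (e φ x s) v = if r = s then resRep M (grp φ x) v else 0 := by
  rw [← grp_mul_idem, map_mul, Module.End.mul_apply, ← incl_δ, resRep_incl, hv.proj]
  split_ifs <;> simp

/-- With `grp_grp`, this says that the action of x ⊗ 1 has the properties found for op_x, so it
defines a half-braiding. -/
theorem grp_hasDegree {r : G} {v : (res M).V} (hv : HasDegree (res M) r v) (x : G) :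
    HasDegree (res M) (x⁻¹ * r * x) (resRep M (grp φ x) v) := fun f => by
  have h := resRep_e_hasDegree hv x r
  rw [if_pos rfl] at h
  rw [← h, ← resRep_incl, ← Module.End.mul_apply, ← map_mul, incl_mul_e, map_smul]
  rfl

theorem grp_grp {t : G} {v : (res M).V} (hv : HasDegree (res M) t v) (x y : G) :
    resRep M (grp φ x) (resRep M (grp φ y) v) =
      (chi φ y x t : k) • resRep M (grp φ (y * x)) v := by
  have h := resRep_e_hasDegree hv y t
  have h' := resRep_e_hasDegree hv (y * x) t
  rw [if_pos rfl] at h h'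
  rw [← h, ← h', ← Module.End.mul_apply, ← map_mul, grp_mul_e, map_smul]
  rfl

theorem act_halfR {V : Type u} [AddCommGroup V] [Module k V]
    (p : TwistedDouble φ →ₐ[k] Module.End k V) {x : G} {w : W.V} (hw : HasDegree W x w) (v : V) :
    act p W.ρ (halfR φ).val (v ⊗ₜ w) = p (grp φ x) v ⊗ₜ w := by
  change act p W.ρ (∑ y, grp φ y ⊗ₜ δ k y) _ = _
  simp [map_sum, LinearMap.sum_apply, hw.proj, TensorProduct.tmul_ite]

/-- The half-braiding `v ⊗ w ↦ w ⊗ (|w| v)` on a module over `D^φ(G)`, as a linear map. -/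
noncomputable def halfBraidEquiv (M : DMod φ) (W : FunMod φ) :
    (res M ⊗ W).V ≃ₗ[k] (W ⊗ res M).V :=
  (actUnit (act (resRep M) W.ρ) (halfR φ)).trans (TensorProduct.comm k (res M).V W.V)

theorem halfBraidEquiv_tm (v : (res M).V) {x : G} {w : W.V} (hw : HasDegree W x w) :
    halfBraidEquiv M W (tm v w) = tm w (resRep M (grp φ x) v) :=
  congrArg (TensorProduct.comm k (res M).V W.V) (act_halfR (resRep M) hw v)

/-- The half-braiding on a module over `D^φ(G)`. -/
noncomputable def halfBraid (M : DMod φ) (W : FunMod φ) : res M ⊗ W ≅ W ⊗ res M :=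
  QMod.isoMk (halfBraidEquiv M W) fun f => tm_ext_degree fun a v b w hv hw => by
    have h := (hw.tm (grp_hasDegree hv b)) f
    rw [LinearMap.comp_apply, LinearMap.comp_apply, hv.tm hw, map_smul]
    change _ • halfBraidEquiv M W (tm v w) = (W ⊗ res M).ρ f (halfBraidEquiv M W (tm v w))
    rw [halfBraidEquiv_tm v hw]
    refine Eq.trans ?_ h.symm
    rw [mul_assoc b⁻¹, mul_inv_cancel_left]

theorem halfBraid_tm (v : (res M).V) {x : G} {w : W.V} (hw : HasDegree W x w) :
    QMod.Hom.toLin (halfBraid M W).hom (tm v w) = tm w (resRep M (grp φ x) v) :=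
  halfBraidEquiv_tm v hw

theorem halfBraid_monoidal (M : DMod φ) (U U' : FunMod φ) : (halfBraid M (U ⊗ U')).hom =
    (α_ _ _ _).inv ≫ ((halfBraid M U).hom ▷ U') ≫ (α_ _ _ _).hom ≫
      (U ◁ (halfBraid M U').hom) ≫ (α_ _ _ _).inv :=
  QMod.hom_ext <| tm_ext_degree_right fun t v y u x u' hv hu hu' => by
    -- The three associators of the monoidality axiom cancel the χ that arises when x ⊗ 1 and y ⊗ 1
    -- are composed: the computation of `op_op` in reverse.
    have h : (φ.val t y x)⁻¹ * φ.val y (y⁻¹ * t * y) x *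
        (φ.val y x (x⁻¹ * (y⁻¹ * t * y) * x))⁻¹ * chi φ y x t = 1 := by
      apply Additive.ofMul.injective
      simp only [Cocycle₃.ofMul_chi, Cocycle₃.log, ofMul_mul, ofMul_inv, ofMul_one, mul_assoc]
      abel
    simp only [comp_toLin_apply]
    rw [halfBraid_tm v (hu.tm hu'), associator_inv_tm hv hu hu']
    simp only [map_smul, whiskerRight_tm, halfBraid_tm _ hu]
    rw [associator_hom_tm hu (grp_hasDegree hv y) hu']
    simp only [map_smul, whiskerLeft_tm, halfBraid_tm _ hu']
    rw [associator_inv_tm hu hu' (grp_hasDegree (grp_hasDegree hv y) x), grp_grp hv, tm_smul,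
      smul_smul, smul_smul, smul_smul, ← Units.val_mul, ← Units.val_mul, ← Units.val_mul, h,
      Units.val_one, one_smul]

theorem halfBraid_natural (M : DMod φ) {U U' : FunMod φ} (f : U ⟶ U') :
    (res M ◁ f) ≫ (halfBraid M U').hom = (halfBraid M U).hom ≫ (f ▷ res M) :=
  QMod.hom_ext <| tm_ext_degree fun a v b w _ hw => by
    have hw' : HasDegree U' b (QMod.Hom.toLin f w) := fun g => by
      rw [← toLin_ρ, hw, map_smul]
    simp only [comp_toLin_apply]
    rw [whiskerLeft_tm, halfBraid_tm v hw', halfBraid_tm v hw, whiskerRight_tm]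

/-- The object of the double category defined by a module over `D^φ(G)`. -/
noncomputable def double (M : DMod φ) : Center (FunMod φ) :=
  ⟨res M, halfBraid M, halfBraid_monoidal M, halfBraid_natural M⟩

theorem op_double (M : DMod φ) (x : G) : DoubleObj.op (double M) x = M.ρ (grp φ x) :=
  LinearMap.ext fun v => by
    have hx := hasDegree_regδ (φ := φ) x
    apply regδ_tm_injective (M := res M) x
    exact (DoubleObj.braiding_tm (X := double M) hx v).symm.trans (halfBraid_tm v hx)

/-- The round trip returns the same representation on the same k-module. Fullness, essential
surjectivity and the monoidal structure then need only identity maps. -/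
theorem rep_double (M : DMod φ) : DoubleObj.rep (double M) = M.ρ :=
  algHom_ext (g := resRep M) fun x s => LinearMap.ext fun v => by
    refine (DoubleObj.rep_e (double M) x s v).trans ?_
    rw [op_double, ← grp_mul_idem, ← incl_δ, map_mul]
    rfl

variable (φ) in
/-- The functor from modules over `D^φ(G)` to the double category. -/
noncomputable def doubleFunctor : DMod φ ⥤ Center (FunMod φ) where
  obj := double
  map {M N} f := DoubleObj.homOfRep (X := double M) (Y := double N)
    (show M.V →ₗ[k] N.V from QMod.Hom.toLin f) fun d v => by rw [rep_double, rep_double]; exact toLin_ρ f d v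
  map_id _ := rfl
  map_comp _ _ := rfl

/-- The unit isomorphism of `doubleFunctor`. -/
noncomputable def doubleUnit :
    𝟙_ (Center (FunMod φ)) ≅ (doubleFunctor φ).obj (𝟙_ (DMod φ)) :=
  DoubleObj.isoOfRep (X := 𝟙_ (Center (FunMod φ))) (Y := double (𝟙_ (DMod φ)))
    (show k ≃ₗ[k] k from LinearEquiv.refl k k) fun d v => by
    rw [rep_double]; exact DoubleObj.rep_unit d v

/-- The tensor structure of `doubleFunctor`. -/
noncomputable def doubleTensor (M N : DMod φ) :
    (doubleFunctor φ).obj M ⊗ (doubleFunctor φ).obj N ≅ (doubleFunctor φ).obj (M ⊗ N) :=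
  DoubleObj.isoOfRep (X := double M ⊗ double N) (Y := double (M ⊗ N))
    (show M.V ⊗[k] N.V ≃ₗ[k] M.V ⊗[k] N.V from LinearEquiv.refl k (M.V ⊗[k] N.V)) fun d v => by
      rw [rep_double]
      refine (LinearMap.congr_fun (AlgHom.congr_fun DoubleObj.rep_tensor d) v).trans ?_
      rw [rep_double, rep_double]
      rfl

/-- The associator of `D^φ(G)` is the image of the one of `k^φ(G)`, which acts through restriction.
-/
theorem double_associator (M N P : DMod φ) :
    QMod.Hom.toLin (α_ (res M) (res N) (res P)).hom = QMod.Hom.toLin (α_ M N P).hom := by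
  change act (M.ρ.comp (incl φ)) (act (N.ρ.comp (incl φ)) (P.ρ.comp (incl φ))) φ.unit.val ∘ₗ
    (TensorProduct.assoc k M.V N.V P.V).toLinearMap =
      act M.ρ (act N.ρ P.ρ) (phi φ).val ∘ₗ (TensorProduct.assoc k M.V N.V P.V).toLinearMap
  congr 1
  have h : act (N.ρ.comp (incl φ)) (P.ρ.comp (incl φ)) =
    (act N.ρ P.ρ).comp (Algebra.TensorProduct.map (incl φ) (incl φ)) :=
      AlgHom.ext fun t => act_map _ _ _ _ t
  rw [h, act_map]
  rfl

/-- R is the image of `halfR`, whose second leg lies in k(G) and so needs only the grading of N. -/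
theorem double_braiding (M N : DMod φ) (v : M.V) (w : N.V) :
    QMod.Hom.toLin (β_ M N).hom (tm v w) =
      QMod.Hom.toLin (β_ (double M) (double N)).hom.f (tm (M := res M) (N := res N) v w) := by
  change TensorProduct.comm k M.V N.V (act M.ρ N.ρ (R φ).val (v ⊗ₜ w)) =
    TensorProduct.comm k M.V N.V (act M.ρ (N.ρ.comp (incl φ)) (halfR φ).val (v ⊗ₜ w))
  rw [← AlgHom.comp_id M.ρ, act_map]
  rfl

/-- The monoidal structure of `doubleFunctor`. -/
noncomputable def doubleCoreMonoidal : (doubleFunctor φ).CoreMonoidal where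
  εIso := doubleUnit
  μIso := doubleTensor
  μIso_hom_natural_left _ _ := rfl
  μIso_hom_natural_right _ _ := rfl
  associativity M N P := Center.ext _ _ <| QMod.hom_ext <| tm_ext fun t w => by
    have h := LinearMap.congr_fun (double_associator M N P) (tm t w)
    -- The tensor structure is the identity on underlying modules, but whiskering it leaves a tensor
    -- product of identities to remove.
    have h' := LinearMap.congr_fun (TensorProduct.map_id (R := k) (M := M.V) (N := N.V ⊗[k] P.V))
      (QMod.Hom.toLin (α_ (res M) (res N) (res P)).hom (tm t w))
    exact h.symm.trans h'.symm
  left_unitality _ := Center.ext _ _ <| QMod.hom_ext <| tm_ext fun _ _ => rfl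
  right_unitality _ := Center.ext _ _ <| QMod.hom_ext <| tm_ext fun _ _ => rfl

noncomputable instance : (doubleFunctor φ).Monoidal := doubleCoreMonoidal.toMonoidal

noncomputable instance : (doubleFunctor φ).Braided where
  braided M N := Center.ext _ _ <| QMod.hom_ext <| tm_ext fun v w => double_braiding M N v w

instance : (doubleFunctor φ).Faithful where
  map_injective h := QMod.hom_ext (congrArg (fun f => QMod.Hom.toLin f.f) h)

instance : (doubleFunctor φ).Full where
  map_surjective {M N} f := ⟨⟨QMod.Hom.toLin (M := res M) (N := res N) f.f, fun d =>
    LinearMap.ext fun v => by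
      have h := DoubleObj.rep_natural (X := double M) (Y := double N) f d v
      rw [rep_double, rep_double] at h
      exact h⟩, rfl⟩

/-- The module over `D^φ(G)` defined by an object of the double category. -/
noncomputable def ofDouble (X : Center (FunMod φ)) : DMod φ := ⟨X.1.V, DoubleObj.rep X⟩

instance : (doubleFunctor φ).EssSurj where
  mem_essImage X := ⟨ofDouble X, ⟨DoubleObj.isoOfRep (X := double (ofDouble X))
    (show X.1.V ≃ₗ[k] X.1.V from LinearEquiv.refl k _) fun d v => by
      rw [rep_double]; rfl⟩⟩

/-- `D^φ(G)` is a quantum double of `k^φ(G)`. -/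
noncomputable def quantumDouble (φ : Cocycle₃ k G) : QuantumDouble (funAlg φ) (quasiHopf φ) where
  F := doubleFunctor φ
  isEquivalence := {}
  θ M := LinearEquiv.refl k M.V
  natural _ _ := rfl
  tensor _ _ _ _ := rfl
  unit := rfl

end TwistedDouble

end QuasiHopf

/-! ### The comparison map to an arbitrary quantum double -/

namespace QuasiHopf

variable {k G : Type u} [CommRing k] [Group G] [Fintype G] [DecidableEq G] {φ : Cocycle₃ k G}
  {D : Type u} [Ring D] [Algebra k D] {T : QuasitriangularQuasiHopfAlgebra k D}

namespace QuantumDouble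

open TwistedDouble

variable (E : QuantumDouble (funAlg φ) T)

/-- The action of `D^φ(G)` on the modules over a quantum double of `k^φ(G)`. -/
noncomputable def tr (N : QMod T.toQuasiBialgebra) : TwistedDouble φ →ₐ[k] Module.End k N.V :=
  (LinearEquiv.conjAlgEquiv k (E.θ N)).toAlgHom.comp (DoubleObj.rep (E.F.obj N))

variable {E}

theorem tr_θ (N : QMod T.toQuasiBialgebra) (d : TwistedDouble φ) (v : (E.F.obj N).1.V) :
    E.tr N d (E.θ N v) = E.θ N (DoubleObj.rep (E.F.obj N) d v) := by
  change E.θ N (DoubleObj.rep (E.F.obj N) d ((E.θ N).symm (E.θ N v))) = _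
  rw [LinearEquiv.symm_apply_apply]

/-- Morphisms of the double category are `D^φ(G)`-linear and θ is natural, so each d acts as a
natural endomorphism of the underlying k-module. -/
theorem tr_natural {M N : QMod T.toQuasiBialgebra} (f : M ⟶ N) (d : TwistedDouble φ) (v : M.V) :
    QMod.Hom.toLin f (E.tr M d v) = E.tr N d (QMod.Hom.toLin f v) := by
  obtain ⟨v, rfl⟩ := (E.θ M).surjective v
  rw [tr_θ, ← E.natural, ← E.natural, tr_θ, DoubleObj.rep_natural]

variable (T) in
/-- The unit as an element of the regular module. -/
def regOne : (QMod.regular T.toQuasiBialgebra).V := (1 : D)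

theorem orbitMap_regOne (N : QMod T.toQuasiBialgebra) (v : N.V) :
    QMod.Hom.toLin (orbitMap N v) (regOne T) = v := by
  change N.ρ 1 v = v
  rw [map_one, Module.End.one_apply]

variable (E)

/-- The linear map underlying `comparison`. -/
noncomputable def comparisonMap : TwistedDouble φ →ₗ[k] D :=
  LinearMap.applyₗ (regOne T) ∘ₗ (E.tr (QMod.regular T.toQuasiBialgebra)).toLinearMap

/-- Naturality along the orbit map 1 ↦ v from the regular module: a natural endomorphism is
determined by its value at 1. -/
theorem ρ_comparisonMap (N : QMod T.toQuasiBialgebra) (d : TwistedDouble φ) :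
    N.ρ (E.comparisonMap d) = E.tr N d := LinearMap.ext fun v => by
  have h := tr_natural (E := E) (orbitMap N v) d (regOne T)
  rw [orbitMap_regOne] at h
  exact h

/-- The comparison map from `D^φ(G)` to a quantum double of `k^φ(G)`. -/
noncomputable def comparison : TwistedDouble φ →ₐ[k] D :=
  AlgHom.ofLinearMap E.comparisonMap
    (by
      change E.tr _ 1 (regOne T) = _
      rw [map_one]
      rfl)
    fun a b => by
      change E.tr _ (a * b) (regOne T) = _
      rw [map_mul, ← ρ_comparisonMap, ← ρ_comparisonMap]
      change E.comparisonMap a * (E.comparisonMap b * 1) = _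
      rw [mul_one]

theorem ρ_comparison (N : QMod T.toQuasiBialgebra) (d : TwistedDouble φ) :
    N.ρ (E.comparison d) = E.tr N d := E.ρ_comparisonMap N d

variable (φ) in
/-- The regular module of `D^φ(G)`, as an object of the double category. -/
noncomputable def doubleReg : Center (FunMod φ) :=
  double (QMod.regular (quasiHopf φ).toQuasiBialgebra)

variable (φ) in
/-- The unit of `D^φ(G)`, as an element of the regular module. -/
noncomputable def doubleRegOne : (doubleReg φ).1.V := (1 : TwistedDouble φ)

theorem rep_doubleReg (d v : TwistedDouble φ) :
    DoubleObj.rep (doubleReg φ) d (show (doubleReg φ).1.V from v) = d * v :=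
  LinearMap.congr_fun (AlgHom.congr_fun (rep_double (QMod.regular _)) d) v

theorem rep_doubleRegOne (d : TwistedDouble φ) :
    DoubleObj.rep (doubleReg φ) d (doubleRegOne φ) = d :=
  (rep_doubleReg d _).trans (mul_one d)

/-- The orbit map of a vector of an object of the double category. -/
noncomputable def doubleOrbitMap (X : Center (FunMod φ)) (v : X.1.V) : doubleReg φ ⟶ X :=
  DoubleObj.homOfRep (X := doubleReg φ)
    (show TwistedDouble φ →ₗ[k] X.1.V from
      LinearMap.applyₗ v ∘ₗ (DoubleObj.rep X).toLinearMap) fun d d' => by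
    refine (congrArg _ (rep_doubleReg d d')).trans ?_
    exact LinearMap.congr_fun (map_mul (DoubleObj.rep X) d d') v

theorem doubleOrbitMap_one (X : Center (FunMod φ)) (v : X.1.V) :
    QMod.Hom.toLin (doubleOrbitMap X v).f (doubleRegOne φ) = v :=
  LinearMap.congr_fun (map_one (DoubleObj.rep X)) v

theorem exists_iso : ∃ (N : QMod T.toQuasiBialgebra), Nonempty (E.F.obj N ≅ doubleReg φ) :=
  have := E.isEquivalence
  ⟨E.F.objPreimage (doubleReg φ), ⟨E.F.objObjPreimageIso _⟩⟩

theorem center_inv_hom {X Y : Center (FunMod φ)} (i : X ≅ Y) (v : Y.1.V) :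
    QMod.Hom.toLin i.hom.f (QMod.Hom.toLin i.inv.f v) = v :=
  toLin_congr (congrArg Center.Hom.f i.inv_hom_id) v

theorem center_hom_inv {X Y : Center (FunMod φ)} (i : X ≅ Y) (v : X.1.V) :
    QMod.Hom.toLin i.inv.f (QMod.Hom.toLin i.hom.f v) = v :=
  toLin_congr (congrArg Center.Hom.f i.hom_inv_id) v

/-- Choose N whose image is the regular `D^φ(G)`-module. Acting on its generator `w₀` recovers d
from `comparison d`, whence injectivity. For surjectivity, j(d w₀) is a preimage of d: the two
elements of D agree on `w₀`, and a map to the regular D-module carries `w₀` to 1. -/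
theorem comparison_bijective : Function.Bijective E.comparison := by
  obtain ⟨N, ⟨i⟩⟩ := E.exists_iso
  have := E.isEquivalence
  -- `w₀` corresponds to the unit of `D^φ(G)`
  let j : N.V → TwistedDouble φ := fun w => QMod.Hom.toLin i.hom.f ((E.θ N).symm w)
  let w₀ : N.V := E.θ N (QMod.Hom.toLin i.inv.f (doubleRegOne φ))
  have hj : Function.Injective j := fun v w h => by
    have h' := congrArg (QMod.Hom.toLin i.inv.f) h
    rw [center_hom_inv, center_hom_inv] at h'
    exact (E.θ N).symm.injective h'
  have hΨ : ∀ d, j (N.ρ (E.comparison d) w₀) = d := fun d => by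
    rw [ρ_comparison, tr_θ]
    change QMod.Hom.toLin i.hom.f ((E.θ N).symm (E.θ N _)) = d
    rw [LinearEquiv.symm_apply_apply, DoubleObj.rep_natural, center_inv_hom, rep_doubleRegOne]
  refine ⟨fun a b h => by rw [← hΨ a, ← hΨ b, h], fun d => ⟨j (N.ρ d w₀), ?_⟩⟩
  let X := E.F.obj (QMod.regular T.toQuasiBialgebra)
  let x : X.1.V := (E.θ (QMod.regular T.toQuasiBialgebra)).symm (regOne T)
  -- Freeness of the regular object in the double category gives a map sending its generator to x,
  -- the vector matching 1 in D; fullness lifts it to D-modules.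
  let g : N ⟶ QMod.regular T.toQuasiBialgebra := E.F.preimage (i.hom ≫ doubleOrbitMap X x)
  have hg : QMod.Hom.toLin g w₀ = regOne T := by
    rw [← E.natural, E.F.map_preimage]
    change E.θ _ (QMod.Hom.toLin (doubleOrbitMap X x).f (QMod.Hom.toLin i.hom.f
      (QMod.Hom.toLin i.inv.f (doubleRegOne φ)))) = _
    rw [center_inv_hom, doubleOrbitMap_one]
    exact LinearEquiv.apply_symm_apply _ _
  have h := congrArg (QMod.Hom.toLin g) (hj (hΨ (j (N.ρ d w₀))))
  rw [toLin_ρ, toLin_ρ, hg] at h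
  have h1 : ∀ c : D, (QMod.regular T.toQuasiBialgebra).ρ c (regOne T) = c := fun c => mul_one c
  rwa [h1, h1] at h

end QuantumDouble

end QuasiHopf

/-! ### Transport of coproduct, counit, R-matrix and associator -/

namespace QuasiHopf

variable {k G : Type u} [CommRing k] [Group G] [Fintype G] [DecidableEq G] {φ : Cocycle₃ k G}
  {D : Type u} [Ring D] [Algebra k D] {T : QuasitriangularQuasiHopfAlgebra k D}

namespace QuantumDouble

open TwistedDouble Functor.LaxMonoidal

attribute [local instance] QuantumDouble.braided

section Evaluation

variable {A B C : Type u} [Ring A] [Algebra k A] [Ring B] [Algebra k B] [Ring C] [Algebra k C]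

/-- On tensor products of regular modules an element is recovered from its action on 1 ⊗ 1. The
structure elements of D are read off in this way. -/
theorem act_lmul (t u : A ⊗[k] B) : act (Algebra.lmul k A) (Algebra.lmul k B) t u = t * u := by
  induction t using TensorProduct.induction_on with
  | zero => simp
  | add s t hs ht => simp only [map_add, LinearMap.add_apply, add_mul, hs, ht]
  | tmul a b =>
    induction u using TensorProduct.induction_on with
    | zero => simp
    | add s t hs ht => simp only [map_add, mul_add, hs, ht]
    | tmul c d => simp

theorem act_lmul₃ (t u : A ⊗[k] (B ⊗[k] C)) :
    act (Algebra.lmul k A) (act (Algebra.lmul k B) (Algebra.lmul k C)) t u = t * u := by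
  have h : act (Algebra.lmul k B) (Algebra.lmul k C) = Algebra.lmul k (B ⊗[k] C) :=
    AlgHom.ext fun t => LinearMap.ext fun u => act_lmul t u
  rw [h, act_lmul]

variable {U V W X Y : Type u} [AddCommGroup U] [Module k U] [AddCommGroup V] [Module k V]
  [AddCommGroup W] [Module k W] [AddCommGroup X] [Module k X] [AddCommGroup Y] [Module k Y]

theorem map_comp_left {f : V →ₗ[k] W} {g : W →ₗ[k] X} {f' : V →ₗ[k] X} (h : g ∘ₗ f = f')
    (p : U →ₗ[k] Y) (t : V ⊗[k] U) :
    TensorProduct.map g p (TensorProduct.map f LinearMap.id t) = TensorProduct.map f' p t := by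
  rw [← LinearMap.comp_apply, ← TensorProduct.map_comp, h, LinearMap.comp_id]

theorem map_comp_right {f : V →ₗ[k] W} {g : W →ₗ[k] X} {f' : V →ₗ[k] X} (h : g ∘ₗ f = f')
    (p : U →ₗ[k] Y) (t : U ⊗[k] V) :
    TensorProduct.map p g (TensorProduct.map LinearMap.id f t) = TensorProduct.map p f' t := by
  rw [← LinearMap.comp_apply, ← TensorProduct.map_comp, h, LinearMap.comp_id]

omit [Group G] in
theorem act_fun₃ (p : (G → k) →ₐ[k] Module.End k U) (q : (G → k) →ₐ[k] Module.End k V)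
    (r : (G → k) →ₐ[k] Module.End k W) (F : G → G → G → k) (u : U) (v : V) (w : W) :
    act p (act q r) (fun₃ F) (u ⊗ₜ (v ⊗ₜ w)) = ∑ x, ∑ y, ∑ z,
      F x y z • (p (δ k x) u ⊗ₜ[k] (q (δ k y) v ⊗ₜ[k] r (δ k z) w)) := by
  simp only [fun₃, map_sum, map_smul, LinearMap.sum_apply, LinearMap.smul_apply, act_tmul,
    TensorProduct.map_tmul]

end Evaluation

variable (E : QuantumDouble (funAlg φ) T)

/-- The tensor structure of the functor, as a linear map. -/
noncomputable def muLin (M N : QMod T.toQuasiBialgebra) :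
    (E.F.obj M).1.V ⊗[k] (E.F.obj N).1.V →ₗ[k] (E.F.obj (M ⊗ N)).1.V :=
  QMod.Hom.toLin (μ E.F M N).f

theorem θ_muLin (M N : QMod T.toQuasiBialgebra) :
    (E.θ (M ⊗ N)).toLinearMap ∘ₗ E.muLin M N =
      TensorProduct.map (E.θ M).toLinearMap (E.θ N).toLinearMap :=
  TensorProduct.ext' fun v w => E.tensor M N v w

theorem act_tr (M N : QMod T.toQuasiBialgebra) (t : TwistedDouble φ ⊗[k] TwistedDouble φ) :
    TensorProduct.map (E.θ M).toLinearMap (E.θ N).toLinearMap ∘ₗ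
      act (DoubleObj.rep (E.F.obj M)) (DoubleObj.rep (E.F.obj N)) t =
    act (E.tr M) (E.tr N) t ∘ₗ TensorProduct.map (E.θ M).toLinearMap (E.θ N).toLinearMap :=
  act_natural (fun d => LinearMap.ext fun v => (tr_θ M d v).symm)
    (fun d => LinearMap.ext fun v => (tr_θ N d v).symm) t

/-- The tensor structure of the functor is a morphism of the double category, hence `D^φ(G)`-linear,
and θ turns it into the identity on pure tensors. -/
theorem tr_tensor (M N : QMod T.toQuasiBialgebra) (d : TwistedDouble φ) :
    E.tr (M ⊗ N) d = act (E.tr M) (E.tr N) (comul φ d) := by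
  have h1 := LinearMap.congr_fun (E.θ_muLin M N)
  have h2 := LinearMap.congr_fun (E.act_tr M N (comul φ d))
  have h3 : Function.Surjective
      (TensorProduct.map (E.θ M).toLinearMap (E.θ N).toLinearMap) :=
    TensorProduct.map_surjective (E.θ M).surjective (E.θ N).surjective
  refine LinearMap.ext fun x => ?_
  obtain ⟨x, rfl⟩ := h3 x
  refine Eq.trans ?_ (h2 x)
  refine (congrArg _ (h1 x).symm).trans ?_
  refine (tr_θ (M ⊗ N) d (E.muLin M N x)).trans ?_
  refine (congrArg (E.θ (M ⊗ N)) (DoubleObj.rep_natural (μ E.F M N) d x).symm).trans ?_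
  rw [DoubleObj.rep_tensor]
  exact h1 _

theorem comul_comparison (d : TwistedDouble φ) : T.comul (E.comparison d) =
    Algebra.TensorProduct.map E.comparison E.comparison (comul φ d) := by
  let M := QMod.regular T.toQuasiBialgebra
  have h := E.ρ_comparison (M ⊗ M) d
  have h1 : E.tr M = M.ρ.comp E.comparison := AlgHom.ext fun d => (E.ρ_comparison M d).symm
  rw [tr_tensor, h1, act_map] at h
  have h2 := LinearMap.congr_fun h (1 : D ⊗[k] D)
  have h3 : T.comul (E.comparison d) * 1 =
      Algebra.TensorProduct.map E.comparison E.comparison (comul φ d) * 1 :=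
    (act_lmul _ _).symm.trans (h2.trans (act_lmul _ _))
  rwa [mul_one, mul_one] at h3

theorem counit_comparison (d : TwistedDouble φ) : T.counit (E.comparison d) = counit φ d := by
  let u : k →ₗ[k] (E.F.obj (𝟙_ _)).1.V := QMod.Hom.toLin (ε E.F).f
  have h : E.tr (𝟙_ _) d (E.θ (𝟙_ _) (u 1)) = E.θ (𝟙_ _) (u (counit φ d * 1)) := by
    rw [tr_θ]
    refine congrArg _ ?_
    -- The unit map of the functor is `D^φ(G)`-linear, and on the unit object d acts by ε(d).
    refine (DoubleObj.rep_natural (ε E.F) d (1 : k)).symm.trans ?_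
    exact congrArg u (DoubleObj.rep_unit d (1 : k))
  have hu : E.θ (𝟙_ _) (u 1) = (1 : k) := E.unit
  rw [← smul_eq_mul, map_smul, map_smul, hu, ← ρ_comparison] at h
  have h' : T.counit (E.comparison d) * 1 = counit φ d * 1 := h
  rwa [mul_one, mul_one] at h'

/-- The functor is braided; applying θ to that square removes the tensor structure maps and leaves
the action of the R-matrix of D. -/
theorem braiding_θ (M N : QMod T.toQuasiBialgebra)
    (x : (E.F.obj M).1.V ⊗[k] (E.F.obj N).1.V) :
    TensorProduct.map (E.θ N).toLinearMap (E.θ M).toLinearMap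
        (QMod.Hom.toLin (β_ (E.F.obj M) (E.F.obj N)).hom.f x) =
      TensorProduct.comm k M.V N.V (act M.ρ N.ρ T.R.val
        (TensorProduct.map (E.θ M).toLinearMap (E.θ N).toLinearMap x)) := by
  have h := toLin_congr (congrArg Center.Hom.f (Functor.LaxBraided.braided (F := E.F) M N)) x
  have h1 := LinearMap.congr_fun (E.θ_muLin M N) x
  have h2 := LinearMap.congr_fun (E.θ_muLin N M)
    (QMod.Hom.toLin (β_ (E.F.obj M) (E.F.obj N)).hom.f x)
  have h3 := E.natural (β_ M N).hom (E.muLin M N x)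
  refine h2.symm.trans ((congrArg (E.θ (N ⊗ M)) h).symm.trans (h3.trans ?_))
  exact congrArg (QMod.Hom.toLin (β_ M N).hom) h1

theorem R_comparison : T.R.val =
    Algebra.TensorProduct.map E.comparison E.comparison (R φ).val := by
  let M := QMod.regular T.toQuasiBialgebra
  let x₁ := (E.θ M).symm (regOne T)
  have hx : E.θ M x₁ = regOne T := LinearEquiv.apply_symm_apply _ _
  have htr : ∀ d, E.tr M d (regOne T) = E.comparison d := fun d => rfl
  have h := E.braiding_θ M M (x₁ ⊗ₜ x₁)
  have h1 : QMod.Hom.toLin (β_ (E.F.obj M) (E.F.obj M)).hom.f (x₁ ⊗ₜ x₁) =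
      ∑ b, DoubleObj.rep (E.F.obj M) (e φ 1 b) x₁ ⊗ₜ[k]
        DoubleObj.rep (E.F.obj M) (grp φ b) x₁ := DoubleObj.braiding_hom_tm x₁ x₁
  rw [h1, map_sum] at h
  simp only [TensorProduct.map_tmul, LinearEquiv.coe_coe, ← tr_θ, hx, htr] at h
  -- At 1 ⊗ 1 the braiding of D-modules gives R with its legs flipped; the braiding of the double
  -- category gives the flipped image of ∑ (x ⊗ 1) ⊗ (e ⊗ δ_x).
  have h2 : act M.ρ M.ρ T.R.val (regOne T ⊗ₜ regOne T) = T.R.val :=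
    (act_lmul T.R.val 1).trans (mul_one _)
  apply (TensorProduct.comm k D D).injective
  refine (congrArg (TensorProduct.comm k D D) h2).symm.trans (h.symm.trans ?_)
  rw [R_val]
  simp only [map_sum, Algebra.TensorProduct.map_tmul, TensorProduct.comm_tmul]
  rfl

theorem associator_θ (M N P : QMod T.toQuasiBialgebra)
    (x : ((E.F.obj M).1.V ⊗[k] (E.F.obj N).1.V) ⊗[k] (E.F.obj P).1.V) :
    TensorProduct.map (E.θ M).toLinearMap
        (TensorProduct.map (E.θ N).toLinearMap (E.θ P).toLinearMap)
        (QMod.Hom.toLin (α_ (E.F.obj M).1 (E.F.obj N).1 (E.F.obj P).1).hom x) =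
      QMod.Hom.toLin (α_ M N P).hom
        (TensorProduct.map (TensorProduct.map (E.θ M).toLinearMap (E.θ N).toLinearMap)
          (E.θ P).toLinearMap x) := by
  have h := toLin_congr (congrArg Center.Hom.f (associativity E.F M N P)) x
  have h1 := (LinearMap.congr_fun (E.θ_muLin (M ⊗ N) P)
    (TensorProduct.map (E.muLin M N) LinearMap.id x)).trans
      (map_comp_left (E.θ_muLin M N) (E.θ P).toLinearMap x)
  have h2 := (LinearMap.congr_fun (E.θ_muLin M (N ⊗ P)) (TensorProduct.map LinearMap.id
    (E.muLin N P) (QMod.Hom.toLin (α_ (E.F.obj M).1 (E.F.obj N).1 (E.F.obj P).1).hom x))).trans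
      (map_comp_right (E.θ_muLin N P) (E.θ M).toLinearMap _)
  have h3 := E.natural (α_ M N P).hom
    (E.muLin (M ⊗ N) P (TensorProduct.map (E.muLin M N) LinearMap.id x))
  refine h2.symm.trans ((congrArg (E.θ (M ⊗ (N ⊗ P))) h).symm.trans (h3.trans ?_))
  exact congrArg (QMod.Hom.toLin (α_ M N P).hom) h1

/-- The associator of the double category is that of the graded modules, hence given by φ on
homogeneous components. Comparing at 1 ⊗ 1 ⊗ 1 in the regular module yields the associator of D. -/
theorem phi_comparison : T.phi.val = Algebra.TensorProduct.map E.comparison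
    (Algebra.TensorProduct.map E.comparison E.comparison) (phi φ).val := by
  let M := QMod.regular T.toQuasiBialgebra
  let x₁ := (E.θ M).symm (regOne T)
  have hx : E.θ M x₁ = regOne T := LinearEquiv.apply_symm_apply _ _
  have htr : ∀ d, E.tr M d (regOne T) = E.comparison d := fun d => rfl
  have h := E.associator_θ M M M ((x₁ ⊗ₜ x₁) ⊗ₜ x₁)
  have h1 : QMod.Hom.toLin (α_ (E.F.obj M).1 (E.F.obj M).1 (E.F.obj M).1).hom
      ((x₁ ⊗ₜ x₁) ⊗ₜ x₁) = ∑ x, ∑ y, ∑ z, (φ.val x y z : k) •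
        ((E.F.obj M).1.ρ (δ k x) x₁ ⊗ₜ[k] ((E.F.obj M).1.ρ (δ k y) x₁ ⊗ₜ[k]
          (E.F.obj M).1.ρ (δ k z) x₁)) := act_fun₃ _ _ _ _ x₁ x₁ x₁
  have h2 : QMod.Hom.toLin (α_ M M M).hom ((regOne T ⊗ₜ regOne T) ⊗ₜ regOne T) = T.phi.val :=
    (act_lmul₃ T.phi.val 1).trans (mul_one _)
  replace h := (congrArg (TensorProduct.map (E.θ M).toLinearMap
    (TensorProduct.map (E.θ M).toLinearMap (E.θ M).toLinearMap)) h1).symm.trans h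
  simp only [map_sum, map_smul, TensorProduct.map_tmul, LinearEquiv.coe_coe, ← DoubleObj.rep_incl,
    incl_δ, ← tr_θ, hx, htr] at h
  refine h2.symm.trans (h.symm.trans ?_)
  rw [phi_eq]
  simp only [map_sum, map_smul, Algebra.TensorProduct.map_tmul]
  rfl

end QuantumDouble

end QuasiHopf

/-! ### The basis of an arbitrary quantum double and the conclusion -/

namespace QuasiHopf

namespace QuantumDouble

variable {k G : Type u} [CommRing k] [Group G] [Fintype G] [DecidableEq G] {φ : Cocycle₃ k G}
  {D : Type u} [Ring D] [Algebra k D] {T : QuasitriangularQuasiHopfAlgebra k D}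

open TwistedDouble

/-- The basis `x ⊗ δ_s` of a quantum double of `k^φ(G)`. -/
noncomputable def basis (E : QuantumDouble (funAlg φ) T) : Module.Basis (G × G) k D :=
  (TwistedDouble.basis φ).map
    (LinearEquiv.ofBijective E.comparison.toLinearMap E.comparison_bijective)

theorem basis_apply (E : QuantumDouble (funAlg φ) T) (x s : G) :
    E.basis (x, s) = E.comparison (e φ x s) := by
  rw [basis, Module.Basis.map_apply]; rfl

end QuantumDouble

end QuasiHopf

open QuasiHopf in
theorem proposition4p2 {k G : Type u} [Field k] [Group G] [Fintype G] [DecidableEq G]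
    (φ : Cocycle₃ k G) :
    (∃ (D : Type u) (_ : Ring D) (_ : Algebra k D) (T : QuasitriangularQuasiHopfAlgebra k D),
      Nonempty (QuantumDouble (funAlg φ) T)) ∧
    ∀ (D : Type u) [Ring D] [Algebra k D] (T : QuasitriangularQuasiHopfAlgebra k D)
      (E : QuantumDouble (funAlg φ) T),
      -- `b (x, s)` is the element `x ⊗ δ_s`
      ∃ b : Module.Basis (G × G) k D,
        (∀ x s y t : G, b (x, s) * b (y, t) =
          if y * s * y⁻¹ = t then (chi φ y x t : k) • b (y * x, t) else 0) ∧
        (1 : D) = ∑ s : G, b (1, s) ∧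
        (∀ x s : G, T.comul (b (x, s)) =
          ∑ a : G, ∑ c : G, if a * c = s then
            (gam φ x a c : k) • (b (x, a) ⊗ₜ[k] b (x, c)) else 0) ∧
        (∀ x s : G, T.counit (b (x, s)) = if s = 1 then 1 else 0) ∧
        T.phi.val = ∑ x : G, ∑ y : G, ∑ z : G,
          (φ.val x y z : k) • (b (1, x) ⊗ₜ[k] (b (1, y) ⊗ₜ[k] b (1, z))) ∧
        T.R.val = ∑ x : G, (∑ s : G, b (x, s)) ⊗ₜ[k] b (1, x) ∧
        -- the action of `x ⊗ δ_s` is `v ↦ ⟨x, β(δ_s v)⟩`, where `β` is the coaction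
        (∀ (M : QMod T.toQuasiBialgebra) (v : (E.F.obj M).1.V) (x s : G),
          M.ρ (b (x, s)) (E.θ M v) =
            E.θ M (TensorProduct.lid k (E.F.obj M).1.V
              (TensorProduct.map (ev k x).toLinearMap LinearMap.id
                (coaction (E.F.obj M) ((E.F.obj M).1.ρ (δ k s) v))))) := by
  -- Existence is witnessed by `D^φ(G)` itself. For a general D the basis is the image of x ⊗ δ_s
  -- under `comparison`, and each formula is pushed forward along this isomorphism.
  refine ⟨⟨TwistedDouble φ, inferInstance, inferInstance, TwistedDouble.quasiHopf φ,
    ⟨TwistedDouble.quantumDouble φ⟩⟩, fun D _ _ T E => ⟨E.basis, ?_, ?_, ?_, ?_, ?_, ?_, ?_⟩⟩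
  · intro x s y t
    simp only [E.basis_apply]
    rw [← map_mul, TwistedDouble.e_mul_e, apply_ite E.comparison, map_smul, map_zero]
  · simp only [E.basis_apply]
    rw [← map_sum, ← TwistedDouble.one_def, map_one]
  · intro x s
    simp only [E.basis_apply]
    rw [E.comul_comparison, TwistedDouble.comul_e]
    simp only [map_sum, apply_ite (Algebra.TensorProduct.map E.comparison E.comparison), map_smul,
      map_zero, Algebra.TensorProduct.map_tmul]
  · intro x s
    rw [E.basis_apply, E.counit_comparison, TwistedDouble.counit_e]
  · simp only [E.basis_apply]
    rw [E.phi_comparison, TwistedDouble.phi_eq]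
    simp only [map_sum, map_smul, Algebra.TensorProduct.map_tmul]
  · simp only [E.basis_apply]
    rw [E.R_comparison, TwistedDouble.R_val]
    simp only [map_sum, TwistedDouble.grp, Algebra.TensorProduct.map_tmul]
  · intro M v x s
    rw [E.basis_apply, E.ρ_comparison, QuantumDouble.tr_θ, DoubleObj.rep_e, DoubleObj.op_apply]
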